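/- Let $\mathcal G_0$ be the set of right continuous nondecreasing maps $g:[0,1)\to[0,1]$, extended by $g(1):=1$, equipped with the metric $\|g_1-g_0\|_{L^2}=\big(\int_0^1|g_1(t)-g_0(t)|^2dt\big)^{1/2}$ and its Borel $\sigma$-algebra. Let $\beta>0$ and let $\mathbb Q_0=\mathbb Q_0^\beta$ be the Dirichlet process, i.e. the probability measure on $\mathcal G_0$ such that for all $0=t_0<t_1<\dots<t_N<t_{N+1}=1$ the vector $(g(t_1),\dots,g(t_N))$ has, on $\{0=x_0<x_1<\dots<x_N<x_{N+1}=1\}$, the Lebesgue density $$\frac{\Gamma(\beta)}{\prod_{i=0}^{N}\Gamma(\beta(t_{i+1}-t_i))}\prod_{i=0}^{N}(x_{i+1}-x_i)^{\beta(t_{i+1}-t_i)-1}$$ (and density $0$ elsewhere). Let $\mathfrak Z^1(\mathcal G_0)$ be the class of functions $u(g)=U\big(\int_0^1\alpha_1(g_s)ds,\dots,\int_0^1\alpha_m(g_s)ds\big)$ with $m\in\mathbb N$, $U\in C^1(\mathbb R^m)$, $\alpha_i\in C^1([0,1])$, and put $$\mathbb D u(g)(t)=\sum_{i=1}^m\partial_iU\Big(\int_0^1\vec\alpha(g_s)ds\Big)\,\alpha_i'(g_t).$$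 Let $(\overline{\mathbb D},\mathrm{Dom}(\overline{\mathbb D}))$ be the closure of $(\mathbb D,\mathfrak Z^1(\mathcal G_0))$ as an operator from $L^2(\mathcal G_0,\mathbb Q_0)$ to $L^2(\mathcal G_0\times[0,1],\mathbb Q_0\otimes\mathrm{Leb})$. The Wasserstein Dirichlet form is $$\mathbb E(u,v)=\int_{\mathcal G_0}\Gamma(u,v)\,d\mathbb Q_0,\qquad \Gamma(u,v)(g)=\langle\overline{\mathbb D}u(g),\overline{\mathbb D}v(g)\rangle_{L^2([0,1])},\qquad u,v\in\mathrm{Dom}(\mathbb E)=\mathrm{Dom}(\overline{\mathbb D}).$$ Then the intrinsic metric of $(\mathbb E,\mathrm{Dom}(\mathbb E))$ is the $L^2$-metric: for all $g_0,g_1\in\mathcal G_0$, $$\|g_1-g_0\|_{L^2}=\sup\big\{u(g_1)-u(g_0):\ u\in C(\mathcal G_0)\cap\mathrm{Dom}(\mathbb E),\ \Gamma(u,u)\le1\ \ \mathbb Q_0\text{-a.e. on }\mathcal G_0\big\}.$$ Hence it is the $L^2$-Wasserstein distance $d_W$ on $\mathcal P([0,1])$: for all $\mu,\nu\in\mathcal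 P([0,1])$, $$d_W(\mu,\nu)=\sup\big\{u(g_\nu)-u(g_\mu):\ u\in C(\mathcal G_0)\cap\mathrm{Dom}(\mathbb E),\ \Gamma(u,u)\le1\ \ \mathbb Q_0\text{-a.e. on }\mathcal G_0\big\},$$ where $g_\mu(t)=\inf\{s\in[0,1]:\mu([0,s])>t\}$ (with $\inf\emptyset=1$) is the inverse distribution function of $\mu$ and $d_W(\mu,\nu)=\inf_\gamma\big(\iint|x-y|^2\gamma(dx,dy)\big)^{1/2}$, the infimum being over all couplings $\gamma$ of $\mu$ and $\nu$. -/

import Mathlib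

open MeasureTheory Set Topology
open scoped unitInterval NNReal ENNReal

noncomputable section

/-- The space `𝒢₀` of right continuous nondecreasing maps `g : [0,1[ → [0,1]`, each of them being
extended to `[0,1]` by `g(1) = 1`. -/
structure G0 where
  toFun : I → I
  monotone' : Monotone toFun
  rightContinuous' : ∀ t, ContinuousWithinAt toFun (Ici t) t
  map_one' : toFun 1 = 1

namespace G0

instance : CoeFun G0 fun _ => I → I := ⟨G0.toFun⟩

theorem measurable_coe (g : G0) : Measurable fun t : I => (g t : ℝ) :=
  measurable_subtype_coe.comp g.monotone'.measurable

theorem memLp (g : G0) : MemLp (fun t : I => (g t : ℝ)) 2 (volume : Measure I) :=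
  MemLp.of_bound g.measurable_coe.aestronglyMeasurable 1
    (Filter.Eventually.of_forall fun t => by
      rw [Real.norm_of_nonneg (g t).2.1]; exact (g t).2.2)

/-- `g ∈ 𝒢₀` as an element of `L²([0,1], Leb)`. -/
def toL2 (g : G0) : Lp ℝ 2 (volume : Measure I) := g.memLp.toLp _

theorem toL2_injective : Function.Injective toL2 := by
  intro f g h
  have key : ∀ t, f t = g t := by
    intro t
    have h1 : (fun t : I => (f t : ℝ)) =ᵐ[volume] fun t => (g t : ℝ) :=
      (MemLp.toLp_eq_toLp_iff _ _).1 h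
    rcases eq_or_lt_of_le (show t ≤ 1 from t.2.2) with rfl | ht
    · rw [f.map_one', g.map_one']
    have hd : ∃ᶠ s in 𝓝[≥] t, f s = g s := by
      rw [(nhdsGE_basis_of_exists_gt ⟨1, ht⟩).frequently_iff]
      intro u hu
      by_contra! hc
      have h2 : volume {s : I | ¬ ((f s : ℝ) = g s)} = 0 := h1
      have h3 : volume (Ico t u) = 0 := measure_mono_null (fun s hs => by
        simpa [Subtype.ext_iff] using hc s hs) h2
      simp at h3
      exact absurd h3 (not_le.2 hu)
    have hc : Filter.Tendsto (fun s => (f s, g s)) (𝓝[≥] t) (𝓝 (f t, g t)) :=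
      (f.rightContinuous' t).prodMk_nhds (g.rightContinuous' t)
    by_contra hne
    have ho : ∀ᶠ s in 𝓝[≥] t, f s ≠ g s :=
      hc.eventually ((isOpen_ne_fun continuous_fst continuous_snd).mem_nhds hne)
    exact (hd.and_eventually ho).exists.elim fun s hs => hs.2 hs.1
  cases f
  cases g
  congr
  exact funext key

/-- `𝒢₀` carries the `L²`-distance `‖g - h‖_{L²}`, with its topology and Borel `σ`-algebra. -/
instance : MetricSpace G0 := MetricSpace.induced toL2 toL2_injective inferInstance

instance : MeasurableSpace G0 := borel G0

instance : BorelSpace G0 := ⟨rfl⟩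

end G0

/-! ### The Dirichlet process -/

/-- `(x₁, …, x_N) ↦ (x₀, x₁, …, x_N, x_{N+1})` with `x₀ = 0` and `x_{N+1} = 1`. -/
def withEndpoints {N : ℕ} (x : Fin N → ℝ) : Fin (N + 2) → ℝ :=
  Fin.cons (α := fun _ => ℝ) 0 (Fin.snoc (α := fun _ => ℝ) x 1)

open Classical in
/-- The density
`Γ(β) / ∏ᵢ Γ(β (tᵢ₊₁ - tᵢ)) · ∏ᵢ (xᵢ₊₁ - xᵢ) ^ (β (tᵢ₊₁ - tᵢ) - 1)`, `i = 0, …, N`,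
on the simplex `0 < x₁ < ⋯ < x_N < 1`, extended by zero. -/
def dirichletDensity (β : ℝ) {N : ℕ} (t x : Fin N → ℝ) : ℝ :=
  if StrictMono (withEndpoints x) then
    Real.Gamma β /
        (∏ i : Fin (N + 1),
          Real.Gamma (β * (withEndpoints t i.succ - withEndpoints t i.castSucc))) *
      ∏ i : Fin (N + 1),
        (withEndpoints x i.succ - withEndpoints x i.castSucc) ^
          (β * (withEndpoints t i.succ - withEndpoints t i.castSucc) - 1)
  else 0

/-- `Q` is a probability measure on `𝒢₀` for which, for all `0 < t₁ < ⋯ < t_N < 1`, the vector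
`(g(t₁), …, g(t_N))` has the density `dirichletDensity β t` with respect to Lebesgue measure. -/
structure IsDirichletProcess (β : ℝ) (Q : Measure G0) : Prop where
  isProbabilityMeasure : IsProbabilityMeasure Q
  map_eval : ∀ (N : ℕ) (t : Fin N → I), StrictMono (withEndpoints fun i => (t i : ℝ)) →
    Q.map (fun (g : G0) (i : Fin N) => (g (t i) : ℝ)) =
      (volume : Measure (Fin N → ℝ)).withDensity
        fun x => ENNReal.ofReal (dirichletDensity β (fun i => (t i : ℝ)) x)

/-- The Dirichlet process `ℚ₀^β`: the probability measure on `𝒢₀` with the finite dimensional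
distributions above. -/
def dirichletProcess (β : ℝ) : Measure G0 := Classical.epsilon (IsDirichletProcess β)

/-! ### The Wasserstein Dirichlet form -/

/-- `∫ α(g_s) ds ∈ ℝ^m`. -/
def moments {m : ℕ} (α : Fin m → ℝ → ℝ) (g : G0) : Fin m → ℝ :=
  fun i => ∫ s : I, α i (g s)

/-- The cylinder function `u(g) = U(∫ α(g_s) ds)`. -/
def cylinderFunction {m : ℕ} (U : (Fin m → ℝ) → ℝ) (α : Fin m → ℝ → ℝ) (g : G0) : ℝ :=
  U (moments α g)

/-- The `L²`-gradient `𝔻u(g)(t) = ∑ᵢ ∂ᵢU(∫ α(g_s) ds) αᵢ'(g_t)` of a cylinder function. -/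
def cylinderGradient {m : ℕ} (U : (Fin m → ℝ) → ℝ) (α : Fin m → ℝ → ℝ) (p : G0 × I) : ℝ :=
  ∑ i, fderiv ℝ U (moments α p.1) (Pi.single i 1) * deriv (α i) (p.1 p.2)

/-- The pairs `(u, 𝔻u)` with `u` in the class `ℨ¹(𝒢₀)` of cylinder functions
`u(g) = U(∫ α(g_s) ds)`, `U ∈ C¹(ℝ^m)`, `αᵢ ∈ C¹([0,1])`. (A `C¹` function on `[0,1]` is the
restriction of a `C¹` function on `ℝ`; only the values of `αᵢ` and `αᵢ'` on `[0,1]` enter.) -/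
def cylinderGraph (β : ℝ) :
    Set (Lp ℝ 2 (dirichletProcess β) ×
      Lp ℝ 2 ((dirichletProcess β).prod (volume : Measure I))) :=
  {p | ∃ (m : ℕ) (U : (Fin m → ℝ) → ℝ) (α : Fin m → ℝ → ℝ),
    ContDiff ℝ 1 U ∧ (∀ i, ContDiff ℝ 1 (α i)) ∧
    p.1 =ᵐ[dirichletProcess β] cylinderFunction U α ∧
    p.2 =ᵐ[(dirichletProcess β).prod (volume : Measure I)] cylinderGradient U α}

/-- The operator `𝔻 : ℨ¹(𝒢₀) → L²(𝒢₀ × [0,1], ℚ₀ ⊗ Leb)`, as an unbounded operator on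
`L²(𝒢₀, ℚ₀)`. Since `ℨ¹(𝒢₀)` is a vector space and `𝔻` is linear, the span below
is the graph itself. -/
def wassersteinGradient (β : ℝ) :
    Lp ℝ 2 (dirichletProcess β) →ₗ.[ℝ]
      Lp ℝ 2 ((dirichletProcess β).prod (volume : Measure I)) :=
  (Submodule.span ℝ (cylinderGraph β)).toLinearPMap

/-- The closure `(𝔻̅, Dom(𝔻̅))` of `(𝔻, ℨ¹(𝒢₀))`. The domain of the Wasserstein Dirichlet form,
i.e. of the closure of `𝔼(u,v) = ∫ ⟨𝔻u(g), 𝔻v(g)⟩_{L²} dℚ₀(g)` on `ℨ¹(𝒢₀)`,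
is `Dom(𝔼) = Dom(𝔻̅)`. -/
def closedGradient (β : ℝ) :
    Lp ℝ 2 (dirichletProcess β) →ₗ.[ℝ]
      Lp ℝ 2 ((dirichletProcess β).prod (volume : Measure I)) :=
  (wassersteinGradient β).closure

/-- The domain `Dom(𝔼)` of the Wasserstein Dirichlet form. -/
def formDomain (β : ℝ) : Submodule ℝ (Lp ℝ 2 (dirichletProcess β)) := (closedGradient β).domain

/-- The square field operator `Γ(u,v)(g) = ⟨𝔻̅u(g), 𝔻̅v(g)⟩_{L²(Leb)}`. -/
def squareField {β : ℝ} (u v : formDomain β) (g : G0) : ℝ :=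
  ∫ t : I, closedGradient β u (g, t) * closedGradient β v (g, t)

/-- The Wasserstein Dirichlet form `𝔼(u,v) = ∫ Γ(u,v) dℚ₀` on `Dom(𝔼)`. -/
def wassersteinForm {β : ℝ} (u v : formDomain β) : ℝ :=
  ∫ g, squareField u v g ∂(dirichletProcess β)

/-- The functions admitted in the definition of the intrinsic metric of `𝔼`: continuous functions
`u` on `𝒢₀` which belong to `Dom(𝔼)` and satisfy `Γ(u,u) ≤ 1` almost everywhere. -/
def intrinsicFunctions (β : ℝ) : Set (G0 → ℝ) :=
  {u | Continuous u ∧ ∃ w : formDomain β,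
    (w : Lp ℝ 2 (dirichletProcess β)) =ᵐ[dirichletProcess β] u ∧
    ∀ᵐ g ∂(dirichletProcess β), squareField w w g ≤ 1}

/-! ### Probability measures on `[0,1]` -/

/-- The `L²`-Wasserstein distance on `𝒫([0,1])`. -/
def wassersteinDist (μ ν : ProbabilityMeasure I) : ℝ :=
  sInf {r : ℝ | ∃ γ : Measure (I × I), γ.map Prod.fst = μ ∧ γ.map Prod.snd = ν ∧
    r = Real.sqrt (∫ p, ((p.1 : ℝ) - (p.2 : ℝ)) ^ 2 ∂γ)}

/-- The inverse distribution function `g_μ(t) = inf {s ∈ [0,1] : μ[0,s] > t}` with `inf ∅ = 1`. -/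
def inverseCDF (μ : ProbabilityMeasure I) : G0 where
  toFun t := sInf {s : I | (t : ℝ) < (μ : Measure I).real (Iic s)}
  monotone' := fun t t' h => sInf_le_sInf fun s (hs : (t' : ℝ) < _) =>
    lt_of_le_of_lt (show (t : ℝ) ≤ t' from h) hs
  rightContinuous' := by
    intro t
    refine tendsto_order.2 ⟨fun a ha => ?_, fun a ha => ?_⟩
    · filter_upwards [self_mem_nhdsWithin] with t' ht'
      exact lt_of_lt_of_le ha
        (sInf_le_sInf fun s (hs : (t' : ℝ) < _) =>
          lt_of_le_of_lt (show (t : ℝ) ≤ t' from ht') hs)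
    · obtain ⟨s, hs, hsa⟩ := sInf_lt_iff.1 ha
      have : ∀ᶠ t' : I in 𝓝 t, (t' : ℝ) < (μ : Measure I).real (Iic s) :=
        continuous_subtype_val.continuousAt.eventually (gt_mem_nhds hs)
      filter_upwards [nhdsWithin_le_nhds this] with t' ht'
      exact lt_of_le_of_lt (sInf_le ht') hsa
  map_one' := by
    have : {s : I | ((1 : I) : ℝ) < (μ : Measure I).real (Iic s)} = ∅ := by
      ext s
      simp
    rw [this, sInf_empty]
    rfl

end

open ProbabilityTheory

noncomputable section

/-! ### Product measures with densities -/

/-! The argument rests on one family of transformations of 𝒢₀. `G0.reweight` multiplies the measure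
dg by a positive step function w, constant on the cells of a uniform grid, and normalizes the total
mass to 1. The increments of the Dirichlet process are normalized independent gamma variables
(`map_pi_gammaMeasure`), and scaling a gamma variable changes its law by an explicit density. Hence
the image of ℚ₀ under a reweighting with m ≤ w ≤ M is at most (m/M)^(-β) ℚ₀, a constant that does
not see the grid (`IsDirichletProcess.map_reweight_le`).

The weights (1 - s) + s w produce a path from g to its reweighting. It runs along the straight
segment in L², at a nonnegative speed of total integral 1 (`G0.coe_pathMap`). The fundamental
theorem of calculus along this path is elementary for cylinder functions. By the bound on image
measures both of its sides are continuous from L² to L¹ as functions of (u, 𝔻u), so it persists on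
the closure of the graph of 𝔻 (`gradientGraph_flow`).

Closability (`gradientGraph_snd_eq_zero`): if u = 0, then with weights 2 on [0, b) and 1 elsewhere
the formula forces the limit gradient V(g) to be orthogonal to g(t ∧ b) - g(b) g(t), for every grid
point b. These vectors are total in the relevant sense when g is strictly increasing, which is
almost surely the case, so V = 0.

Upper bound (`sub_le_dist_of_mem_intrinsicFunctions`): if Γ(u,u) ≤ 1, Cauchy-Schwarz in the formula
gives u(Θg) - u(g) ≤ ‖Θg - g‖ for almost every g and every reweighting Θ (`gradientGraph_sub_le`).
Given g₀ and g₁, weights are chosen that carry slightly perturbed grid values of g₀ to those of g₁.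
Since ℚ₀ charges every neighbourhood in the simplex of grid values, there are good points g near g₀
with Θg near g₁, and continuity of u concludes.

Lower bound (`inner_toL2_mem_intrinsicFunctions`): take u(g) = ⟨φ, g⟩ with φ the normalized
difference g₁ - g₀; its gradient is the constant vector φ. This u is not a cylinder function, since
φ depends on t and not on g(t). For continuous φ with primitive Ψ one has ∫ φ g = const - ∫
Ψ(g⁻¹(x)) dx, and g⁻¹(x) = Leb{g ≤ x} is approximated by smooth moments of g
(`continuous_linear_mem_gradientGraph`). Density of continuous functions gives the rest.

The Wasserstein statement follows since the monotone coupling (g_μ, g_ν) is optimal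
(`wassersteinDist_eq`). As ℚ₀ is specified only by its marginals, its existence is proved as well
(`exists_isDirichletProcess`). -/

theorem lintegral_pi_prod_eq_prod {n : ℕ} (μ : Fin n → Measure ℝ) [∀ i, SigmaFinite (μ i)]
    (f : Fin n → ℝ → ℝ≥0∞) (hf : ∀ i, Measurable (f i)) :
    ∫⁻ x, ∏ i, f i (x i) ∂Measure.pi μ = ∏ i, ∫⁻ y, f i y ∂μ i := by
  induction n with
  | zero => simp
  | succ n ih =>
    have h := measurePreserving_piFinSuccAbove μ 0
    rw [← h.symm.lintegral_comp_emb (MeasurableEquiv.measurableEmbedding _)]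
    have : ∀ z : ℝ × (Fin n → ℝ), ∏ i, f i ((MeasurableEquiv.piFinSuccAbove (fun _ => ℝ) 0).symm z i)
        = f 0 z.1 * ∏ i : Fin n, f i.succ (z.2 i) := by
      intro z
      rw [Fin.prod_univ_succ]
      simp [MeasurableEquiv.piFinSuccAbove, Fin.insertNthEquiv]
    simp_rw [this]
    rw [lintegral_prod_mul (g := fun x : Fin n → ℝ => ∏ i : Fin n, f i.succ (x i))
      (hf 0).aemeasurable (Finset.measurable_prod _ fun (i : Fin n) _ =>
        (hf i.succ).comp (measurable_pi_apply i)).aemeasurable,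
      Fin.prod_univ_succ]
    congr 1
    exact ih (fun i => μ i.succ) (fun i => f i.succ) fun i => hf _

theorem pi_withDensity {n : ℕ} (f : Fin n → ℝ → ℝ≥0∞) (hf : ∀ i, Measurable (f i))
    [∀ i, SigmaFinite ((volume : Measure ℝ).withDensity (f i))] :
    Measure.pi (fun i => (volume : Measure ℝ).withDensity (f i)) =
      (volume : Measure (Fin n → ℝ)).withDensity fun x => ∏ i, f i (x i) := by
  refine Measure.pi_eq fun s hs => ?_
  rw [withDensity_apply _ (MeasurableSet.univ_pi hs), ← lintegral_indicator (MeasurableSet.univ_pi hs)]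
  have : (fun x : Fin n → ℝ => (univ.pi s).indicator (fun x => ∏ i, f i (x i)) x)
      = fun x => ∏ i, (s i).indicator (f i) (x i) := by
    funext x
    by_cases hx : x ∈ univ.pi s
    · rw [indicator_of_mem hx]
      exact Finset.prod_congr rfl fun i _ => (indicator_of_mem (hx i trivial) _).symm
    · rw [indicator_of_notMem hx]
      simp only [mem_univ_pi, not_forall] at hx
      obtain ⟨i, hi⟩ := hx
      exact (Finset.prod_eq_zero (Finset.mem_univ i) (indicator_of_notMem hi _)).symm
  rw [this, volume_pi, lintegral_pi_prod_eq_prod _ _ fun i => (hf i).indicator (hs i)]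
  exact Finset.prod_congr rfl fun i _ => by
    rw [withDensity_apply _ (hs i), lintegral_indicator (hs i)]

/-! ### The difference map -/

/-- The increments `x_{i+1} - x_i`, `i = 0, …, N`, where `x₀ = 0` and `x_{N+1} = 1`. -/
def increments {N : ℕ} (x : Fin N → ℝ) (i : Fin (N + 1)) : ℝ :=
  withEndpoints x i.succ - withEndpoints x i.castSucc

/-- The differences `s_i - s_{i-1}`, where `s_{-1} = 0`. -/
def differences (n : ℕ) : (Fin n → ℝ) →ₗ[ℝ] (Fin n → ℝ) where
  toFun s i := s i - (Fin.cons (α := fun _ => ℝ) 0 s : Fin (n + 1) → ℝ) i.castSucc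
  map_add' s t := by
    funext i
    rcases n with _ | n
    · exact i.elim0
    · refine Fin.cases ?_ (fun j => ?_) i
      · simp
      · simp only [Fin.castSucc_succ, Fin.cons_succ, Pi.add_apply]; ring
  map_smul' c s := by
    funext i
    rcases n with _ | n
    · exact i.elim0
    · refine Fin.cases ?_ (fun j => ?_) i
      · simp
      · simp only [Fin.castSucc_succ, Fin.cons_succ, Pi.smul_apply, smul_eq_mul,
          RingHom.id_apply]; ring

theorem det_differences (n : ℕ) : LinearMap.det (differences n) = 1 := by
  rw [← LinearMap.det_toMatrix', Matrix.det_of_isLowerTriangular]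
  · refine Finset.prod_eq_one fun i _ => ?_
    rcases n with _ | n
    · exact i.elim0
    · refine Fin.cases ?_ (fun j => ?_) i
      · simp [LinearMap.toMatrix'_apply, differences]
      · simp [LinearMap.toMatrix'_apply, differences, Fin.castSucc_succ, Fin.ext_iff]
  · intro i j hij
    have hij : i < j := hij
    rcases n with _ | n
    · exact i.elim0
    · revert hij
      refine Fin.cases ?_ (fun k => ?_) i
      · intro h
        simp [LinearMap.toMatrix'_apply, differences, h.ne]
      · intro h
        have h2 : k.castSucc ≠ j := by
          rintro rfl; exact absurd h (by simp [Fin.lt_def])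
        simp [LinearMap.toMatrix'_apply, differences, Fin.castSucc_succ, h.ne, h2]

theorem measurePreserving_differences (n : ℕ) :
    MeasurePreserving (differences n) (volume : Measure (Fin n → ℝ)) volume := by
  refine ⟨(LinearMap.continuous_on_pi _).measurable, ?_⟩
  rw [Real.map_linearMap_volume_pi_eq_smul_volume_pi (by simp [det_differences])]
  simp [det_differences]

/-- In partial-sum coordinates the last entry is the total r and the others are r times the
normalized sums. As `differences` has determinant 1, the change of variables (r, x) ↦ r · increments
x has Jacobian r ^ N. -/
theorem differences_snoc {N : ℕ} (r : ℝ) (x : Fin N → ℝ) :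
    differences (N + 1) (Fin.snoc (α := fun _ => ℝ) (r • x) r) = r • increments x := by
  have key : (Fin.snoc (α := fun _ => ℝ) (r • x) r : Fin (N + 1) → ℝ) =
      r • (Fin.snoc (α := fun _ => ℝ) x 1 : Fin (N + 1) → ℝ) := by
    funext i
    refine Fin.lastCases ?_ (fun j => ?_) i <;> simp
  funext i
  rw [key, map_smul]
  simp [differences, increments, withEndpoints]

theorem sum_increments_Iic {N : ℕ} (x : Fin N → ℝ) (k : Fin (N + 1)) :
    ∑ j ∈ Finset.Iic k, increments x j = withEndpoints x k.succ := by
  induction k using Fin.induction with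
  | zero =>
    have : Finset.Iic (0 : Fin (N + 1)) = {0} := by ext j; simp
    rw [this]
    simp [increments, withEndpoints]
  | succ i ih =>
    have : Finset.Iic i.succ = insert i.succ (Finset.Iic i.castSucc) := by
      ext j; simp [Fin.le_def, Fin.ext_iff]; omega
    rw [this, Finset.sum_insert (by simp [Fin.le_def]), ih, increments, Fin.succ_castSucc]
    ring

theorem sum_increments {N : ℕ} (x : Fin N → ℝ) : ∑ j, increments x j = 1 := by
  have := sum_increments_Iic x (Fin.last N)
  rw [show Finset.Iic (Fin.last N) = Finset.univ by ext j; simp [Fin.le_last]] at this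
  rw [this]
  simp [withEndpoints]

theorem strictMono_withEndpoints_iff {N : ℕ} {x : Fin N → ℝ} :
    StrictMono (withEndpoints x) ↔ ∀ i, 0 < increments x i := by
  simp [Fin.strictMono_iff_lt_succ, increments]

/-- The partial sums `y₀ + ⋯ + yᵢ`, `i < N`, divided by the total `y₀ + ⋯ + y_N`. -/
def normalizedSums {N : ℕ} (y : Fin (N + 1) → ℝ) (i : Fin N) : ℝ :=
  (∑ j ∈ Finset.Iic i.castSucc, y j) / ∑ j, y j

theorem measurable_normalizedSums {N : ℕ} : Measurable (normalizedSums (N := N)) := by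
  refine measurable_pi_lambda _ fun i => ?_
  unfold normalizedSums
  fun_prop

theorem normalizedSums_smul {N : ℕ} {r : ℝ} (hr : r ≠ 0) (y : Fin (N + 1) → ℝ) :
    normalizedSums (r • y) = normalizedSums y := by
  funext i
  simp only [normalizedSums, Pi.smul_apply, smul_eq_mul, ← Finset.mul_sum]
  exact mul_div_mul_left _ _ hr

theorem normalizedSums_increments {N : ℕ} (x : Fin N → ℝ) :
    normalizedSums (increments x) = x := by
  funext i
  rw [normalizedSums, sum_increments_Iic, sum_increments, div_one]
  rw [withEndpoints, Fin.cons_succ, Fin.snoc_castSucc]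

/-! ### Gamma and Dirichlet distributions -/

/-- The density of the Dirichlet distribution with parameters `a₀, …, a_N`, in the coordinates
given by the partial sums. -/
def dirichletPDF {N : ℕ} (a : Fin (N + 1) → ℝ) (x : Fin N → ℝ) : ℝ≥0∞ :=
  if ∀ i, 0 < increments x i then
    ENNReal.ofReal (Real.Gamma (∑ i, a i) / (∏ i, Real.Gamma (a i)) *
      ∏ i, increments x i ^ (a i - 1))
  else 0

theorem measurable_increments {N : ℕ} (i : Fin (N + 1)) :
    Measurable fun x : Fin N → ℝ => increments x i := by
  have : ∀ j : Fin (N + 2), Measurable fun x : Fin N → ℝ => withEndpoints x j := by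
    intro j
    refine Fin.cases ?_ (fun k => ?_) j
    · simp [withEndpoints]
    · refine Fin.lastCases ?_ (fun l => ?_) k
      · simp [withEndpoints]
      · simpa [withEndpoints] using measurable_pi_apply l
  exact (this _).sub (this _)

theorem measurable_dirichletPDF {N : ℕ} (a : Fin (N + 1) → ℝ) : Measurable (dirichletPDF a) := by
  unfold dirichletPDF
  refine Measurable.ite ?_ ?_ measurable_const
  · rw [ofPred_forall]
    exact MeasurableSet.iInter fun i => measurableSet_lt measurable_const (measurable_increments i)
  · refine ENNReal.measurable_ofReal.comp (measurable_const.mul ?_)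
    exact Finset.measurable_prod _ fun i _ => (measurable_increments i).pow_const _

theorem ofReal_dirichletDensity (β : ℝ) {N : ℕ} (t x : Fin N → ℝ) :
    ENNReal.ofReal (dirichletDensity β t x) = dirichletPDF (fun i => β * increments t i) x := by
  unfold dirichletDensity dirichletPDF
  simp only [strictMono_withEndpoints_iff, ← Finset.mul_sum, sum_increments, mul_one]
  split_ifs
  · rfl
  · simp

/-- The density of the gamma distribution with parameter `a`, vanishing at `0`. -/
def gammaDensity (a x : ℝ) : ℝ≥0∞ :=
  if 0 < x then ENNReal.ofReal (1 / Real.Gamma a * x ^ (a - 1) * Real.exp (-x)) else 0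

theorem measurable_gammaDensity (a : ℝ) : Measurable (gammaDensity a) := by
  refine Measurable.ite measurableSet_Ioi ?_ measurable_const
  exact ENNReal.measurable_ofReal.comp
    (((measurable_id.pow_const _).const_mul _).mul measurable_neg.exp)

theorem gammaMeasure_eq_withDensity (a : ℝ) :
    gammaMeasure a 1 = (volume : Measure ℝ).withDensity (gammaDensity a) := by
  refine withDensity_congr_ae ?_
  have : ∀ᵐ x : ℝ, x ≠ 0 := by simp [ae_iff]
  filter_upwards [this] with x hx
  rw [gammaPDF_eq, gammaDensity]
  rcases lt_or_gt_of_ne hx with h | h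
  · simp [h.not_ge, h.not_gt]
  · simp [h.le, h]

/-- The increments sum to 1, so the exponentials combine to exp(-r), while the powers give r to the
exponent ∑ a - (N + 1); the Jacobian r ^ N raises this to ∑ a - 1. Thus the total and the
proportions separate. -/
theorem prod_gammaDensity_mul {N : ℕ} {a : Fin (N + 1) → ℝ} (ha : ∀ i, 0 < a i) {r : ℝ}
    (hr : 0 < r) (x : Fin N → ℝ) :
    ENNReal.ofReal (r ^ N) * ∏ i, gammaDensity (a i) (r * increments x i) =
      gammaDensity (∑ i, a i) r * dirichletPDF a x := by
  by_cases h : ∀ i, 0 < increments x i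
  · have hS : 0 < ∑ i, a i := Finset.sum_pos (fun i _ => ha i) Finset.univ_nonempty
    have hG := Real.Gamma_pos_of_pos hS
    have hGi := fun i => Real.Gamma_pos_of_pos (ha i)
    simp only [gammaDensity, dirichletPDF, hr, mul_pos hr (h _), if_true, h, implies_true]
    rw [← ENNReal.ofReal_prod_of_nonneg, ← ENNReal.ofReal_mul (by positivity),
      ← ENNReal.ofReal_mul (by positivity)]
    · congr 1
      have e1 : ∏ i, Real.exp (-(r * increments x i)) = Real.exp (-r) := by
        rw [← Real.exp_sum, Finset.sum_neg_distrib, ← Finset.mul_sum, sum_increments, mul_one]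
      have e2 : ∏ i, (r * increments x i) ^ (a i - 1) =
          r ^ (∑ i, a i - (N + 1)) * ∏ i, increments x i ^ (a i - 1) := by
        rw [Finset.prod_congr rfl fun i _ => Real.mul_rpow hr.le (h i).le,
          Finset.prod_mul_distrib, ← Real.rpow_sum_of_pos hr]
        simp
      have e3 : r ^ N * r ^ (∑ i, a i - (N + 1)) = r ^ (∑ i, a i - 1) := by
        rw [← Real.rpow_natCast, ← Real.rpow_add hr]; congr 1; ring
      rw [Finset.prod_mul_distrib, Finset.prod_mul_distrib, e1, e2, ← e3]
      have : ∏ i, Real.Gamma (a i) ≠ 0 := (Finset.prod_pos fun i _ => hGi i).ne'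
      simp only [one_div, Finset.prod_inv_distrib]
      field_simp
    · intro i _
      have := hGi i
      have := h i
      positivity
  · rw [dirichletPDF, if_neg h, mul_zero]
    push Not at h
    obtain ⟨i, hi⟩ := h
    rw [Finset.prod_eq_zero (Finset.mem_univ i), mul_zero]
    rw [gammaDensity, if_neg (not_lt.2 (mul_nonpos_of_nonneg_of_nonpos hr.le hi))]

theorem lintegral_comp_smul_pi {N : ℕ} {r : ℝ} (hr : 0 < r) {F : (Fin N → ℝ) → ℝ≥0∞}
    (hF : Measurable F) : ∫⁻ x, F x = ENNReal.ofReal (r ^ N) * ∫⁻ x, F (r • x) := by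
  have h := Measure.map_addHaar_smul (volume : Measure (Fin N → ℝ)) hr.ne'
  have h2 := congrArg (fun μ => ∫⁻ x, F x ∂μ) h
  simp only [lintegral_smul_measure, smul_eq_mul] at h2
  rw [lintegral_map hF (measurable_const_smul r)] at h2
  rw [h2, ← mul_assoc, ← ENNReal.ofReal_mul (by positivity)]
  simp [abs_of_pos hr, hr.ne']

/-- The total and the normalized partial sums of independent gamma variables are independent, with
a gamma and a Dirichlet distribution respectively. -/
theorem map_pi_gammaMeasure {N : ℕ} {a : Fin (N + 1) → ℝ} (ha : ∀ i, 0 < a i) :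
    (Measure.pi fun i => gammaMeasure (a i) 1).map (fun y => (∑ i, y i, normalizedSums y)) =
      (gammaMeasure (∑ i, a i) 1).prod (volume.withDensity (dirichletPDF a)) := by
  have hm : Measurable fun y : Fin (N + 1) → ℝ => (∑ i, y i, normalizedSums y) :=
    (by fun_prop : Measurable fun y : Fin (N + 1) → ℝ => ∑ i, y i).prodMk measurable_normalizedSums
  have hs : ∀ b : Fin (N + 1) → ℝ, (∀ i, 0 < b i) → ∀ i, SigmaFinite
      ((volume : Measure ℝ).withDensity (gammaDensity (b i))) := fun b hb i => by
    rw [← gammaMeasure_eq_withDensity]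
    have := isProbabilityMeasure_gammaMeasure (hb i) one_pos
    infer_instance
  have := hs a ha
  refine Measure.ext_of_lintegral _ fun F hF => ?_
  simp only [gammaMeasure_eq_withDensity]
  have hg : Measurable fun y : Fin (N + 1) → ℝ => ∏ i, gammaDensity (a i) (y i) :=
    Finset.measurable_prod _ fun i _ => (measurable_gammaDensity _).comp (measurable_pi_apply i)
  rw [lintegral_map hF hm, pi_withDensity _ fun i => measurable_gammaDensity _,
    lintegral_withDensity_eq_lintegral_mul _ hg (g := fun y => F (∑ i, y i, normalizedSums y))
      (hF.comp hm)]
  have hd : Measurable (differences (N + 1)) := (LinearMap.continuous_on_pi _).measurable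
  have hH : Measurable ((fun y => ∏ i, gammaDensity (a i) (y i)) *
      fun y => F (∑ i, y i, normalizedSums y)) := hg.mul (hF.comp hm)
  have he := (volume_preserving_piFinSuccAbove (fun _ : Fin (N + 1) => ℝ) (Fin.last N)).symm
  -- Pass to partial sums and split off the last one, which is the total r.
  rw [← (measurePreserving_differences (N + 1)).lintegral_comp hH]
  refine (he.lintegral_comp (hH.comp hd)).symm.trans ?_
  refine (lintegral_prod _ ((hH.comp hd).comp he.measurable).aemeasurable).trans ?_
  rw [lintegral_prod _ hF.aemeasurable,
    lintegral_withDensity_eq_lintegral_mul _ (measurable_gammaDensity _)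
      hF.lintegral_prod_right']
  have h0 : ∀ᵐ r : ℝ, r ≠ 0 := by simp [ae_iff]
  refine lintegral_congr_ae ?_
  filter_upwards [h0] with r hr0
  have hsym : ∀ x : Fin N → ℝ, (MeasurableEquiv.piFinSuccAbove (fun _ : Fin (N + 1) => ℝ)
      (Fin.last N)).symm (r, x) = Fin.snoc (α := fun _ => ℝ) x r := by
    intro x
    simp [MeasurableEquiv.piFinSuccAbove, Fin.insertNthEquiv]
  simp only [Pi.mul_apply]
  rcases lt_or_gt_of_ne hr0 with hr | hr
  -- For a negative total some coordinate is nonpositive, so both densities vanish.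
  · rw [gammaDensity, if_neg hr.not_gt, zero_mul]
    refine lintegral_eq_zero_of_ae_eq_zero (ae_of_all _ fun x => ?_)
    have hx : differences (N + 1) (Fin.snoc (α := fun _ => ℝ) x r) =
        r • increments (r⁻¹ • x) := by
      rw [← differences_snoc, smul_inv_smul₀ hr0]
    have : ∑ i, (r • increments (r⁻¹ • x)) i = r := by
      simp [← Finset.mul_sum, sum_increments]
    obtain ⟨i, -, hi⟩ := Finset.exists_le_of_sum_le (s := (Finset.univ : Finset (Fin (N + 1))))
      (f := r • increments (r⁻¹ • x)) (g := fun i => 0) Finset.univ_nonempty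
      (by rw [this]; simpa using hr.le)
    simp only [Function.comp_apply, hsym, hx, Pi.mul_apply, Pi.zero_apply, mul_eq_zero]
    left
    rw [Finset.prod_eq_zero (Finset.mem_univ i)]
    rw [gammaDensity, if_neg (not_lt.2 hi)]
  · have hGr : Measurable fun x : Fin N → ℝ => ((fun y : Fin (N + 1) → ℝ => ∏ i, gammaDensity (a i) (y i)) *
        (fun y : Fin (N + 1) → ℝ => F (∑ i, y i, normalizedSums y))) (differences (N + 1)
        ((MeasurableEquiv.piFinSuccAbove (fun _ : Fin (N + 1) => ℝ) (Fin.last N)).symm (r, x))) :=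
      ((hH.comp hd).comp he.measurable).comp measurable_prodMk_left
    have hFr : Measurable fun x : Fin N → ℝ => F (r, x) := hF.comp measurable_prodMk_left
    refine (lintegral_comp_smul_pi hr hGr).trans ?_
    rw [lintegral_withDensity_eq_lintegral_mul _ (measurable_dirichletPDF a) hFr,
      ← lintegral_const_mul _ ((measurable_dirichletPDF a).mul hFr)]
    refine (lintegral_const_mul _ (hGr.comp (measurable_const_smul r))).symm.trans ?_
    refine lintegral_congr fun x => ?_
    have hsum : ∑ i, (r • increments x) i = r := by
      simp [← Finset.mul_sum, sum_increments]
    simp only [Function.comp_apply, hsym, Pi.mul_apply, differences_snoc, hsum]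
    rw [normalizedSums_smul hr0, normalizedSums_increments, ← mul_assoc, ← mul_assoc,
      ← prod_gammaDensity_mul ha hr]
    rfl

/-- Comparing total masses in the gamma factorization yields the normalization without evaluating a
multivariate beta integral. -/
theorem isProbabilityMeasure_dirichlet {N : ℕ} {a : Fin (N + 1) → ℝ} (ha : ∀ i, 0 < a i) :
    IsProbabilityMeasure ((volume : Measure (Fin N → ℝ)).withDensity (dirichletPDF a)) := by
  have := fun i => isProbabilityMeasure_gammaMeasure (ha i) one_pos
  have hS : 0 < ∑ i, a i := Finset.sum_pos (fun i _ => ha i) Finset.univ_nonempty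
  have := isProbabilityMeasure_gammaMeasure hS one_pos
  have hm : Measurable fun y : Fin (N + 1) → ℝ => (∑ i, y i, normalizedSums y) :=
    (by fun_prop : Measurable fun y : Fin (N + 1) → ℝ => ∑ i, y i).prodMk measurable_normalizedSums
  have h := congrArg (fun μ => μ univ) (map_pi_gammaMeasure ha)
  simp only [Measure.map_apply hm MeasurableSet.univ, preimage_univ, measure_univ] at h
  rw [← univ_prod_univ, Measure.prod_prod, measure_univ, one_mul] at h
  exact ⟨h.symm⟩

theorem map_normalizedSums_gamma {N : ℕ} {a : Fin (N + 1) → ℝ} (ha : ∀ i, 0 < a i) :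
    (Measure.pi fun i => gammaMeasure (a i) 1).map normalizedSums =
      volume.withDensity (dirichletPDF a) := by
  have hm : Measurable fun y : Fin (N + 1) → ℝ => (∑ i, y i, normalizedSums y) :=
    (by fun_prop : Measurable fun y : Fin (N + 1) → ℝ => ∑ i, y i).prodMk measurable_normalizedSums
  have hS : 0 < ∑ i, a i := Finset.sum_pos (fun i _ => ha i) Finset.univ_nonempty
  have := isProbabilityMeasure_gammaMeasure hS one_pos
  have h := congrArg (Measure.map Prod.snd) (map_pi_gammaMeasure ha)
  rw [Measure.map_map measurable_snd hm, Measure.map_snd_prod, measure_univ, one_smul] at h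
  exact h

theorem map_sum_gamma {N : ℕ} {a : Fin (N + 1) → ℝ} (ha : ∀ i, 0 < a i) :
    (Measure.pi fun i => gammaMeasure (a i) 1).map (fun y => ∑ i, y i) =
      gammaMeasure (∑ i, a i) 1 := by
  have hm : Measurable fun y : Fin (N + 1) → ℝ => (∑ i, y i, normalizedSums y) :=
    (by fun_prop : Measurable fun y : Fin (N + 1) → ℝ => ∑ i, y i).prodMk measurable_normalizedSums
  have := isProbabilityMeasure_dirichlet ha
  have h := congrArg (Measure.map Prod.fst) (map_pi_gammaMeasure ha)
  rw [Measure.map_map measurable_fst hm, Measure.map_fst_prod, measure_univ, one_smul] at h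
  exact h

/-! ### Comparison of measures -/

/-- Thickened indicators decrease to the indicator of a closed set, and finite Borel measures here
are inner regular for closed sets. -/
theorem measure_le_of_forall_lintegral_le {X : Type*} [MeasurableSpace X] [PseudoEMetricSpace X]
    [BorelSpace X] {μ ν : Measure X} [IsFiniteMeasure μ] [IsFiniteMeasure ν]
    (h : ∀ f : BoundedContinuousFunction X ℝ≥0, ∫⁻ x, f x ∂μ ≤ ∫⁻ x, f x ∂ν) : μ ≤ ν := by
  have hc : ∀ F, IsClosed F → μ F ≤ ν F := fun F hF => by
    have hμ := tendsto_lintegral_thickenedIndicator_of_isClosed μ hF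
      (δs := fun n : ℕ => 1 / ((n : ℝ) + 1)) (fun n => by positivity)
      tendsto_one_div_add_atTop_nhds_zero_nat
    have hν := tendsto_lintegral_thickenedIndicator_of_isClosed ν hF
      (δs := fun n : ℕ => 1 / ((n : ℝ) + 1)) (fun n => by positivity)
      tendsto_one_div_add_atTop_nhds_zero_nat
    exact le_of_tendsto_of_tendsto' hμ hν fun n => h _
  refine Measure.le_iff.2 fun s hs => ?_
  rw [hs.measure_eq_iSup_isClosed_of_ne_top (measure_ne_top μ s)]
  exact iSup₂_le fun F hF => iSup_le fun hF' => (hc F hF').trans (measure_mono hF)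

theorem tendsto_dirichletPDF {N : ℕ} {a : Fin (N + 1) → ℝ} (ha : ∀ i, 0 < a i)
    {b : ℕ → Fin (N + 1) → ℝ} (hb : Filter.Tendsto b Filter.atTop (𝓝 a)) (x : Fin N → ℝ) :
    Filter.Tendsto (fun n => dirichletPDF (b n) x) Filter.atTop (𝓝 (dirichletPDF a x)) := by
  have hbi : ∀ i, Filter.Tendsto (fun n => b n i) Filter.atTop (𝓝 (a i)) :=
    fun i => tendsto_pi_nhds.1 hb i
  have hG : ∀ s : ℝ, 0 < s → ContinuousAt Real.Gamma s := fun s hs =>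
    (Real.differentiableAt_Gamma fun m => by
      have : (0 : ℝ) ≤ m := m.cast_nonneg
      linarith).continuousAt
  have hS : 0 < ∑ i, a i := Finset.sum_pos (fun i _ => ha i) Finset.univ_nonempty
  unfold dirichletPDF
  by_cases h : ∀ i, 0 < increments x i
  · simp only [h, implies_true, if_true]
    refine ENNReal.tendsto_ofReal (Filter.Tendsto.mul (Filter.Tendsto.div ?_ ?_ ?_) ?_)
    · exact (hG _ hS).tendsto.comp (tendsto_finsetSum _ fun i _ => hbi i)
    · exact tendsto_finsetProd _ fun i _ => (hG _ (ha i)).tendsto.comp (hbi i)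
    · exact (Finset.prod_pos fun i _ => Real.Gamma_pos_of_pos (ha i)).ne'
    · exact tendsto_finsetProd _ fun i _ =>
        tendsto_const_nhds.rpow ((hbi i).sub_const 1) (Or.inl (h i).ne')
  · simp [h]

/-- A limit of Dirichlet distributions is a Dirichlet distribution. -/
theorem eq_dirichlet_of_tendsto {N : ℕ} {a : Fin (N + 1) → ℝ} (ha : ∀ i, 0 < a i)
    {b : ℕ → Fin (N + 1) → ℝ} (hb : Filter.Tendsto b Filter.atTop (𝓝 a))
    {ν : Measure (Fin N → ℝ)} [IsProbabilityMeasure ν] {l : Filter ℕ} [l.NeBot]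
    (hl : l ≤ Filter.atTop)
    (h : ∀ f : BoundedContinuousFunction (Fin N → ℝ) ℝ≥0, Filter.Tendsto
      (fun n => ∫⁻ x, f x ∂((volume : Measure (Fin N → ℝ)).withDensity (dirichletPDF (b n)))) l
      (𝓝 (∫⁻ x, f x ∂ν))) : ν = volume.withDensity (dirichletPDF a) := by
  have := isProbabilityMeasure_dirichlet ha
  -- One inequality suffices between probability measures, and Fatou's lemma for the pointwise
  -- converging densities provides it; no domination is needed.
  refine (Measure.eq_of_le_of_isProbabilityMeasure
    (measure_le_of_forall_lintegral_le fun f => ?_)).symm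
  have hf : Measurable fun x => (f x : ℝ≥0∞) :=
    (ENNReal.continuous_coe.comp f.continuous).measurable
  have hd : ∀ c : Fin (N + 1) → ℝ, ∫⁻ x, f x ∂((volume : Measure (Fin N → ℝ)).withDensity
      (dirichletPDF c)) = ∫⁻ x, dirichletPDF c x * f x := fun c =>
    lintegral_withDensity_eq_lintegral_mul _ (measurable_dirichletPDF c) hf
  rw [← (h f).liminf_eq]
  simp only [hd]
  calc ∫⁻ x, dirichletPDF a x * f x
      = ∫⁻ x, Filter.liminf (fun n => dirichletPDF (b n) x * f x) Filter.atTop := by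
        refine lintegral_congr fun x => Eq.symm (Filter.Tendsto.liminf_eq ?_)
        exact ENNReal.Tendsto.mul_const (tendsto_dirichletPDF ha hb x) (Or.inr ENNReal.coe_ne_top)
    _ ≤ Filter.liminf (fun n => ∫⁻ x, dirichletPDF (b n) x * f x) Filter.atTop :=
        lintegral_liminf_le fun n => (measurable_dirichletPDF _).mul hf
    _ ≤ _ := Filter.liminf_le_liminf_of_le hl

end

open Filter

noncomputable section

namespace G0

/-! ### The space `𝒢₀` -/

theorem dist_eq_norm_toL2 (g h : G0) : dist g h = ‖g.toL2 - h.toL2‖ := dist_eq_norm g.toL2 h.toL2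

theorem continuous_toL2 : Continuous toL2 := continuous_induced_dom

theorem coeFn_toL2 (g : G0) : g.toL2 =ᵐ[volume] fun t => (g t : ℝ) := g.memLp.coeFn_toLp

theorem norm_toL2_sub_sq (g h : G0) :
    ‖g.toL2 - h.toL2‖ ^ 2 = ∫ t : I, ((g t : ℝ) - h t) ^ 2 := by
  rw [← real_inner_self_eq_norm_sq, L2.inner_def]
  refine integral_congr_ae ?_
  filter_upwards [Lp.coeFn_sub g.toL2 h.toL2, g.coeFn_toL2, h.coeFn_toL2] with t h1 h2 h3
  rw [h1, Pi.sub_apply, h2, h3, sq]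
  rfl

theorem abs_sub_le_one (g h : G0) (t : I) : |(g t : ℝ) - h t| ≤ 1 := by
  rw [abs_le]
  constructor <;> linarith [(g t).2.1, (g t).2.2, (h t).2.1, (h t).2.2]

theorem tendsto_of_ae {ι : Type*} {l : Filter ι} [l.IsCountablyGenerated] {g : ι → G0} {h : G0}
    (hg : ∀ᵐ t : I, Tendsto (fun n => (g n t : ℝ)) l (𝓝 (h t))) : Tendsto g l (𝓝 h) := by
  rw [tendsto_iff_dist_tendsto_zero]
  have h1 : Tendsto (fun n => ∫ t : I, ((g n t : ℝ) - h t) ^ 2) l (𝓝 (∫ _ : I, (0 : ℝ))) := by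
    refine tendsto_integral_filter_of_dominated_convergence (fun _ => 1) ?_ ?_
      (integrable_const _) ?_
    · exact Eventually.of_forall fun n =>
        (((g n).measurable_coe.sub h.measurable_coe).pow_const 2).aestronglyMeasurable
    · refine Eventually.of_forall fun n => ae_of_all _ fun t => ?_
      rw [Real.norm_eq_abs, abs_pow]
      exact pow_le_one₀ (abs_nonneg _) (abs_sub_le_one _ _ _)
    · filter_upwards [hg] with t ht
      simpa using (ht.sub_const (h t : ℝ)).pow 2
  have h2 := h1.sqrt
  simp only [integral_zero, Real.sqrt_zero] at h2
  refine h2.congr fun n => ?_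
  rw [← norm_toL2_sub_sq, Real.sqrt_sq (norm_nonneg _), dist_eq_norm_toL2]

/-- The grid point `k / N`. -/
def gridPt (N k : ℕ) : I := projIcc 0 1 zero_le_one ((k : ℝ) / N)

theorem coe_gridPt {N k : ℕ} (hk : k ≤ N) : (gridPt N k : ℝ) = (k : ℝ) / N := by
  rw [gridPt, projIcc_of_mem]
  exact ⟨by positivity, div_le_one_of_le₀ (by exact_mod_cast hk) (by positivity)⟩

theorem gridPt_mono (N : ℕ) : Monotone (gridPt N) := fun a b h =>
  monotone_projIcc _ (by gcongr)

theorem gridPt_self {N : ℕ} (hN : 0 < N) : gridPt N N = 1 := by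
  ext; rw [coe_gridPt le_rfl, div_self (by positivity)]; rfl

theorem gridPt_of_le {N k : ℕ} (hN : 0 < N) (hk : N ≤ k) : gridPt N k = 1 :=
  le_antisymm le_top (by rw [← gridPt_self hN]; exact gridPt_mono N hk)

theorem gridPt_floor_le (N : ℕ) (hN : 0 < N) (t : I) : gridPt N ⌊(N : ℝ) * t⌋₊ ≤ t := by
  have hfl := Nat.floor_le (mul_nonneg N.cast_nonneg t.2.1)
  have hN' : (0 : ℝ) < N := by exact_mod_cast hN
  have : ⌊(N : ℝ) * t⌋₊ ≤ N := by
    have := mul_le_of_le_one_right hN'.le t.2.2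
    exact_mod_cast hfl.trans this
  rw [← Subtype.coe_le_coe, coe_gridPt this, div_le_iff₀ hN']
  linarith

theorem lt_gridPt_floor (N : ℕ) (hN : 0 < N) (t : I) (ht : t < 1) :
    t < gridPt N (⌊(N : ℝ) * t⌋₊ + 1) := by
  have hN' : (0 : ℝ) < N := by exact_mod_cast hN
  have hlt : (N : ℝ) * t < N := by
    have : (t : ℝ) < 1 := ht
    nlinarith
  have : ⌊(N : ℝ) * t⌋₊ + 1 ≤ N := Nat.succ_le_of_lt ((Nat.floor_lt' hN.ne').2 hlt)
  rw [← Subtype.coe_lt_coe, coe_gridPt this, lt_div_iff₀ hN']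
  have := Nat.lt_floor_add_one ((N : ℝ) * t)
  push_cast
  linarith

theorem tendsto_gridPt_floor (t : I) {N : ℕ → ℕ} (hN : Tendsto N atTop atTop) (c : ℕ) :
    Tendsto (fun n => gridPt (N n) (⌊(N n : ℝ) * t⌋₊ + c)) atTop (𝓝 t) := by
  have h1 : Tendsto (fun n => ((⌊(N n : ℝ) * t⌋₊ + c : ℕ) : ℝ) / N n) atTop (𝓝 (t : ℝ)) := by
    have hNr : Tendsto (fun n => (N n : ℝ)) atTop atTop := tendsto_natCast_atTop_atTop.comp hN
    have h2 : Tendsto (fun n => (⌊(t : ℝ) * (N n : ℝ)⌋₊ : ℝ) / N n) atTop (𝓝 (t : ℝ)) :=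
      (tendsto_nat_floor_mul_div_atTop t.2.1).comp hNr
    have h3 : Tendsto (fun n => (c : ℝ) / N n) atTop (𝓝 0) := tendsto_const_nhds.div_atTop hNr
    have := h2.add h3
    rw [add_zero] at this
    refine this.congr fun n => ?_
    push_cast
    rw [mul_comm (t : ℝ), add_div]
  have h4 := (continuous_projIcc (h := zero_le_one (α := ℝ))).tendsto (t : ℝ) |>.comp h1
  rwa [projIcc_val] at h4

theorem ae_continuousAt (g : G0) : ∀ᵐ t : I, ContinuousAt g t := by
  have : {t : I | ¬ ContinuousAt g t}.Countable := g.monotone'.countable_not_continuousAt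
  exact this.measure_zero volume

/-- By monotonicity g n t lies between its values at the two grid points around t. There it is close
to h, and h at those points tends to h t whenever t is a continuity point of h, that is for almost
every t. -/
theorem tendsto_of_nodes {g : ℕ → G0} {h : G0} {N : ℕ → ℕ} (hN : Tendsto N atTop atTop)
    {ε : ℕ → ℝ} (hε : Tendsto ε atTop (𝓝 0))
    (hg : ∀ n k, 0 < k → k < N n → |(g n (gridPt (N n) k) : ℝ) - h (gridPt (N n) k)| ≤ ε n) :
    Tendsto g atTop (𝓝 h) := by
  refine tendsto_of_ae ?_
  have h0 : ∀ᵐ t : I, t ≠ 0 := by simp [ae_iff]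
  have h1 : ∀ᵐ t : I, t ≠ 1 := by simp [ae_iff]
  filter_upwards [h.ae_continuousAt, h0, h1] with t hc ht0 ht1
  have ht0 : 0 < t := bot_lt_iff_ne_bot.2 ht0
  have ht1 : t < 1 := lt_top_iff_ne_top.2 ht1
  have hcr : ContinuousAt (fun s : I => (h s : ℝ)) t := continuous_subtype_val.continuousAt.comp hc
  have hlo := (hcr.tendsto.comp (tendsto_gridPt_floor t hN 0)).sub hε
  have hhi := (hcr.tendsto.comp (tendsto_gridPt_floor t hN 1)).add hε
  rw [sub_zero] at hlo
  rw [add_zero] at hhi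
  have hNr : Tendsto (fun n => (N n : ℝ)) atTop atTop := tendsto_natCast_atTop_atTop.comp hN
  have hbig : ∀ᶠ n in atTop, 2 < (N n : ℝ) * t ∧ 2 < (N n : ℝ) * (1 - t) := by
    have a1 : (0 : ℝ) < t := ht0
    have a2 : (0 : ℝ) < 1 - t := sub_pos.2 ht1
    exact ((hNr.atTop_mul_const a1).eventually_gt_atTop 2).and
      ((hNr.atTop_mul_const a2).eventually_gt_atTop 2)
  refine tendsto_of_tendsto_of_tendsto_of_le_of_le' hlo hhi ?_ ?_
  · filter_upwards [hbig] with n ⟨hb1, hb2⟩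
    have hNpos : 0 < N n := by
      rcases Nat.eq_zero_or_pos (N n) with h | h
      · simp [h] at hb1; linarith
      · exact h
    have hk0 : 0 < ⌊(N n : ℝ) * t⌋₊ := Nat.floor_pos.2 (by linarith)
    have hk1 : ⌊(N n : ℝ) * t⌋₊ < N n := (Nat.floor_lt' hNpos.ne').2 (by linarith)
    have := (abs_le.1 (hg n _ hk0 hk1)).1
    have h5 : (g n (gridPt (N n) ⌊(N n : ℝ) * t⌋₊) : ℝ) ≤ g n t :=
      (g n).monotone' (gridPt_floor_le _ hNpos t)
    simp only [Function.comp_apply, add_zero]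
    linarith
  · filter_upwards [hbig] with n ⟨hb1, hb2⟩
    have hNpos : 0 < N n := by
      rcases Nat.eq_zero_or_pos (N n) with h | h
      · simp [h] at hb1; linarith
      · exact h
    have hk1 : ⌊(N n : ℝ) * t⌋₊ + 1 < N n := by
      have := Nat.floor_le (mul_nonneg (N n).cast_nonneg t.2.1)
      have : ((⌊(N n : ℝ) * t⌋₊ + 1 : ℕ) : ℝ) < N n := by push_cast; linarith
      exact_mod_cast this
    have := (abs_le.1 (hg n _ (Nat.succ_pos _) hk1)).2
    have h5 : (g n t : ℝ) ≤ g n (gridPt (N n) (⌊(N n : ℝ) * t⌋₊ + 1)) :=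
      (g n).monotone' (lt_gridPt_floor _ hNpos t ht1).le
    simp only [Function.comp_apply]
    linarith

/-! ### Measurability -/

theorem tendsto_right (g : G0) {t : I} (ht : t < 1) :
    Tendsto (fun n : ℕ => g (gridPt (n + 1) (⌊((n + 1 : ℕ) : ℝ) * t⌋₊ + 1))) atTop (𝓝 (g t)) := by
  have h1 : Tendsto (fun n : ℕ => gridPt (n + 1) (⌊((n + 1 : ℕ) : ℝ) * t⌋₊ + 1)) atTop (𝓝[≥] t) := by
    refine tendsto_nhdsWithin_iff.2 ⟨?_, Eventually.of_forall fun n =>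
      (lt_gridPt_floor _ n.succ_pos t ht).le⟩
    exact tendsto_gridPt_floor t (tendsto_add_atTop_nat 1) 1
  exact (g.rightContinuous' t).tendsto.comp h1

/-- By right continuity the joint evaluation is a limit of evaluations at the next grid point to the
right, which takes finitely many positions. -/
theorem measurable_uncurry {Ω : Type*} [MeasurableSpace Ω] {φ : Ω → G0}
    (hφ : ∀ t, Measurable fun ω => φ ω t) : Measurable fun p : Ω × I => φ p.1 p.2 := by
  have h : ∀ n : ℕ, Measurable fun p : Ω × I =>
      if p.2 = 1 then (1 : I) else φ p.1 (gridPt (n + 1) (⌊((n + 1 : ℕ) : ℝ) * p.2⌋₊ + 1)) := by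
    intro n
    refine Measurable.ite (measurable_snd (measurableSet_singleton 1)) measurable_const ?_
    have h1 : Measurable fun q : Ω × ℕ => φ q.1 (gridPt (n + 1) (q.2 + 1)) :=
      measurable_from_prod_countable_left fun k =>
        (hφ (gridPt (n + 1) (k + 1)) :)
    have h2 : Measurable fun p : Ω × I => (p.1, ⌊((n + 1 : ℕ) : ℝ) * p.2⌋₊) :=
      measurable_fst.prodMk (Nat.measurable_floor.comp
        ((measurable_subtype_coe.comp measurable_snd).const_mul _))
    exact h1.comp h2
  refine measurable_of_tendsto_metrizable h (tendsto_pi_nhds.2 fun p => ?_)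
  by_cases hp : p.2 = 1
  · simp only [hp, if_true, (φ p.1).map_one']; exact tendsto_const_nhds
  · simp only [hp, if_false]
    exact (φ p.1).tendsto_right (lt_top_iff_ne_top.2 hp)

instance : SecondCountableTopology G0 :=
  have : Fact ((2 : ℝ≥0∞) ≠ ∞) := ⟨ENNReal.ofNat_ne_top⟩
  (Topology.IsInducing.induced toL2).secondCountableTopology

/-- A map into `𝒢₀` is measurable as soon as all its evaluations are. -/
theorem measurable_of_eval {Ω : Type*} [MeasurableSpace Ω] {φ : Ω → G0}
    (hφ : ∀ t, Measurable fun ω => φ ω t) : Measurable φ := by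
  have hu : Measurable fun p : Ω × I => (φ p.1 p.2 : ℝ) :=
    measurable_subtype_coe.comp (measurable_uncurry hφ)
  have hd : ∀ h : G0, Measurable fun ω => dist (φ ω) h := by
    intro h
    have h1 : Measurable fun ω => ∫ t : I, ((φ ω t : ℝ) - h t) ^ 2 :=
      (StronglyMeasurable.integral_prod_right' (ν := (volume : Measure I))
        (f := fun p : Ω × I => ((φ p.1 p.2 : ℝ) - h p.2) ^ 2)
        ((hu.sub (h.measurable_coe.comp measurable_snd)).pow_const 2).stronglyMeasurable).measurable
    have h2 : (fun ω => dist (φ ω) h) = fun ω => √(∫ t : I, ((φ ω t : ℝ) - h t) ^ 2) := by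
      funext ω
      rw [← norm_toL2_sub_sq, Real.sqrt_sq (norm_nonneg _), dist_eq_norm_toL2]
    rw [h2]
    exact h1.sqrt
  -- In a second countable metric space open sets are countable unions of balls, so measurability of
  -- all distance functions is enough.
  refine measurable_of_isOpen fun s hs => ?_
  choose! r hr hrs using Metric.isOpen_iff.1 hs
  obtain ⟨T, hT, hTs⟩ := TopologicalSpace.isOpen_iUnion_countable
    (fun x : s => Metric.ball (x : G0) (r x)) fun x => Metric.isOpen_ball
  have hs' : s = ⋃ x ∈ T, Metric.ball (x : G0) (r x) := by
    rw [hTs]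
    refine Subset.antisymm (fun x hx => mem_iUnion.2 ⟨⟨x, hx⟩, Metric.mem_ball_self (hr x hx)⟩)
      (iUnion_subset fun x => hrs x x.2)
  rw [hs']
  simp only [preimage_iUnion]
  exact MeasurableSet.biUnion hT fun x _ => measurableSet_lt (hd x) measurable_const

/-- Evaluation is not continuous for the L² metric, but averages over intervals to the right of t
are, and they converge to g t by right continuity and monotonicity. -/
theorem measurable_eval (t : I) : Measurable fun g : G0 => g t := by
  rcases eq_or_lt_of_le (show t ≤ 1 from t.2.2) with rfl | ht
  · simp only [map_one']; exact measurable_const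
  suffices h : Measurable fun g : G0 => (g t : ℝ) from
    h.subtype_mk (h := fun g => (g t).2)
  set s : ℕ → I := fun n => gridPt (n + 1) (⌊((n + 1 : ℕ) : ℝ) * t⌋₊ + 1) with hs
  have hts : ∀ n, t < s n := fun n => lt_gridPt_floor _ n.succ_pos t ht
  have hv : ∀ n, 0 < (volume : Measure I).real (Ioo t (s n)) := fun n => by
    rw [measureReal_def, ENNReal.toReal_pos_iff]
    refine ⟨?_, measure_lt_top _ _⟩
    simp [hts n]
  have hint : ∀ (g : G0) n, IntegrableOn (fun x : I => (g x : ℝ)) (Ioo t (s n)) := fun g n =>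
    (g.memLp.integrable one_le_two).integrableOn
  have hm : ∀ n, Measurable fun g : G0 =>
      (∫ x in Ioo t (s n), (g x : ℝ)) / (volume : Measure I).real (Ioo t (s n)) := by
    intro n
    refine Measurable.div_const (Continuous.measurable ?_) _
    have h1 : (fun g : G0 => ∫ x in Ioo t (s n), (g x : ℝ)) = fun g : G0 =>
        inner ℝ (indicatorConstLp 2 (measurableSet_Ioo (a := t) (b := s n))
          (measure_ne_top volume _) (1 : ℝ)) g.toL2 := by
      funext g
      rw [L2.inner_indicatorConstLp_one]
      exact setIntegral_congr_ae measurableSet_Ioo (g.coeFn_toL2.mono fun x hx _ => hx.symm)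
    rw [h1]
    exact continuous_const.inner continuous_toL2
  refine measurable_of_tendsto_metrizable hm (tendsto_pi_nhds.2 fun g => ?_)
  have hr := (continuous_subtype_val.tendsto (g t)).comp (g.tendsto_right ht)
  refine tendsto_of_tendsto_of_tendsto_of_le_of_le tendsto_const_nhds hr (fun n => ?_) fun n => ?_
  · rw [le_div_iff₀ (hv n)]
    calc (g t : ℝ) * (volume : Measure I).real (Ioo t (s n))
        = ∫ x in Ioo t (s n), (g t : ℝ) := by
          rw [setIntegral_const, smul_eq_mul, mul_comm]
      _ ≤ _ := setIntegral_mono_on (integrable_const _) (hint g n) measurableSet_Ioo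
          fun x hx => g.monotone' hx.1.le
  · simp only
    rw [div_le_iff₀ (hv n)]
    calc ∫ x in Ioo t (s n), (g x : ℝ)
        ≤ ∫ x in Ioo t (s n), (g (s n) : ℝ) := setIntegral_mono_on (hint g n) (integrable_const _)
          measurableSet_Ioo fun x hx => g.monotone' hx.2.le
      _ = _ := by rw [setIntegral_const, smul_eq_mul, mul_comm]; rfl

theorem measurable_eval_real (t : I) : Measurable fun g : G0 => (g t : ℝ) :=
  measurable_subtype_coe.comp (measurable_eval t)

theorem measurable_eval_uncurry : Measurable fun p : G0 × I => (p.1 p.2 : ℝ) :=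
  measurable_subtype_coe.comp (measurable_uncurry (φ := fun g : G0 => g) measurable_eval)

/-! ### Step functions -/

/-- The step function with value `v k` on `[k / N, (k + 1) / N[`. -/
def step (N : ℕ) (v : ℕ → I) (hv : Monotone v) (h1 : v N = 1) : G0 where
  toFun t := v ⌊(N : ℝ) * t⌋₊
  monotone' s t h := hv (Nat.floor_mono (mul_le_mul_of_nonneg_left h N.cast_nonneg))
  rightContinuous' t := by
    have h1 : ∀ᶠ s : I in 𝓝[≥] t, ⌊(N : ℝ) * s⌋₊ = ⌊(N : ℝ) * t⌋₊ := by
      have h2 : Tendsto (fun s : I => (N : ℝ) * s) (𝓝[≥] t) (𝓝 ((N : ℝ) * t)) :=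
        ((continuous_const.mul continuous_subtype_val).tendsto t).mono_left nhdsWithin_le_nhds
      filter_upwards [self_mem_nhdsWithin, h2.eventually (gt_mem_nhds (Nat.lt_floor_add_one _))]
        with s hs hs2
      refine le_antisymm ?_ (Nat.floor_mono (mul_le_mul_of_nonneg_left hs N.cast_nonneg))
      refine Nat.lt_succ_iff.1 ((Nat.floor_lt (mul_nonneg N.cast_nonneg s.2.1)).2 ?_)
      push_cast
      exact hs2
    exact (continuousWithinAt_const (b := v ⌊(N : ℝ) * t⌋₊)).congr_of_eventuallyEq
      (h1.mono fun s hs => congrArg v hs) rfl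
  map_one' := by simp [h1]

/-- The step function in `𝒢₀` with values `y₁, …, y_N` at the grid points `k / (N + 1)`. -/
def ofNodes {N : ℕ} (y : Fin N → ℝ) : G0 :=
  step (N + 1) (fun k => if k ≤ N then
      (Finset.univ.filter fun i : Fin (N + 1) => i.val ≤ k).sup
        fun i => projIcc (0 : ℝ) 1 zero_le_one (withEndpoints y i.castSucc) else 1)
    (fun a b h => by
      dsimp only
      split_ifs with ha hb
      · exact Finset.sup_mono fun i hi => by simp at hi ⊢; omega
      · exact le_top
      · omega
      · exact le_rfl)
    (by simp)

theorem measurable_ofNodes {N : ℕ} : Measurable (ofNodes (N := N)) := by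
  refine measurable_of_eval fun t => ?_
  dsimp only [ofNodes, step]
  split_ifs
  · refine Continuous.measurable ?_
    refine Continuous.finset_sup_apply fun i _ => continuous_projIcc.comp ?_
    refine Fin.cases ?_ (fun j => ?_) i
    · simp [withEndpoints, continuous_const]
    · simpa [withEndpoints, Fin.castSucc_succ] using continuous_apply j
  · exact measurable_const

/-- The clipped running supremum in `ofNodes` makes it an element of 𝒢₀ for arbitrary y; on monotone
data it returns the data. -/
theorem ofNodes_gridPt {N : ℕ} {y : Fin N → ℝ} (hy : Monotone (withEndpoints y)) {k : ℕ}
    (hk : k ≤ N) : (ofNodes y (gridPt (N + 1) k) : ℝ) =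
      withEndpoints y ⟨k, by omega⟩ := by
  have h1 : ⌊((N + 1 : ℕ) : ℝ) * (gridPt (N + 1) k : ℝ)⌋₊ = k := by
    rw [coe_gridPt (by omega), mul_div_cancel₀ _ (by positivity), Nat.floor_natCast]
  have h0 : withEndpoints y 0 = 0 := by simp [withEndpoints]
  have hl : withEndpoints y (Fin.last _) = 1 := by simp [withEndpoints, ← Fin.succ_last]
  dsimp only [ofNodes, step]
  rw [h1, if_pos hk]
  have hsup : ((Finset.univ.filter fun i : Fin (N + 1) => i.val ≤ k).sup
        fun i => projIcc (0 : ℝ) 1 zero_le_one (withEndpoints y i.castSucc)) =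
      projIcc (0 : ℝ) 1 zero_le_one (withEndpoints y ⟨k, by omega⟩) := by
    refine le_antisymm (Finset.sup_le fun i hi => monotone_projIcc _ (hy ?_)) ?_
    · simp at hi
      simpa [Fin.le_def] using hi
    · exact Finset.le_sup (f := fun i : Fin (N + 1) => projIcc (0 : ℝ) 1 zero_le_one
        (withEndpoints y i.castSucc)) (b := ⟨k, by omega⟩) (by simp)
  rw [hsup, projIcc_of_mem]
  exact ⟨h0 ▸ hy (Fin.zero_le _), hl ▸ hy (Fin.le_last _)⟩

/-- The values of `g` at the grid points `1 / (N + 1), …, N / (N + 1)`. -/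
def nodes (N : ℕ) (g : G0) (i : Fin N) : ℝ := g (gridPt (N + 1) (i + 1))

theorem measurable_nodes (N : ℕ) : Measurable (nodes N) :=
  measurable_pi_lambda _ fun _ => measurable_eval_real _

theorem withEndpoints_nodes (N : ℕ) (g : G0) (k : Fin (N + 2)) :
    withEndpoints (nodes N g) k = if k = 0 then 0 else (g (gridPt (N + 1) k) : ℝ) := by
  refine Fin.cases ?_ (fun j => ?_) k
  · simp [withEndpoints]
  · refine Fin.lastCases ?_ (fun i => ?_) j
    · simp [withEndpoints, gridPt_self N.succ_pos, map_one']
    · simp [withEndpoints, nodes]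

theorem monotone_withEndpoints_nodes (N : ℕ) (g : G0) :
    Monotone (withEndpoints (nodes N g)) := by
  intro a b h
  rw [withEndpoints_nodes, withEndpoints_nodes]
  split_ifs with h1 h2
  · exact le_rfl
  · exact (g _).2.1
  · subst_vars; exact absurd (le_antisymm h (Fin.zero_le _)) h1
  · exact g.monotone' (gridPt_mono _ h)

theorem ofNodes_nodes_gridPt {N : ℕ} (g : G0) {k : ℕ} (hk0 : 0 < k) (hk : k ≤ N) :
    ofNodes (nodes N g) (gridPt (N + 1) k) = g (gridPt (N + 1) k) := by
  ext
  rw [ofNodes_gridPt (monotone_withEndpoints_nodes N g) hk, withEndpoints_nodes,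
    if_neg (by simp [Fin.ext_iff]; omega)]

theorem tendsto_ofNodes_nodes {N : ℕ → ℕ} (hN : Tendsto N atTop atTop) (g : G0) :
    Tendsto (fun n => ofNodes (nodes (N n) g)) atTop (𝓝 g) :=
  tendsto_of_nodes (N := fun n => N n + 1) ((tendsto_add_atTop_nat 1).comp hN)
    (ε := fun _ => 0) tendsto_const_nhds fun n k hk0 hk => by
      rw [ofNodes_nodes_gridPt g hk0 (by omega)]; simp

end G0
end

noncomputable section

/-! ### Sums of independent gamma variables over blocks -/

theorem map_sum_infinitePi_gamma {ι : Type*} [Fintype ι] [Nonempty ι] {a : ι → ℝ}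
    (ha : ∀ i, 0 < a i) :
    (Measure.infinitePi fun i => gammaMeasure (a i) 1).map (fun ω => ∑ i, ω i) =
      gammaMeasure (∑ i, a i) 1 := by
  have := fun i => isProbabilityMeasure_gammaMeasure (ha i) one_pos
  obtain ⟨N, hN⟩ := Nat.exists_eq_succ_of_ne_zero (Fintype.card_ne_zero (α := ι))
  let e : Fin (N + 1) ≃ ι := (finCongr hN.symm).trans (Fintype.equivFin ι).symm
  have h1 := Measure.map_infinitePi_infinitePi_of_inj
    (P := fun i => gammaMeasure (a i) 1) e.injective
  have h2 := map_sum_gamma (N := N) (a := fun j => a (e j)) fun j => ha _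
  have hs : Measurable fun y : Fin (N + 1) → ℝ => ∑ i, y i := by fun_prop
  have hp : Measurable fun (ω : ι → ℝ) (j : Fin (N + 1)) => ω (e j) := by fun_prop
  rw [← Measure.infinitePi_eq_pi, ← h1, Measure.map_map hs hp, Equiv.sum_comp e a] at h2
  rw [← h2]
  congr 1
  funext ω
  exact (Equiv.sum_comp e ω).symm

/-- Disjoint blocks of independent variables are independent, and each block sum is again gamma. The
proof restricts to the disjoint union of the blocks, curries, and sums inside each block. -/
theorem map_blockSum_gamma {ι κ : Type*} [Fintype ι] [Fintype κ] {a : ι → ℝ} (ha : ∀ i, 0 < a i)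
    {S : κ → Finset ι} (hS : ∀ k, (S k).Nonempty) (hd : Pairwise (Function.onFun Disjoint S)) :
    (Measure.pi fun i => gammaMeasure (a i) 1).map (fun ω k => ∑ i ∈ S k, ω i) =
      Measure.pi fun k => gammaMeasure (∑ i ∈ S k, a i) 1 := by
  have := fun i => isProbabilityMeasure_gammaMeasure (ha i) one_pos
  have := fun k => (hS k).to_subtype
  have := fun k => isProbabilityMeasure_gammaMeasure
    (Finset.sum_pos (fun i _ => ha i) (hS k)) one_pos
  have : ∀ k, IsProbabilityMeasure (gammaMeasure (∑ i : S k, a i) 1) := fun k => by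
    rw [Finset.sum_coe_sort (S k) a]; infer_instance
  have hinj : Function.Injective fun p : (k : κ) × S k => (p.2 : ι) := by
    rintro ⟨k, i, hi⟩ ⟨l, j, hj⟩ (rfl : i = j)
    by_cases hkl : k = l
    · subst hkl; rfl
    · exact absurd hj (Finset.disjoint_left.1 (hd hkl) hi)
  have h1 := Measure.map_infinitePi_infinitePi_of_inj (P := fun i => gammaMeasure (a i) 1) hinj
  have h2 := Measure.infinitePi_map_piCurry (X := fun (k : κ) (_ : S k) => ℝ)
    fun (k : κ) (j : S k) => gammaMeasure (a j) 1
  have h3 := Measure.infinitePi_map_pi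
    (μ := fun k : κ => Measure.infinitePi fun j : S k => gammaMeasure (a j) 1)
    (f := fun k ω => ∑ j, ω j) fun k => by fun_prop
  have hm1 : Measurable fun (ω : ι → ℝ) (p : (k : κ) × S k) => ω p.2 := by fun_prop
  have hm2 : Measurable (MeasurableEquiv.piCurry fun (k : κ) (_ : S k) => ℝ) :=
    MeasurableEquiv.measurable _
  have hm3 : Measurable fun (x : (k : κ) → S k → ℝ) k => ∑ j, x k j := by fun_prop
  rw [← h2, ← h1, Measure.map_map hm2 hm1, Measure.map_map hm3 (hm2.comp hm1)] at h3
  simp only [map_sum_infinitePi_gamma (fun j : S _ => ha j)] at h3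
  rw [Measure.infinitePi_eq_pi, Measure.infinitePi_eq_pi] at h3
  have h4 : (fun k => gammaMeasure (∑ i : S k, a i) 1) = fun k => gammaMeasure (∑ i ∈ S k, a i) 1 := by
    funext k
    rw [Finset.sum_coe_sort (S k) a]
  rw [h4] at h3
  rw [← h3]
  congr 1
  funext ω k
  exact (Finset.sum_coe_sort (S k) ω).symm

theorem ae_increments_pos {N : ℕ} (a : Fin (N + 1) → ℝ) :
    ∀ᵐ x ∂(volume : Measure (Fin N → ℝ)).withDensity (dirichletPDF a),
      ∀ i, 0 < increments x i := by
  rw [ae_withDensity_iff (measurable_dirichletPDF a)]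
  refine ae_of_all _ fun x hx => ?_
  by_contra h
  exact hx (by rw [dirichletPDF, if_neg h])

theorem withEndpoints_mem_Icc {N : ℕ} {x : Fin N → ℝ} (hx : ∀ i, 0 < increments x i)
    (k : Fin (N + 2)) : withEndpoints x k ∈ Icc (0 : ℝ) 1 := by
  have hm := (strictMono_withEndpoints_iff.2 hx).monotone
  have h0 : withEndpoints x 0 = 0 := by simp [withEndpoints]
  have hl : withEndpoints x (Fin.last _) = 1 := by simp [withEndpoints, ← Fin.succ_last]
  exact ⟨h0 ▸ hm (Fin.zero_le _), hl ▸ hm (Fin.le_last _)⟩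

theorem withEndpoints_castSucc_succ {N : ℕ} (x : Fin N → ℝ) (i : Fin N) :
    withEndpoints x i.castSucc.succ = x i := by simp [withEndpoints]

/-! ### Existence of the Dirichlet process -/

/-- The sum of the first `m` coordinates. -/
def initialSum {n : ℕ} (ω : Fin n → ℝ) (m : ℕ) : ℝ :=
  ∑ j ∈ Finset.univ.filter (fun j : Fin n => j.val < m), ω j

/-- The index set of the cells `[j / n, (j + 1) / n[` between `⌊n s⌋` and `⌊n t⌋`. -/
def cells (n : ℕ) (s t : ℝ) : Finset (Fin n) :=
  Finset.univ.filter fun j : Fin n => ⌊(n : ℝ) * s⌋₊ ≤ j.val ∧ j.val < ⌊(n : ℝ) * t⌋₊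

theorem sum_cells {n : ℕ} (ω : Fin n → ℝ) {s t : ℝ} (hst : s ≤ t) :
    ∑ j ∈ cells n s t, ω j = initialSum ω ⌊(n : ℝ) * t⌋₊ - initialSum ω ⌊(n : ℝ) * s⌋₊ := by
  have hfl : ⌊(n : ℝ) * s⌋₊ ≤ ⌊(n : ℝ) * t⌋₊ := Nat.floor_mono (by gcongr)
  rw [eq_sub_iff_add_eq, initialSum, initialSum, cells, ← Finset.sum_union]
  · refine Finset.sum_congr ?_ fun _ _ => rfl
    ext j
    simp only [Finset.mem_union, Finset.mem_filter, Finset.mem_univ, true_and]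
    omega
  · refine Finset.disjoint_left.2 fun j => ?_
    simp only [Finset.mem_filter, Finset.mem_univ, true_and]
    omega

theorem sum_Iic_sub {N : ℕ} (f : Fin (N + 2) → ℝ) (i : Fin (N + 1)) :
    ∑ k ∈ Finset.Iic i, (f k.succ - f k.castSucc) = f i.succ - f 0 := by
  induction i using Fin.induction with
  | zero =>
    have : Finset.Iic (0 : Fin (N + 1)) = {0} := by ext j; simp
    rw [this]
    simp
  | succ i ih =>
    have : Finset.Iic i.succ = insert i.succ (Finset.Iic i.castSucc) := by
      ext j; simp [Fin.le_def, Fin.ext_iff]; omega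
    rw [this, Finset.sum_insert (by simp [Fin.le_def]), ih, Fin.succ_castSucc]
    ring

theorem initialSum_zero {n : ℕ} (ω : Fin n → ℝ) : initialSum ω 0 = 0 := by simp [initialSum]

theorem initialSum_self {n : ℕ} (ω : Fin n → ℝ) : initialSum ω n = ∑ j, ω j := by
  simp [initialSum]

/-- The joint law of the normalized partial sums of equidistributed gamma variables. -/
theorem map_initialSum_div {β : ℝ} (hβ : 0 < β) {N n : ℕ} {t : Fin N → ℝ}
    (hn : ∀ k, 1 < n * increments t k) :
    (Measure.pi fun _ : Fin n => gammaMeasure (β / n) 1).map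
      (fun ω (i : Fin N) => initialSum ω ⌊(n : ℝ) * t i⌋₊ / ∑ j, ω j) =
    volume.withDensity (dirichletPDF fun k => ∑ _j ∈ cells n (withEndpoints t k.castSucc)
      (withEndpoints t k.succ), β / n) := by
  have hn0 : (0 : ℝ) < n := by
    by_contra h
    have h0 : (n : ℝ) = 0 := le_antisymm (not_lt.1 h) n.cast_nonneg
    have := hn 0
    rw [h0, zero_mul] at this
    linarith
  have hinc : ∀ k, 0 < increments t k := fun k => by
    have := hn k
    by_contra h
    have := mul_nonpos_of_nonneg_of_nonpos hn0.le (not_lt.1 h)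
    linarith
  have hmono := (strictMono_withEndpoints_iff.2 hinc)
  -- A gap longer than one cell changes the floor; hence every block of cells is nonempty and its
  -- gamma parameter positive.
  have hfl : ∀ k : Fin (N + 1), ⌊(n : ℝ) * withEndpoints t k.castSucc⌋₊ <
      ⌊(n : ℝ) * withEndpoints t k.succ⌋₊ := fun k => by
    have h1 := hn k
    rw [increments, mul_sub] at h1
    have h2 := Nat.floor_le (mul_nonneg hn0.le (withEndpoints_mem_Icc hinc k.castSucc).1)
    have h3 := Nat.lt_floor_add_one ((n : ℝ) * withEndpoints t k.succ)
    have : (⌊(n : ℝ) * withEndpoints t k.castSucc⌋₊ : ℝ) < ⌊(n : ℝ) * withEndpoints t k.succ⌋₊ := by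
      linarith
    exact_mod_cast this
  have hle : ∀ k, ⌊(n : ℝ) * withEndpoints t k⌋₊ ≤ n := fun k => by
    refine Nat.floor_le_of_le ?_
    exact mul_le_of_le_one_right hn0.le (withEndpoints_mem_Icc hinc k).2
  have hne : ∀ k : Fin (N + 1), (cells n (withEndpoints t k.castSucc)
      (withEndpoints t k.succ)).Nonempty := fun k =>
    ⟨⟨_, (hfl k).trans_le (hle _)⟩, by simp [cells, hfl k]⟩
  have hdis : Pairwise (Function.onFun Disjoint fun k : Fin (N + 1) =>
      cells n (withEndpoints t k.castSucc) (withEndpoints t k.succ)) := by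
    have key : ∀ k l : Fin (N + 1), k < l → Disjoint
        (cells n (withEndpoints t k.castSucc) (withEndpoints t k.succ))
        (cells n (withEndpoints t l.castSucc) (withEndpoints t l.succ)) := fun k l hkl => by
      refine Finset.disjoint_left.2 fun j hj hj' => ?_
      simp only [cells, Finset.mem_filter, Finset.mem_univ, true_and] at hj hj'
      have : ⌊(n : ℝ) * withEndpoints t k.succ⌋₊ ≤ ⌊(n : ℝ) * withEndpoints t l.castSucc⌋₊ :=
        Nat.floor_mono (mul_le_mul_of_nonneg_left (hmono.monotone (by
          simp only [Fin.le_def, Fin.lt_def, Fin.val_succ, Fin.val_castSucc] at hkl ⊢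
          omega)) hn0.le)
      omega
    intro k l hkl
    rcases lt_or_gt_of_ne hkl with h | h
    · exact key k l h
    · exact (key l k h).symm
  have hpos : ∀ _ : Fin n, 0 < β / n := fun _ => by positivity
  have h1 := map_blockSum_gamma hpos hne hdis
  have h2 := map_normalizedSums_gamma (N := N) (a := fun k => ∑ _j ∈ cells n
    (withEndpoints t k.castSucc) (withEndpoints t k.succ), β / n)
    fun k => Finset.sum_pos (fun j _ => hpos j) (hne k)
  rw [← h2, ← h1, Measure.map_map measurable_normalizedSums (by fun_prop)]
  congr 1
  funext ω i
  simp only [Function.comp_apply, normalizedSums]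
  -- The block sums telescope to initial sums.
  have hsum : ∀ i : Fin (N + 1), ∑ k ∈ Finset.Iic i, ∑ j ∈ cells n (withEndpoints t k.castSucc)
      (withEndpoints t k.succ), ω j = initialSum ω ⌊(n : ℝ) * withEndpoints t i.succ⌋₊ := by
    intro i
    rw [Finset.sum_congr rfl fun k _ => sum_cells ω (hmono.monotone (Fin.castSucc_lt_succ (i := k)).le),
      sum_Iic_sub (fun k => initialSum ω ⌊(n : ℝ) * withEndpoints t k⌋₊)]
    simp [withEndpoints, initialSum_zero]
  have htot := hsum (Fin.last N)
  rw [show Finset.Iic (Fin.last N) = Finset.univ by ext j; simp [Fin.le_last]] at htot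
  rw [hsum, htot, withEndpoints_castSucc_succ]
  simp [withEndpoints, initialSum_self]

theorem tendsto_sum_cells {β s t : ℝ} (hs : 0 ≤ s) (hst : s ≤ t) (ht : t ≤ 1) :
    Tendsto (fun n : ℕ => ∑ _j ∈ cells n s t, β / n) atTop (𝓝 (β * (t - s))) := by
  have h1 : ∀ u : ℝ, 0 ≤ u → Tendsto (fun n : ℕ => (⌊u * (n : ℝ)⌋₊ : ℝ) / n) atTop (𝓝 u) :=
    fun u hu => (tendsto_nat_floor_mul_div_atTop hu).comp tendsto_natCast_atTop_atTop
  have h2 := ((h1 t (hs.trans hst)).sub (h1 s hs)).const_mul β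
  refine h2.congr fun n => ?_
  have hc : ∀ u : ℝ, u ≤ 1 → initialSum (fun _ : Fin n => β / n) ⌊(n : ℝ) * u⌋₊ =
      β * ((⌊u * (n : ℝ)⌋₊ : ℝ) / n) := fun u hu => by
    have : ⌊(n : ℝ) * u⌋₊ ≤ n := Nat.floor_le_of_le (mul_le_of_le_one_right n.cast_nonneg hu)
    rw [initialSum, Finset.sum_const, Fin.card_filter_val_lt, min_eq_right this, nsmul_eq_mul,
      mul_comm u]
    ring
  rw [sum_cells (fun _ => β / (n : ℝ)) hst, hc t ht, hc s (hst.trans ht), mul_sub]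


/-- The Dirichlet random vector at level `n`, indexed by the rationals. -/
def ratVector {n : ℕ} (ω : Fin n → ℝ) (q : ℚ) : I :=
  projIcc 0 1 zero_le_one (initialSum ω ⌊(n : ℝ) * q⌋₊ / ∑ j, ω j)

theorem measurable_ratVector {n : ℕ} : Measurable (ratVector (n := n)) := by
  refine measurable_pi_lambda _ fun q => continuous_projIcc.measurable.comp ?_
  unfold initialSum
  fun_prop

/-- Evaluation of an element of `ℚ → I` at finitely many rationals. -/
def ratEval {N : ℕ} (q : Fin N → ℚ) (x : ℚ → I) (i : Fin N) : ℝ := x (q i)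

theorem continuous_ratEval {N : ℕ} (q : Fin N → ℚ) : Continuous (ratEval q) :=
  continuous_pi fun i => continuous_subtype_val.comp (continuous_apply (q i))

/-- The clipping to [0,1] in `ratVector` is harmless, since Dirichlet vectors lie in the simplex
almost surely. -/
theorem map_ratEval_ratVector {β : ℝ} (hβ : 0 < β) {N n : ℕ} {q : Fin N → ℚ}
    (hn : ∀ k, 1 < n * increments (fun i => (q i : ℝ)) k) :
    ((Measure.pi fun _ : Fin n => gammaMeasure (β / n) 1).map ratVector).map (ratEval q) =
    volume.withDensity (dirichletPDF fun k => ∑ _j ∈ cells n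
      (withEndpoints (fun i => (q i : ℝ)) k.castSucc)
      (withEndpoints (fun i => (q i : ℝ)) k.succ), β / n) := by
  have h1 := map_initialSum_div hβ hn
  set D := (volume : Measure (Fin N → ℝ)).withDensity (dirichletPDF fun k => ∑ _j ∈ cells n
      (withEndpoints (fun i => (q i : ℝ)) k.castSucc)
      (withEndpoints (fun i => (q i : ℝ)) k.succ), β / n) with hD
  have hp : Measurable fun (x : Fin N → ℝ) i => (projIcc (0 : ℝ) 1 zero_le_one (x i) : ℝ) :=
    (continuous_pi fun i => continuous_subtype_val.comp
      (continuous_projIcc.comp (continuous_apply i))).measurable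
  have hm : Measurable fun (ω : Fin n → ℝ) (i : Fin N) =>
      initialSum ω ⌊(n : ℝ) * (q i : ℝ)⌋₊ / ∑ j, ω j := by
    unfold initialSum
    fun_prop
  rw [Measure.map_map (continuous_ratEval q).measurable measurable_ratVector]
  have h2 : ratEval q ∘ ratVector (n := n) = (fun (x : Fin N → ℝ) i =>
      (projIcc (0 : ℝ) 1 zero_le_one (x i) : ℝ)) ∘ fun (ω : Fin n → ℝ) (i : Fin N) =>
      initialSum ω ⌊(n : ℝ) * (q i : ℝ)⌋₊ / ∑ j, ω j := rfl
  rw [h2, ← Measure.map_map hp hm, h1]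
  have h3 : (fun (x : Fin N → ℝ) i => (projIcc (0 : ℝ) 1 zero_le_one (x i) : ℝ)) =ᵐ[D] id := by
    filter_upwards [ae_increments_pos _] with x hx
    funext i
    have := withEndpoints_mem_Icc hx i.castSucc.succ
    rw [withEndpoints_castSucc_succ] at this
    rw [projIcc_of_mem _ this, id]
  rw [Measure.map_congr h3, Measure.map_id]

/-- There is a random element of `[0,1]^ℚ` with Dirichlet finite dimensional distributions. -/
theorem exists_measure_rat {β : ℝ} (hβ : 0 < β) :
    ∃ μ : ProbabilityMeasure (ℚ → I), ∀ (N : ℕ) (q : Fin N → ℚ),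
      (∀ k, 0 < increments (fun i => (q i : ℝ)) k) →
      (μ : Measure (ℚ → I)).map (ratEval q) =
        volume.withDensity (dirichletPDF fun k => β * increments (fun i => (q i : ℝ)) k) := by
  have hP : ∀ n : ℕ, IsProbabilityMeasure
      ((Measure.pi fun _ : Fin (n + 1) => gammaMeasure (β / (n + 1 : ℕ)) 1).map ratVector) :=
    fun n => by
      have := isProbabilityMeasure_gammaMeasure (a := β / (n + 1 : ℕ)) (by positivity) one_pos
      exact Measure.isProbabilityMeasure_map measurable_ratVector.aemeasurable
  let P : ℕ → ProbabilityMeasure (ℚ → I) := fun n => ⟨_, hP n⟩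
  -- Probability measures on the compact space [0,1]^ℚ form a compact space, so the laws of the
  -- discrete approximations converge along an ultrafilter.
  obtain ⟨μ, -, hμ⟩ := isCompact_univ.ultrafilter_le_nhds ((hyperfilter ℕ).map P) (by simp)
  refine ⟨μ, fun N q hq => ?_⟩
  have hm := (continuous_ratEval q).measurable
  have : IsProbabilityMeasure ((μ : Measure (ℚ → I)).map (ratEval q)) :=
    Measure.isProbabilityMeasure_map hm.aemeasurable
  have hμ' : Tendsto P (hyperfilter ℕ : Filter ℕ) (𝓝 μ) := hμ
  rw [ProbabilityMeasure.tendsto_iff_forall_lintegral_tendsto] at hμ'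
  have hlt := Nat.hyperfilter_le_atTop
  have hI := fun k => withEndpoints_mem_Icc hq k
  have hmono := (strictMono_withEndpoints_iff.2 hq).monotone
  refine eq_dirichlet_of_tendsto (b := fun n k => ∑ _j ∈ cells (n + 1)
    (withEndpoints (fun i => (q i : ℝ)) k.castSucc)
    (withEndpoints (fun i => (q i : ℝ)) k.succ), β / (n + 1 : ℕ))
    (fun k => mul_pos hβ (hq k)) (tendsto_pi_nhds.2 fun k => ?_) hlt fun f => ?_
  · exact (tendsto_sum_cells (hI _).1 (hmono (Fin.castSucc_lt_succ (i := k)).le) (hI _).2).comp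
      (tendsto_add_atTop_nat 1)
  · have hf : Measurable fun x => (f x : ℝ≥0∞) :=
      (ENNReal.continuous_coe.comp f.continuous).measurable
    have h1 := hμ' (f.compContinuous ⟨ratEval q, continuous_ratEval q⟩)
    rw [lintegral_map hf hm]
    refine h1.congr' ?_
    have hev : ∀ᶠ n : ℕ in atTop, ∀ k,
        1 < ((n + 1 : ℕ) : ℝ) * increments (fun i => (q i : ℝ)) k := by
      refine eventually_all.2 fun k => ?_
      have h2 : Tendsto (fun n : ℕ => ((n + 1 : ℕ) : ℝ)) atTop atTop :=
        tendsto_natCast_atTop_atTop.comp (tendsto_add_atTop_nat 1)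
      exact (h2.atTop_mul_const (hq k)).eventually_gt_atTop 1
    filter_upwards [hlt hev] with n hn
    rw [← map_ratEval_ratVector hβ hn, lintegral_map hf hm]
    rfl

namespace G0

/-- The right limits of a function on the rationals, as an element of `𝒢₀`. -/
def ofRat (x : ℚ → I) : G0 where
  -- The default 1 is the top element, so it drops out of the infimum and also gives the value 1 at
  -- t = 1.
  toFun t := ⨅ q : ℚ, if (t : ℝ) < q ∧ (q : ℝ) < 1 then x q else 1
  monotone' s t h := iInf_mono fun q => by
    have h : (s : ℝ) ≤ t := h
    split_ifs with h1 h2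
    · exact le_rfl
    · exact le_top
    · exact absurd ⟨h.trans_lt (by tauto), by tauto⟩ h1
    · exact le_rfl
  rightContinuous' t := by
    refine tendsto_order.2 ⟨fun a ha => ?_, fun a ha => ?_⟩
    · filter_upwards [self_mem_nhdsWithin] with s hs
      refine ha.trans_le (iInf_mono fun q => ?_)
      have h : (t : ℝ) ≤ s := hs
      split_ifs with h1 h2
      · exact le_rfl
      · exact le_top
      · exact absurd ⟨h.trans_lt (by tauto), by tauto⟩ h1
      · exact le_rfl
    · obtain ⟨q, hq⟩ := iInf_lt_iff.1 ha
      split_ifs at hq with h1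
      · have : ∀ᶠ s : I in 𝓝 t, (s : ℝ) < q :=
          continuous_subtype_val.continuousAt.eventually (gt_mem_nhds h1.1)
        filter_upwards [nhdsWithin_le_nhds this] with s hs
        exact (iInf_le _ q).trans_lt (by rwa [if_pos ⟨hs, h1.2⟩])
      · exact absurd hq (not_lt.2 le_top)
  map_one' := by
    refine le_antisymm le_top (le_iInf fun q => ?_)
    rw [if_neg fun h => absurd (h.1.trans h.2) (lt_irrefl _)]

theorem measurable_ofRat : Measurable ofRat := by
  refine measurable_of_eval fun t => Measurable.iInf fun q => ?_
  split_ifs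
  · exact measurable_pi_apply q
  · exact measurable_const

theorem tendsto_ofRat {x : ℚ → I} (hx : ∀ p q : ℚ, 0 < p → p < q → q < 1 → x p ≤ x q) {t : I}
    {d : ℕ → ℚ} (hd : ∀ n, (t : ℝ) < d n) (ht : (t : ℝ) < 1)
    (hdt : Tendsto (fun n => (d n : ℝ)) atTop (𝓝 t)) :
    Tendsto (fun n => x (d n)) atTop (𝓝 (ofRat x t)) := by
  have hd1 := hdt.eventually (gt_mem_nhds ht)
  refine tendsto_order.2 ⟨fun a ha => ?_, fun a ha => ?_⟩
  · filter_upwards [hd1] with n hn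
    refine ha.trans_le ((iInf_le _ (d n)).trans_eq ?_)
    rw [if_pos ⟨hd n, hn⟩]
  · obtain ⟨q, hq⟩ := iInf_lt_iff.1 ha
    split_ifs at hq with h1
    · filter_upwards [hdt.eventually (gt_mem_nhds h1.1)] with n hn
      refine (hx _ _ ?_ (by exact_mod_cast hn) (by exact_mod_cast h1.2)).trans_lt hq
      exact_mod_cast t.2.1.trans_lt (hd n)
    · exact absurd hq (not_lt.2 le_top)

end G0

theorem increments_pair_one (x : Fin 2 → ℝ) : increments x 1 = x 1 - x 0 := rfl

theorem increments_pos_pair {p q : ℝ} (hp : 0 < p) (hpq : p < q) (hq : q < 1) {x : Fin 2 → ℝ}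
    (h0 : x 0 = p) (h1 : x 1 = q) : ∀ k, 0 < increments x k := by
  intro k
  fin_cases k
  · change 0 < x 0 - 0
    linarith
  · change 0 < x 1 - x 0
    linarith
  · change 0 < 1 - x 1
    linarith

theorem continuous_increments {N : ℕ} (k : Fin (N + 1)) :
    Continuous fun x : Fin N → ℝ => increments x k := by
  have : ∀ j : Fin (N + 2), Continuous fun x : Fin N → ℝ => withEndpoints x j := by
    intro j
    refine Fin.cases ?_ (fun k => ?_) j
    · simpa [withEndpoints] using continuous_const
    · refine Fin.lastCases ?_ (fun l => ?_) k
      · simpa [withEndpoints] using continuous_const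
      · simpa [withEndpoints] using continuous_apply l
  exact (this _).sub (this _)

/-- The two-point marginals make the field on ℚ ∩ (0,1) almost surely monotone, so right limits
define an element of 𝒢₀. Its marginals at real times are limits of those at rational times
decreasing to them, and limits of Dirichlet laws are Dirichlet. -/
theorem exists_isDirichletProcess {β : ℝ} (hβ : 0 < β) : ∃ Q, IsDirichletProcess β Q := by
  obtain ⟨μ, hμ⟩ := exists_measure_rat hβ
  have hmono : ∀ᵐ x ∂(μ : Measure (ℚ → I)), ∀ p q : ℚ, 0 < p → p < q → q < 1 → x p ≤ x q := by
    refine ae_all_iff.2 fun p => ae_all_iff.2 fun q => ?_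
    by_cases h : 0 < p ∧ p < q ∧ q < 1
    · have h1 := hμ 2 ![p, q] (increments_pos_pair (p := p) (q := q) (by exact_mod_cast h.1)
        (by exact_mod_cast h.2.1) (by exact_mod_cast h.2.2) (by simp) (by simp))
      have h2 := ae_increments_pos fun k => β * increments (fun i => ((![p, q] i : ℚ) : ℝ)) k
      rw [← h1] at h2
      have h3 := ae_of_ae_map (continuous_ratEval _).measurable.aemeasurable h2
      filter_upwards [h3] with x hx _ _ _
      have := hx 1
      rw [increments_pair_one] at this
      have h4 : (x p : ℝ) ≤ x q := by simpa [ratEval] using this.le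
      exact h4
    · exact ae_of_all _ fun x h1 h2 h3 => absurd ⟨h1, h2, h3⟩ h
  refine ⟨(μ : Measure (ℚ → I)).map G0.ofRat,
    Measure.isProbabilityMeasure_map G0.measurable_ofRat.aemeasurable, fun N t ht => ?_⟩
  rw [strictMono_withEndpoints_iff] at ht
  have he : Measurable fun (g : G0) (i : Fin N) => (g (t i) : ℝ) :=
    measurable_pi_lambda _ fun i => G0.measurable_eval_real _
  rw [Measure.map_map he G0.measurable_ofRat]
  simp only [ofReal_dirichletDensity]
  have ht1 : ∀ i, (t i : ℝ) < 1 := fun i => by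
    have h1 := (strictMono_withEndpoints_iff.2 ht) (Fin.castSucc_lt_last i.succ)
    rw [Fin.castSucc_succ, withEndpoints_castSucc_succ] at h1
    simpa [withEndpoints, ← Fin.succ_last] using h1
  have hex : ∀ i (n : ℕ), ∃ d : ℚ, (t i : ℝ) < d ∧ (d : ℝ) < t i + 1 / ((n : ℝ) + 1) := fun i n =>
    exists_rat_btwn (lt_add_of_pos_right _ (by positivity))
  choose d hd1 hd2 using hex
  have hdt : ∀ i, Tendsto (fun n => (d i n : ℝ)) atTop (𝓝 (t i)) := fun i => by
    have h1 := (tendsto_one_div_add_atTop_nhds_zero_nat (𝕜 := ℝ)).const_add (t i : ℝ)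
    rw [add_zero] at h1
    exact tendsto_of_tendsto_of_tendsto_of_le_of_le tendsto_const_nhds h1
      (fun n => (hd1 i n).le) fun n => (hd2 i n).le
  have hinc : ∀ k, Tendsto (fun n => increments (fun i => (d i n : ℝ)) k) atTop
      (𝓝 (increments (fun i => (t i : ℝ)) k)) := fun k =>
    ((continuous_increments k).tendsto _).comp (tendsto_pi_nhds.2 hdt)
  have hm := he.comp G0.measurable_ofRat
  have : IsProbabilityMeasure ((μ : Measure (ℚ → I)).map
      ((fun (g : G0) (i : Fin N) => (g (t i) : ℝ)) ∘ G0.ofRat)) :=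
    Measure.isProbabilityMeasure_map hm.aemeasurable
  refine eq_dirichlet_of_tendsto (b := fun n k => β * increments (fun i => (d i n : ℝ)) k)
    (fun k => mul_pos hβ (ht k)) (tendsto_pi_nhds.2 fun k => (hinc k).const_mul β) le_rfl
    fun f => ?_
  have hf : Measurable fun x => (f x : ℝ≥0∞) :=
    (ENNReal.continuous_coe.comp f.continuous).measurable
  rw [lintegral_map hf hm]
  have hlim : Tendsto (fun n => ∫⁻ x, f (ratEval (fun i => d i n) x) ∂(μ : Measure (ℚ → I))) atTop
      (𝓝 (∫⁻ x, f (((fun (g : G0) (i : Fin N) => (g (t i) : ℝ)) ∘ G0.ofRat) x)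
        ∂(μ : Measure (ℚ → I)))) := by
    refine tendsto_lintegral_filter_of_dominated_convergence (fun _ => (nndist f 0 : ℝ≥0∞))
      (Eventually.of_forall fun n => hf.comp (continuous_ratEval _).measurable)
      (Eventually.of_forall fun n => ae_of_all _ fun x => ?_) (by simp) ?_
    · exact_mod_cast BoundedContinuousFunction.NNReal.upper_bound f _
    · filter_upwards [hmono] with x hx
      refine (ENNReal.continuous_coe.tendsto _).comp ((f.continuous.tendsto _).comp ?_)
      exact tendsto_pi_nhds.2 fun i => (continuous_subtype_val.tendsto _).comp
        (G0.tendsto_ofRat hx (hd1 i) (ht1 i) (hdt i))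
  refine hlim.congr' ?_
  have hev : ∀ᶠ n in atTop, ∀ k, 0 < increments (fun i => (d i n : ℝ)) k :=
    eventually_all.2 fun k => (hinc k).eventually (lt_mem_nhds (ht k))
  filter_upwards [hev] with n hn
  rw [← hμ N _ hn, lintegral_map hf (continuous_ratEval _).measurable]

/-- The chosen measure is used only through its finite dimensional marginals, so no uniqueness
statement is required. -/
theorem isDirichletProcess_dirichletProcess {β : ℝ} (hβ : 0 < β) :
    IsDirichletProcess β (dirichletProcess β) :=
  Classical.epsilon_spec (exists_isDirichletProcess hβ)

end

noncomputable section

namespace G0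

/-! ### Reweighting -/

/-- The function `g` stopped at the grid point `k / n`, and `0` if `k = 0`. -/
def cut (g : G0) (n k : ℕ) (t : I) : ℝ := if k = 0 then 0 else (g (min t (gridPt n k)) : ℝ)

theorem cut_zero (g : G0) (n : ℕ) (t : I) : cut g n 0 t = 0 := if_pos rfl

theorem cut_succ (g : G0) (n k : ℕ) (t : I) : cut g n (k + 1) t = g (min t (gridPt n (k + 1))) :=
  if_neg k.succ_ne_zero

theorem cut_self (g : G0) (n : ℕ) (t : I) : cut g (n + 1) (n + 1) t = g t := by
  rw [cut_succ, gridPt_self n.succ_pos, min_eq_left unitInterval.le_one']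

theorem cut_mono (g : G0) (n : ℕ) (t : I) : Monotone fun k => cut g n k t := by
  intro a b h
  simp only [cut]
  split_ifs with h1 h2
  · exact le_rfl
  · exact (g _).2.1
  · omega
  · exact g.monotone' (min_le_min_left _ (gridPt_mono n h))

theorem cut_succ_sub_nonneg (g : G0) (n k : ℕ) (t : I) : 0 ≤ cut g n (k + 1) t - cut g n k t :=
  sub_nonneg.2 (cut_mono g n t k.le_succ)

/-- The difference is the dg-mass of the k-th cell inside [0, t], so it grows with t. -/
theorem cut_succ_sub_mono (g : G0) (n k : ℕ) :
    Monotone fun t => cut g n (k + 1) t - cut g n k t := by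
  intro s t hst
  rcases k with _ | k
  · simp only [cut_zero, sub_zero, cut_succ]
    exact g.monotone' (min_le_min_right _ hst)
  · rcases le_total t (gridPt n (k + 1)) with h | h
    · have h' := gridPt_mono n (Nat.le_succ (k + 1))
      simp only [cut_succ, min_eq_left h, min_eq_left (hst.trans h), min_eq_left (h.trans h'),
        min_eq_left ((hst.trans h).trans h'), sub_self, le_refl]
    · rcases le_total s (gridPt n (k + 1)) with h2 | h2
      · have h' := gridPt_mono n (Nat.le_succ (k + 1))
        have : cut g n (k + 1 + 1) s - cut g n (k + 1) s = 0 := by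
          simp only [cut_succ, min_eq_left h2, min_eq_left (h2.trans h'), sub_self]
        simp only [this]
        exact cut_succ_sub_nonneg _ _ _ _
      · simp only [cut_succ (k := k), min_eq_right h, min_eq_right h2]
        refine sub_le_sub_right ?_ _
        simp only [cut_succ]
        exact g.monotone' (min_le_min_right _ hst)

theorem cut_rightContinuous (g : G0) (n k : ℕ) (t : I) :
    ContinuousWithinAt (cut g n k) (Ici t) t := by
  rcases k with _ | k
  · exact continuousWithinAt_const.congr (fun _ _ => cut_zero _ _ _) (cut_zero _ _ _)
  · have h1 : Tendsto (fun s => min s (gridPt n (k + 1))) (𝓝[≥] t)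
        (𝓝[≥] (min t (gridPt n (k + 1)))) := by
      refine tendsto_nhdsWithin_iff.2 ⟨?_, ?_⟩
      · exact ((continuous_id.min continuous_const).tendsto t).mono_left nhdsWithin_le_nhds
      · filter_upwards [self_mem_nhdsWithin] with s hs
        exact min_le_min_right _ (mem_Ici.1 hs)
    have h2 := (continuous_subtype_val.tendsto _).comp ((g.rightContinuous' _).tendsto.comp h1)
    have h3 : Tendsto (cut g n (k + 1)) (𝓝[≥] t) (𝓝 (cut g n (k + 1) t)) := by
      rw [cut_succ]
      exact h2.congr fun s => (cut_succ g n k s).symm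
    exact h3

theorem measurable_cut (n k : ℕ) (t : I) : Measurable fun g : G0 => cut g n k t := by
  rcases k with _ | k
  · simp only [cut_zero]; exact measurable_const
  · simp only [cut_succ]; exact measurable_eval_real _

/-- The integral of the weight with value `w k` on the `k`-th cell of the grid `k / (N + 1)`, over
`[0, t]` with respect to `dg`. -/
def weighted (N : ℕ) (w : ℕ → ℝ) (g : G0) (t : I) : ℝ :=
  ∑ k ∈ Finset.range (N + 1), w k * (cut g (N + 1) (k + 1) t - cut g (N + 1) k t)

/-- The sum telescopes to g t and not to g t - g 0, because `cut` is 0 at index 0: a possible atom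
of dg at 0 is counted in the first cell. -/
theorem weighted_one (N : ℕ) (g : G0) (t : I) : weighted N (fun _ => 1) g t = g t := by
  simp only [weighted, one_mul]
  rw [Finset.sum_range_sub (fun k => cut g (N + 1) k t), cut_self, cut_zero, sub_zero]

theorem weighted_lin (N : ℕ) (a b : ℝ) (v w : ℕ → ℝ) (g : G0) (t : I) :
    weighted N (fun k => a * v k + b * w k) g t = a * weighted N v g t + b * weighted N w g t := by
  simp only [weighted, Finset.mul_sum, ← Finset.sum_add_distrib]
  exact Finset.sum_congr rfl fun k _ => by ring

theorem weighted_le_weighted (N : ℕ) {v w : ℕ → ℝ} (h : ∀ k, v k ≤ w k) (g : G0) (t : I) :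
    weighted N v g t ≤ weighted N w g t :=
  Finset.sum_le_sum fun _ _ => mul_le_mul_of_nonneg_right (h _) (cut_succ_sub_nonneg _ _ _ _)

theorem weighted_const (N : ℕ) (a : ℝ) (g : G0) (t : I) :
    weighted N (fun _ => a) g t = a * g t := by
  rw [← weighted_one N g t, weighted, weighted, Finset.mul_sum]
  simp

theorem weighted_mono (N : ℕ) {w : ℕ → ℝ} (hw : ∀ k, 0 < w k) (g : G0) :
    Monotone (weighted N w g) := fun _ _ hst =>
  Finset.sum_le_sum fun k _ => mul_le_mul_of_nonneg_left (cut_succ_sub_mono g _ k hst) (hw k).le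

theorem weighted_nonneg (N : ℕ) {w : ℕ → ℝ} (hw : ∀ k, 0 < w k) (g : G0) (t : I) :
    0 ≤ weighted N w g t :=
  Finset.sum_nonneg fun k _ => mul_nonneg (hw k).le (cut_succ_sub_nonneg _ _ _ _)

theorem measurable_weighted (N : ℕ) (w : ℕ → ℝ) (t : I) :
    Measurable fun g : G0 => weighted N w g t :=
  Finset.measurable_sum _ fun _ _ =>
    ((measurable_cut _ _ _).sub (measurable_cut _ _ _)).const_mul _

/-- The total mass of the weight. -/
def mass (N : ℕ) (w : ℕ → ℝ) (g : G0) : ℝ := weighted N w g 1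

theorem measurable_mass (N : ℕ) (w : ℕ → ℝ) : Measurable (mass N w) := measurable_weighted N w 1

theorem le_mass (N : ℕ) {w : ℕ → ℝ} {m : ℝ} (h : ∀ k, m ≤ w k) (g : G0) : m ≤ mass N w g := by
  have := weighted_le_weighted N h g 1
  rwa [weighted_const, g.map_one', Icc.coe_one, mul_one] at this

theorem mass_le (N : ℕ) {w : ℕ → ℝ} {m : ℝ} (h : ∀ k, w k ≤ m) (g : G0) : mass N w g ≤ m := by
  have := weighted_le_weighted N h g 1
  rwa [weighted_const, g.map_one', Icc.coe_one, mul_one] at this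

theorem mass_pos (N : ℕ) {w : ℕ → ℝ} (hw : ∀ k, 0 < w k) (g : G0) : 0 < mass N w g := by
  obtain ⟨k, -, hk⟩ := Finset.exists_min_image (Finset.range (N + 1)) w ⟨0, by simp⟩
  have h1 : weighted N (fun _ => w k) g 1 ≤ weighted N w g 1 :=
    Finset.sum_le_sum fun j hj => mul_le_mul_of_nonneg_right (hk j hj) (cut_succ_sub_nonneg _ _ _ _)
  rw [weighted_const, g.map_one', Icc.coe_one, mul_one] at h1
  exact (hw k).trans_le h1

/-- Multiplication of the measure `dg` by a step weight, followed by normalization. -/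
def reweight (N : ℕ) (w : ℕ → ℝ) (hw : ∀ k, 0 < w k) (g : G0) : G0 where
  toFun t := ⟨weighted N w g t / mass N w g, div_nonneg (weighted_nonneg N hw g t)
    (mass_pos N hw g).le, div_le_one_of_le₀ (weighted_mono N hw g le_top) (mass_pos N hw g).le⟩
  monotone' s t hst := by
    exact Subtype.mk_le_mk.2
      (div_le_div_of_nonneg_right (weighted_mono N hw g hst) (mass_pos N hw g).le)
  rightContinuous' t := by
    refine Topology.IsInducing.subtypeVal.continuousWithinAt_iff.2
      (ContinuousWithinAt.div_const (f := weighted N w g) ?_ _)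
    exact tendsto_finsetSum _ fun k _ =>
      ((cut_rightContinuous g _ _ t).sub (cut_rightContinuous g _ _ t)).const_mul (w k)
  map_one' := by
    ext
    exact div_self (mass_pos N hw g).ne'

theorem coe_reweight (N : ℕ) {w : ℕ → ℝ} (hw : ∀ k, 0 < w k) (g : G0) (t : I) :
    (reweight N w hw g t : ℝ) = weighted N w g t / mass N w g := rfl

theorem measurable_reweight (N : ℕ) {w : ℕ → ℝ} (hw : ∀ k, 0 < w k) :
    Measurable (reweight N w hw) :=
  measurable_of_eval fun t => ((measurable_weighted N w t).div (measurable_mass N w)).subtype_mk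

theorem ext_coe {g h : G0} (H : ∀ t, (g t : ℝ) = h t) : g = h := by
  cases g; cases h
  congr
  funext t
  exact Subtype.ext (H t)

theorem reweight_one (N : ℕ) (g : G0) : reweight N (fun _ => 1) (fun _ => one_pos) g = g :=
  ext_coe fun t => by rw [coe_reweight, mass, weighted_one, weighted_one, g.map_one']; simp

theorem cut_min_gridPt (g : G0) (n j k : ℕ) (t : I) :
    cut g n j (min t (gridPt n (k + 1))) = cut g n (min j (k + 1)) t := by
  rcases j with _ | j
  · simp [cut_zero]
  · rw [cut_succ, min_assoc, ← (gridPt_mono n).map_min, min_comm (k + 1), Nat.succ_min_succ,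
      cut_succ]

theorem weighted_min_gridPt (N : ℕ) (w : ℕ → ℝ) (g : G0) (t : I) {k : ℕ} (hk : k ≤ N) :
    weighted N w g (min t (gridPt (N + 1) (k + 1))) =
      ∑ j ∈ Finset.range (k + 1), w j * (cut g (N + 1) (j + 1) t - cut g (N + 1) j t) := by
  rw [weighted, ← Finset.sum_subset (Finset.range_subset_range.2 (Nat.succ_le_succ hk))]
  · refine Finset.sum_congr rfl fun j hj => ?_
    rw [Finset.mem_range] at hj
    rw [cut_min_gridPt, cut_min_gridPt, min_eq_left (by omega),
      min_eq_left (by omega)]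
  · intro j _ hj
    rw [Finset.mem_range, not_lt] at hj
    rw [cut_min_gridPt, cut_min_gridPt, min_eq_right (by omega),
      min_eq_right (by omega), sub_self, mul_zero]

theorem cut_reweight (N : ℕ) {w : ℕ → ℝ} (hw : ∀ k, 0 < w k) (g : G0) (t : I) {k : ℕ}
    (hk : k ≤ N + 1) : cut (reweight N w hw g) (N + 1) k t =
      (∑ j ∈ Finset.range k, w j * (cut g (N + 1) (j + 1) t - cut g (N + 1) j t)) /
        mass N w g := by
  rcases k with _ | k
  · simp [cut_zero]
  · rw [cut_succ, coe_reweight, weighted_min_gridPt N w g t (by omega)]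

/-- Reweighting multiplies the increment over cell k by w k and divides by a common mass, which
cancels in the second normalization. So positive weights act as a group, and reweightings are
invertible. -/
theorem reweight_reweight (N : ℕ) {v w : ℕ → ℝ} (hv : ∀ k, 0 < v k) (hw : ∀ k, 0 < w k) (g : G0) :
    reweight N v hv (reweight N w hw g) =
      reweight N (fun k => v k * w k) (fun k => mul_pos (hv k) (hw k)) g := by
  have key : ∀ t, weighted N v (reweight N w hw g) t =
      weighted N (fun k => v k * w k) g t / mass N w g := by
    intro t
    rw [weighted, weighted, Finset.sum_div]
    refine Finset.sum_congr rfl fun k hk => ?_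
    rw [Finset.mem_range] at hk
    rw [cut_reweight N hw g t (by omega), cut_reweight N hw g t (by omega),
      Finset.sum_range_succ, add_div, add_sub_cancel_left]
    ring
  refine ext_coe fun t => ?_
  rw [coe_reweight, coe_reweight, mass, key, key,
    div_div_div_cancel_right₀ (mass_pos N hw g).ne']
  rfl

theorem reweight_inv_reweight (N : ℕ) {w : ℕ → ℝ} (hw : ∀ k, 0 < w k) (g : G0) :
    reweight N w hw (reweight N (fun k => (w k)⁻¹) (fun k => inv_pos.2 (hw k)) g) = g := by
  rw [reweight_reweight]
  have : (fun k => w k * (w k)⁻¹) = fun _ => 1 := funext fun k => mul_inv_cancel₀ (hw k).ne'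
  simp only [this]
  exact reweight_one N g

/-! ### Refinement of the grid -/

theorem cut_refine (g : G0) (n k : ℕ) {m : ℕ} (hm : 0 < m) (t : I) :
    cut g (n * m) (k * m) t = cut g n k t := by
  rw [cut, cut]
  have h1 : k * m = 0 ↔ k = 0 := by simp [hm.ne']
  have h2 : gridPt (n * m) (k * m) = gridPt n k := by
    rw [gridPt, gridPt]
    congr 1
    push_cast
    exact mul_div_mul_right _ _ (by positivity)
  simp only [h1, h2]

theorem sum_range_mul {M : Type*} [AddCommMonoid M] (f : ℕ → M) (n m : ℕ) :
    ∑ i ∈ Finset.range (n * m), f i =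
      ∑ k ∈ Finset.range n, ∑ j ∈ Finset.range m, f (k * m + j) := by
  induction n with
  | zero => simp
  | succ n ih => rw [Nat.succ_mul, Finset.sum_range_add, ih, Finset.sum_range_succ]

/-- A step weight is also a step weight on every refinement, the fine cell i lying in the coarse
cell i / m. This lets a fixed reweighting be read off on arbitrarily fine grids. -/
theorem weighted_refine {N N' m : ℕ} (h : (N + 1) * m = N' + 1) (w : ℕ → ℝ) (g : G0) (t : I) :
    weighted N' (fun i => w (i / m)) g t = weighted N w g t := by
  have hm : 0 < m := by
    rcases Nat.eq_zero_or_pos m with rfl | h'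
    · omega
    · exact h'
  rw [weighted, weighted, ← h, sum_range_mul]
  refine Finset.sum_congr rfl fun k _ => ?_
  have h1 : ∀ j ∈ Finset.range m, w ((k * m + j) / m) *
      (cut g ((N + 1) * m) (k * m + j + 1) t - cut g ((N + 1) * m) (k * m + j) t) =
      w k * (cut g ((N + 1) * m) (k * m + (j + 1)) t - cut g ((N + 1) * m) (k * m + j) t) := by
    intro j hj
    rw [Finset.mem_range] at hj
    rw [mul_comm k m, Nat.mul_add_div hm, Nat.div_eq_of_lt hj, add_zero, add_assoc]
  rw [Finset.sum_congr rfl h1, ← Finset.mul_sum,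
    Finset.sum_range_sub (fun j => cut g ((N + 1) * m) (k * m + j) t), add_zero,
    ← Nat.succ_mul, cut_refine _ _ _ hm, cut_refine _ _ _ hm]

theorem reweight_refine {N N' m : ℕ} (h : (N + 1) * m = N' + 1) {w : ℕ → ℝ} (hw : ∀ k, 0 < w k)
    (g : G0) : reweight N' (fun i => w (i / m)) (fun _ => hw _) g = reweight N w hw g :=
  ext_coe fun t => by
    rw [coe_reweight, coe_reweight, mass, mass, weighted_refine h, weighted_refine h]

/-- The action of a reweighting on the grid values. -/
theorem nodes_reweight (N : ℕ) {w : ℕ → ℝ} (hw : ∀ k, 0 < w k) (g : G0) :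
    nodes N (reweight N w hw g) =
      normalizedSums fun i : Fin (N + 1) => w i * increments (nodes N g) i := by
  have hinc : ∀ i : Fin (N + 1), increments (nodes N g) i =
      cut g (N + 1) (i + 1) 1 - cut g (N + 1) i 1 := by
    intro i
    rw [increments, withEndpoints_nodes, withEndpoints_nodes, cut, cut]
    simp only [Fin.succ_ne_zero, if_false, Fin.val_succ, Nat.succ_ne_zero]
    have h2 : i.castSucc = 0 ↔ i.val = 0 := by rw [Fin.ext_iff]; rfl
    simp only [h2, Fin.val_castSucc, min_eq_right unitInterval.le_one']
  funext i
  rw [nodes, normalizedSums, coe_reweight, mass]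
  have h1 := weighted_min_gridPt N w g 1 (k := i) (by omega)
  rw [min_eq_right unitInterval.le_one'] at h1
  congr 1
  · rw [h1]
    simp only [hinc]
    rw [Finset.sum_range]
    refine Finset.sum_bij' (fun j _ => ⟨j, by omega⟩) (fun j hj => ⟨j, ?_⟩) ?_ ?_ ?_ ?_ ?_
    all_goals simp_all [Fin.le_def]
    all_goals omega
  · rw [weighted]
    simp only [hinc]
    exact (Fin.sum_univ_eq_sum_range (fun k => w k * (cut g (N + 1) (k + 1) 1 - cut g (N + 1) k 1)) _).symm

end G0

/-! ### Scaling of gamma variables -/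

theorem map_mul_gammaMeasure (a : ℝ) {w : ℝ} (hw : 0 < w) :
    (gammaMeasure a 1).map (w * ·) =
      (volume : Measure ℝ).withDensity fun x => ENNReal.ofReal w⁻¹ * gammaDensity a (w⁻¹ * x) := by
  rw [gammaMeasure_eq_withDensity]
  refine Measure.ext_of_lintegral _ fun F hF => ?_
  have hm : Measurable fun x => ENNReal.ofReal w⁻¹ * gammaDensity a (w⁻¹ * x) :=
    ((measurable_gammaDensity a).comp (measurable_const_mul _)).const_mul _
  rw [lintegral_map hF (measurable_const_mul w),
    lintegral_withDensity_eq_lintegral_mul _ (measurable_gammaDensity a)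
      (g := fun x => F (w * x)) (hF.comp (measurable_const_mul w)),
    lintegral_withDensity_eq_lintegral_mul _ hm hF]
  have h := Real.map_volume_mul_left hw.ne'
  have h2 := congrArg (fun μ => ∫⁻ x, gammaDensity a (w⁻¹ * x) * F x ∂μ) h
  simp only [lintegral_smul_measure, smul_eq_mul] at h2
  have hG : Measurable fun x => gammaDensity a (w⁻¹ * x) * F x :=
    ((measurable_gammaDensity a).comp (measurable_const_mul _)).mul hF
  rw [lintegral_map hG (measurable_const_mul w), ← lintegral_const_mul _ hG,
    abs_of_pos (inv_pos.2 hw)] at h2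
  simp only [inv_mul_cancel_left₀ hw.ne'] at h2
  simp only [Pi.mul_apply]
  rw [h2]
  exact lintegral_congr fun x => by ring

/-- In each coordinate the density ratio is w ^ (-a) exp(-(1/w - 1) x), and the exponential is at
most 1 because w ≤ 1. -/
theorem pi_gammaMeasure_map_mul_le {N : ℕ} {a w : Fin N → ℝ} (ha : ∀ i, 0 < a i)
    (hw : ∀ i, 0 < w i) (hw1 : ∀ i, w i ≤ 1) :
    (Measure.pi fun i => gammaMeasure (a i) 1).map (fun y i => w i * y i) ≤
      (∏ i, ENNReal.ofReal (w i ^ (-a i))) • Measure.pi fun i => gammaMeasure (a i) 1 := by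
  have := fun i => isProbabilityMeasure_gammaMeasure (ha i) one_pos
  have hp : ∀ i, IsProbabilityMeasure ((gammaMeasure (a i) 1).map (w i * ·)) := fun i =>
    Measure.isProbabilityMeasure_map (measurable_const_mul _).aemeasurable
  rw [Measure.pi_map_pi fun i => (measurable_const_mul (w i)).aemeasurable]
  have h1 : ∀ i, IsProbabilityMeasure ((volume : Measure ℝ).withDensity (gammaDensity (a i))) :=
    fun i => by rw [← gammaMeasure_eq_withDensity]; infer_instance
  have h2 : ∀ i, IsProbabilityMeasure ((volume : Measure ℝ).withDensity
      fun x => ENNReal.ofReal (w i)⁻¹ * gammaDensity (a i) ((w i)⁻¹ * x)) :=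
    fun i => by rw [← map_mul_gammaMeasure _ (hw i)]; infer_instance
  simp only [map_mul_gammaMeasure _ (hw _)]
  rw [pi_withDensity (fun i x => ENNReal.ofReal (w i)⁻¹ * gammaDensity (a i) ((w i)⁻¹ * x)) fun i =>
    ((measurable_gammaDensity (a i)).comp (measurable_const_mul _)).const_mul _]
  simp only [gammaMeasure_eq_withDensity]
  rw [pi_withDensity _ fun i => measurable_gammaDensity _, ← withDensity_smul
    (f := fun x : Fin N → ℝ => ∏ i, gammaDensity (a i) (x i)) _
    (Finset.measurable_prod _ fun i _ => (measurable_gammaDensity _).comp (measurable_pi_apply i))]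
  refine withDensity_mono (ae_of_all _ fun x => ?_)
  rw [Pi.smul_apply, smul_eq_mul, ← Finset.prod_mul_distrib]
  refine Finset.prod_le_prod' fun i _ => ?_
  have hwi := hw i
  rw [gammaDensity, gammaDensity]
  by_cases hx : 0 < x i
  · have hx' : 0 < (w i)⁻¹ * x i := by positivity
    rw [if_pos hx, if_pos hx', ← ENNReal.ofReal_mul (by positivity),
      ← ENNReal.ofReal_mul (by positivity)]
    refine ENNReal.ofReal_le_ofReal ?_
    have hG := Real.Gamma_pos_of_pos (ha i)
    have e1 : ((w i)⁻¹ * x i) ^ (a i - 1) = w i ^ (-a i) * w i * x i ^ (a i - 1) := by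
      rw [Real.mul_rpow (by positivity) hx.le, Real.inv_rpow hwi.le, ← Real.rpow_neg hwi.le,
        neg_sub, sub_eq_add_neg, add_comm, Real.rpow_add hwi, Real.rpow_one]
    have e2 : Real.exp (-((w i)⁻¹ * x i)) ≤ Real.exp (-x i) := by
      refine Real.exp_le_exp.2 (neg_le_neg ?_)
      exact le_mul_of_one_le_left hx.le ((one_le_inv₀ hwi).2 (hw1 i))
    rw [e1]
    calc (w i)⁻¹ * (1 / Real.Gamma (a i) * (w i ^ (-a i) * w i * x i ^ (a i - 1)) *
          Real.exp (-((w i)⁻¹ * x i)))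
        = w i ^ (-a i) * (1 / Real.Gamma (a i) * x i ^ (a i - 1) *
          Real.exp (-((w i)⁻¹ * x i))) := by field_simp
      _ ≤ _ := by gcongr
  · have hx' : ¬ 0 < (w i)⁻¹ * x i := by
      rw [not_lt] at hx ⊢
      exact mul_nonpos_of_nonneg_of_nonpos (by positivity) hx
    rw [if_neg hx, if_neg hx']
    simp

/-! ### Quasi-invariance of the Dirichlet process -/

theorem withEndpoints_normalizedSums {N : ℕ} {y : Fin (N + 1) → ℝ} (hy : ∑ j, y j ≠ 0)
    (k : Fin (N + 2)) : withEndpoints (normalizedSums y) k = initialSum y k / ∑ j, y j := by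
  refine Fin.cases ?_ (fun k => ?_) k
  · simp [withEndpoints, initialSum_zero]
  · refine Fin.lastCases ?_ (fun i => ?_) k
    · rw [show ((Fin.last N).succ : Fin (N + 2)).val = N + 1 from rfl, initialSum_self,
        div_self hy]
      simp [withEndpoints]
    · rw [withEndpoints_castSucc_succ, normalizedSums, initialSum]
      congr 1
      refine Finset.sum_congr ?_ fun _ _ => rfl
      ext j
      simp [Fin.le_def]

theorem initialSum_succ {n : ℕ} (y : Fin n → ℝ) (i : Fin n) :
    initialSum y (i + 1) = initialSum y i + y i := by
  rw [initialSum, initialSum, add_comm (∑ _ ∈ _, _), ← Finset.sum_insert (by simp)]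
  refine Finset.sum_congr ?_ fun _ _ => rfl
  ext j
  simp [Fin.ext_iff]
  omega

theorem increments_normalizedSums {N : ℕ} {y : Fin (N + 1) → ℝ} (hy : ∑ j, y j ≠ 0) :
    increments (normalizedSums y) = (∑ j, y j)⁻¹ • y := by
  funext i
  rw [increments, withEndpoints_normalizedSums hy, withEndpoints_normalizedSums hy, Fin.val_succ,
    Fin.val_castSucc, initialSum_succ, Pi.smul_apply, smul_eq_mul]
  ring

/-- Proportions are invariant under scaling. Hence the Dirichlet vector may be replaced by the gamma
vector it comes from, and the weights by w / M ≤ 1, for which the scaling bound for gamma laws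
applies. -/
theorem lintegral_dirichlet_reweight_le {N : ℕ} {a w : Fin (N + 1) → ℝ} (ha : ∀ i, 0 < a i)
    {M : ℝ} (hw : ∀ i, 0 < w i) (hwM : ∀ i, w i ≤ M) {F : (Fin N → ℝ) → ℝ≥0∞} (hF : Measurable F) :
    ∫⁻ y, F (normalizedSums fun i => w i * increments y i)
        ∂((volume : Measure (Fin N → ℝ)).withDensity (dirichletPDF a)) ≤
      (∏ i, ENNReal.ofReal ((w i / M) ^ (-a i))) *
        ∫⁻ y, F y ∂((volume : Measure (Fin N → ℝ)).withDensity (dirichletPDF a)) := by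
  have hM : 0 < M := (hw 0).trans_le (hwM 0)
  have hFn : Measurable fun y : Fin (N + 1) → ℝ => F (normalizedSums y) :=
    hF.comp measurable_normalizedSums
  have hmul : Measurable fun (y : Fin (N + 1) → ℝ) i => w i / M * y i := by fun_prop
  have hFw : Measurable fun y : Fin N → ℝ => F (normalizedSums fun i => w i * increments y i) :=
    hFn.comp (measurable_pi_lambda _ fun i => (measurable_increments i).const_mul _)
  have hS : 0 < ∑ i, a i := Finset.sum_pos (fun i _ => ha i) Finset.univ_nonempty
  have hne : ∀ᵐ y ∂(Measure.pi fun i => gammaMeasure (a i) 1), ∑ j, y j ≠ 0 := by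
    have h1 : ∀ᵐ r ∂gammaMeasure (∑ i, a i) 1, r ≠ 0 := by
      have h0 : ∀ᵐ r : ℝ, r ≠ 0 := by simp [ae_iff]
      exact (withDensity_absolutelyContinuous _ _).ae_le h0
    rw [← map_sum_gamma ha] at h1
    exact ae_of_ae_map (f := fun y : Fin (N + 1) → ℝ => ∑ i, y i) (by fun_prop) h1
  rw [← map_normalizedSums_gamma ha, lintegral_map hFw measurable_normalizedSums,
    lintegral_map hF measurable_normalizedSums]
  calc ∫⁻ y, F (normalizedSums fun i => w i * increments (normalizedSums y) i)
        ∂(Measure.pi fun i => gammaMeasure (a i) 1)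
      = ∫⁻ y, F (normalizedSums fun i => w i / M * y i)
        ∂(Measure.pi fun i => gammaMeasure (a i) 1) := by
        refine lintegral_congr_ae ?_
        filter_upwards [hne] with y hy
        rw [increments_normalizedSums hy]
        congr 1
        rw [← normalizedSums_smul (div_ne_zero hy hM.ne')
          (fun i => w i * ((∑ j, y j)⁻¹ • y) i)]
        congr 1
        funext i
        simp only [Pi.smul_apply, smul_eq_mul]
        field_simp
    _ = ∫⁻ y, F (normalizedSums y) ∂((Measure.pi fun i => gammaMeasure (a i) 1).map
          fun y i => w i / M * y i) := (lintegral_map hFn hmul).symm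
    _ ≤ ∫⁻ y, F (normalizedSums y) ∂((∏ i, ENNReal.ofReal ((w i / M) ^ (-a i))) •
          Measure.pi fun i => gammaMeasure (a i) 1) :=
        lintegral_mono' (pi_gammaMeasure_map_mul_le ha (fun i => div_pos (hw i) hM)
          fun i => (div_le_one hM).2 (hwM i)) le_rfl
    _ = _ := lintegral_smul_measure _ _

namespace IsDirichletProcess

variable {β : ℝ} {Q : Measure G0}

theorem increments_gridPt (N : ℕ) (k : Fin (N + 1)) :
    increments (fun i : Fin N => (G0.gridPt (N + 1) (i + 1) : ℝ)) k = 1 / (N + 1 : ℕ) := by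
  have h : ∀ k : Fin (N + 2), withEndpoints (fun i : Fin N => (G0.gridPt (N + 1) (i + 1) : ℝ)) k =
      (k : ℝ) / (N + 1 : ℕ) := by
    intro k
    refine Fin.cases ?_ (fun k => ?_) k
    · simp [withEndpoints]
    · refine Fin.lastCases ?_ (fun i => ?_) k
      · have : ((N : ℝ) + 1) ≠ 0 := by positivity
        simp [withEndpoints, this]
      · rw [withEndpoints_castSucc_succ, G0.coe_gridPt (by omega)]
        simp
  rw [increments, h, h]
  simp
  ring

theorem map_nodes (hQ : IsDirichletProcess β Q) (N : ℕ) :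
    Q.map (G0.nodes N) = volume.withDensity (dirichletPDF fun _ => β / (N + 1 : ℕ)) := by
  have h := hQ.map_eval N (fun i => G0.gridPt (N + 1) (i + 1))
    (strictMono_withEndpoints_iff.2 fun k => by rw [increments_gridPt]; positivity)
  simp only [ofReal_dirichletDensity, increments_gridPt, mul_one_div] at h
  exact h

/-- On a grid with n cells each gamma parameter is β / n, so the product of n factors at most (m/M)
^ (-β/n) is at most (m/M) ^ (-β) for every n. This uniform bound survives refinement, where the step
functions through the nodes converge to g in 𝒢₀. -/
theorem map_reweight_le (hQ : IsDirichletProcess β Q) (hβ : 0 < β) (N : ℕ) {w : ℕ → ℝ}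
    (hw : ∀ k, 0 < w k) {m M : ℝ} (hm : 0 < m) (h1 : ∀ k, m ≤ w k) (h2 : ∀ k, w k ≤ M) :
    Q.map (G0.reweight N w hw) ≤ ENNReal.ofReal ((m / M) ^ (-β)) • Q := by
  have := hQ.isProbabilityMeasure
  have hM : 0 < M := hm.trans_le ((h1 0).trans (h2 0))
  have hmr := G0.measurable_reweight N hw
  have : IsFiniteMeasure (ENNReal.ofReal ((m / M) ^ (-β)) • Q) := Q.smul_finite ENNReal.ofReal_ne_top
  refine measure_le_of_forall_lintegral_le fun f => ?_
  have hf : Measurable fun x => (f x : ℝ≥0∞) :=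
    (ENNReal.continuous_coe.comp f.continuous).measurable
  rw [lintegral_map hf hmr, lintegral_smul_measure, smul_eq_mul]
  -- Refinements of the grid of w: N' n + 1 is the multiple (N + 1)(n + 1).
  let N' : ℕ → ℕ := fun n => (N + 1) * (n + 1) - 1
  have hN' : ∀ n, (N + 1) * (n + 1) = N' n + 1 := fun n => by
    have : 0 < (N + 1) * (n + 1) := by positivity
    simp only [N']
    omega
  have hN'top : Tendsto N' atTop atTop := by
    refine tendsto_atTop_mono (fun n => ?_) tendsto_id
    have := hN' n
    simp only [id]
    nlinarith
  have key : ∀ n, ∫⁻ g, f (G0.ofNodes (G0.nodes (N' n) (G0.reweight N w hw g))) ∂Q ≤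
      ENNReal.ofReal ((m / M) ^ (-β)) * ∫⁻ g, f (G0.ofNodes (G0.nodes (N' n) g)) ∂Q := by
    intro n
    have hF : Measurable fun y : Fin (N' n) → ℝ => (f (G0.ofNodes y) : ℝ≥0∞) :=
      hf.comp G0.measurable_ofNodes
    have hn := G0.measurable_nodes (N' n)
    have hFw : Measurable fun y : Fin (N' n) → ℝ => (f (G0.ofNodes (normalizedSums
        fun i => w (i / (n + 1)) * increments y i)) : ℝ≥0∞) :=
      hF.comp (measurable_normalizedSums.comp
        (measurable_pi_lambda _ fun i => (measurable_increments i).const_mul _))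
    have e1 := lintegral_map (μ := Q) hF hn
    have e2 := lintegral_map (μ := Q) hFw hn
    have e3 := lintegral_dirichlet_reweight_le (N := N' n) (a := fun _ => β / (N' n + 1 : ℕ))
      (w := fun i => w (i / (n + 1))) (fun _ => by positivity) (fun i => hw _) (fun i => h2 _) hF
    rw [← hQ.map_nodes, e1, e2] at e3
    simp only [← G0.reweight_refine (hN' n) hw, G0.nodes_reweight]
    refine e3.trans (mul_le_mul_left ?_ _)
    rw [← ENNReal.ofReal_prod_of_nonneg fun i _ => by have := hw (i / (n + 1)); positivity]
    refine ENNReal.ofReal_le_ofReal ?_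
    calc ∏ i : Fin (N' n + 1), (w (i / (n + 1)) / M) ^ (-(β / (N' n + 1 : ℕ)))
        ≤ ∏ i : Fin (N' n + 1), (m / M) ^ (-(β / (N' n + 1 : ℕ))) := by
          refine Finset.prod_le_prod (fun i _ => by have := hw (i / (n + 1)); positivity)
            fun i _ => ?_
          refine Real.rpow_le_rpow_of_nonpos (by positivity) ?_ (by
            rw [neg_nonpos]; positivity)
          exact div_le_div_of_nonneg_right (h1 _) hM.le
      _ = (m / M) ^ (-β) := by
          rw [Finset.prod_const, Finset.card_univ, Fintype.card_fin, ← Real.rpow_natCast,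
            ← Real.rpow_mul (by positivity)]
          congr 1
          have : ((N' n + 1 : ℕ) : ℝ) ≠ 0 := by positivity
          field_simp
  have hdom : ∀ φ : G0 → G0, Measurable φ → Tendsto (fun n => ∫⁻ g,
      f (G0.ofNodes (G0.nodes (N' n) (φ g))) ∂Q) atTop (𝓝 (∫⁻ g, f (φ g) ∂Q)) := by
    intro φ hφ
    refine tendsto_lintegral_filter_of_dominated_convergence (fun _ => (nndist f 0 : ℝ≥0∞))
      (Eventually.of_forall fun n => hf.comp (G0.measurable_ofNodes.comp
        ((G0.measurable_nodes _).comp hφ)))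
      (Eventually.of_forall fun n => ae_of_all _ fun x => ?_) (by simp) (ae_of_all _ fun x => ?_)
    · exact_mod_cast BoundedContinuousFunction.NNReal.upper_bound f _
    · exact (ENNReal.continuous_coe.tendsto _).comp ((f.continuous.tendsto _).comp
        (G0.tendsto_ofNodes_nodes hN'top _))
  exact le_of_tendsto_of_tendsto' (hdom _ hmr)
    (ENNReal.Tendsto.const_mul (hdom _ measurable_id) (Or.inr ENNReal.ofReal_ne_top)) key

end IsDirichletProcess

end

noncomputable section

/-! ### Transfer operators -/

section Transfer

variable {X Y Z : Type*} [MeasurableSpace X] [MeasurableSpace Y] [MeasurableSpace Z]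
  {μ : Measure X} {ν : Measure Y} {ζ : Measure Z}

theorem integrable_comp_of_map_le {Θ : X → Z} (hΘ : Measurable Θ) {C : ℝ≥0∞}
    (hC : C ≠ ∞) (hle : μ.map Θ ≤ C • ζ) {f : Z → ℝ} (hf : Integrable f ζ) :
    Integrable (fun x => f (Θ x)) μ :=
  ((hf.smul_measure hC).mono_measure hle).comp_measurable hΘ

theorem lintegral_comp_le_of_map_le {Θ : X → Z} (hΘ : Measurable Θ) {C : ℝ≥0∞}
    (hle : μ.map Θ ≤ C • ζ) {f : Z → ℝ≥0∞} (hf : AEMeasurable f ζ) :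
    ∫⁻ x, f (Θ x) ∂μ ≤ C * ∫⁻ z, f z ∂ζ := by
  have hac : μ.map Θ ≪ ζ := (Measure.absolutelyContinuous_of_le hle).trans
    Measure.smul_absolutelyContinuous
  rw [← lintegral_map' (hf.mono_ac hac) hΘ.aemeasurable]
  exact (lintegral_mono' hle le_rfl).trans (by rw [lintegral_smul_measure, smul_eq_mul])

/-- If `Θ` maps `μ ⊗ ν` to a measure dominated by a multiple of `ζ`, then
`f ↦ ∫ f(Θ(·, y)) κ(·, y) ν(dy)` is bounded from `L²(ζ)` to `L¹(μ)`. -/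
theorem exists_transfer [SFinite ν] [SFinite μ] [IsProbabilityMeasure ζ] {Θ : X × Y → Z}
    (hΘ : Measurable Θ)
    {C : ℝ≥0∞} (hC : C ≠ ∞) (hle : (μ.prod ν).map Θ ≤ C • ζ) {κ : X × Y → ℝ} (hκ : Measurable κ)
    {K : ℝ≥0} (hK : ∀ p, ‖κ p‖ ≤ K) :
    ∃ T : Lp ℝ 2 ζ →L[ℝ] Lp ℝ 1 μ, ∀ (F : Lp ℝ 2 ζ) (f : Z → ℝ), F =ᵐ[ζ] f →
      T F =ᵐ[μ] fun x => ∫ y, f (Θ (x, y)) * κ (x, y) ∂ν := by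
  have hac : (μ.prod ν).map Θ ≪ ζ := (Measure.absolutelyContinuous_of_le hle).trans
    Measure.smul_absolutelyContinuous
  have hint : ∀ F : Lp ℝ 2 ζ, Integrable F ζ := fun F =>
    (Lp.memLp F).integrable (by norm_num)
  have hi : ∀ F : Lp ℝ 2 ζ, Integrable (fun p => F (Θ p) * κ p) (μ.prod ν) := fun F =>
    (integrable_comp_of_map_le hΘ hC hle (hint F)).mul_bdd hκ.aestronglyMeasurable
      (Eventually.of_forall hK)
  have hi' : ∀ F : Lp ℝ 2 ζ, Integrable (fun x => ∫ y, F (Θ (x, y)) * κ (x, y) ∂ν) μ := fun F =>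
    (hi F).integral_prod_left
  have hcongr : ∀ {f f' : Z → ℝ}, f =ᵐ[ζ] f' → (fun x => ∫ y, f (Θ (x, y)) * κ (x, y) ∂ν) =ᵐ[μ]
      fun x => ∫ y, f' (Θ (x, y)) * κ (x, y) ∂ν := by
    intro f f' h
    have h1 : ∀ᵐ p ∂(μ.prod ν), f (Θ p) = f' (Θ p) := ae_of_ae_map hΘ.aemeasurable (hac.ae_le h)
    filter_upwards [Measure.ae_ae_of_ae_prod h1] with x hx
    refine integral_congr_ae ?_
    filter_upwards [hx] with y hy
    rw [hy]
  let T : Lp ℝ 2 ζ →ₗ[ℝ] Lp ℝ 1 μ :=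
    { toFun := fun F => (hi' F).toL1 _
      map_add' := fun F G => by
        rw [← Integrable.toL1_add, Integrable.toL1_eq_toL1_iff]
        refine (hcongr (Lp.coeFn_add F G)).trans ?_
        filter_upwards [(hi F).prod_right_ae, (hi G).prod_right_ae] with x h1 h2
        simp only [Pi.add_apply, add_mul]
        exact integral_add h1 h2
      map_smul' := fun c F => by
        rw [RingHom.id_apply, ← Integrable.toL1_smul, Integrable.toL1_eq_toL1_iff]
        refine (hcongr (Lp.coeFn_smul c F)).trans ?_
        filter_upwards with x
        simp only [Pi.smul_apply, smul_eq_mul, mul_assoc]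
        exact integral_const_mul _ _ }
  refine ⟨T.mkContinuous (K * C.toReal) fun F => ?_, fun F f hf =>
    ((hi' F).coeFn_toL1).trans (hcongr hf)⟩
  have hb : ∫⁻ x, ‖∫ y, F (Θ (x, y)) * κ (x, y) ∂ν‖ₑ ∂μ ≤ K * (C * ENNReal.ofReal ‖F‖) := by
    have hm : AEMeasurable (fun p => ‖F (Θ p) * κ p‖ₑ) (μ.prod ν) :=
      (hi F).aestronglyMeasurable.enorm
    calc ∫⁻ x, ‖∫ y, F (Θ (x, y)) * κ (x, y) ∂ν‖ₑ ∂μ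
        ≤ ∫⁻ x, ∫⁻ y, ‖F (Θ (x, y)) * κ (x, y)‖ₑ ∂ν ∂μ :=
          lintegral_mono fun x => enorm_integral_le_lintegral_enorm _
      _ = ∫⁻ p, ‖F (Θ p) * κ p‖ₑ ∂(μ.prod ν) := (lintegral_prod _ hm).symm
      _ ≤ ∫⁻ p, K * ‖F (Θ p)‖ₑ ∂(μ.prod ν) := lintegral_mono fun p => by
          rw [enorm_mul, mul_comm]
          gcongr
          rw [← ofReal_norm, ← ENNReal.ofReal_coe_nnreal]
          exact ENNReal.ofReal_le_ofReal (hK p)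
      _ = K * ∫⁻ p, ‖F (Θ p)‖ₑ ∂(μ.prod ν) := lintegral_const_mul' _ _ ENNReal.coe_ne_top
      _ ≤ K * (C * ∫⁻ z, ‖F z‖ₑ ∂ζ) := by
          gcongr
          exact lintegral_comp_le_of_map_le hΘ hle (Lp.aestronglyMeasurable F).enorm
      _ ≤ K * (C * ENNReal.ofReal ‖F‖) := by
          gcongr
          rw [← eLpNorm_one_eq_lintegral_enorm]
          refine (eLpNorm_le_eLpNorm_of_exponent_le (q := 2) (by norm_num)
            (Lp.aestronglyMeasurable F)).trans ?_
          rw [Lp.norm_def, ENNReal.ofReal_toReal (Lp.eLpNorm_ne_top F)]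
  have : ‖T F‖ = (∫⁻ x, ‖∫ y, F (Θ (x, y)) * κ (x, y) ∂ν‖ₑ ∂μ).toReal :=
    (Integrable.norm_toL1 _ (hi' F)).trans (by simp only [edist_zero_right])
  refine this.trans_le ?_
  refine (ENNReal.toReal_mono (by finiteness) hb).trans ?_
  rw [ENNReal.toReal_mul, ENNReal.toReal_mul, ENNReal.toReal_ofReal (norm_nonneg _), mul_assoc]
  rfl

end Transfer

/-- An integrable function whose integrals over a generating `π`-system and over the whole space
vanish is zero almost everywhere. -/
theorem ae_eq_zero_of_forall_setIntegral_piSystem {X : Type*} [m : MeasurableSpace X]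
    {μ : Measure X} {C : Set (Set X)} (hgen : m = MeasurableSpace.generateFrom C)
    (hC : IsPiSystem C) {f : X → ℝ} (hf : Integrable f μ) (h0 : ∫ x, f x ∂μ = 0)
    (h : ∀ s ∈ C, ∫ x in s, f x ∂μ = 0) : f =ᵐ[μ] 0 := by
  suffices H : ∀ s, MeasurableSet s → ∫ x in s, f x ∂μ = 0 from
    hf.ae_eq_zero_of_forall_setIntegral_eq_zero fun s hs _ => H s hs
  intro s hs
  induction s, hs using MeasurableSpace.induction_on_inter hgen hC with
  | empty => simp
  | basic t ht => exact h t ht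
  | compl t ht ih =>
    have := integral_add_compl ht hf
    rwa [ih, h0, zero_add] at this
  | iUnion f hd hm ih =>
    rw [integral_iUnion hm hd hf.integrableOn]
    simp [ih]

/-! ### Reweighting paths and their parametrization -/

namespace G0

variable {N : ℕ} {w : ℕ → ℝ}

/-- The weights `(1 - s) + s w`. -/
def pathWeight (w : ℕ → ℝ) (s : I) (k : ℕ) : ℝ := (1 - s) + s * w k

theorem le_pathWeight {m : ℝ} (hm : m ≤ 1) (h : ∀ k, m ≤ w k) (s : I) (k : ℕ) :
    m ≤ pathWeight w s k := by
  unfold pathWeight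
  nlinarith [s.2.1, s.2.2, h k]

theorem pathWeight_le {M : ℝ} (hM : 1 ≤ M) (h : ∀ k, w k ≤ M) (s : I) (k : ℕ) :
    pathWeight w s k ≤ M := by
  unfold pathWeight
  nlinarith [s.2.1, s.2.2, h k]

theorem pathWeight_pos (hw : ∀ k, 0 < w k) (s : I) (k : ℕ) : 0 < pathWeight w s k := by
  have h1 := lt_min one_pos (hw k)
  have h2 : min 1 (w k) ≤ pathWeight w s k := by
    unfold pathWeight
    nlinarith [s.2.1, s.2.2, min_le_left 1 (w k), min_le_right 1 (w k)]
  exact h1.trans_le h2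

/-- The path `s ↦ g_s` of reweightings from `g` to `reweight N w hw g`. -/
def pathMap (N : ℕ) (w : ℕ → ℝ) (hw : ∀ k, 0 < w k) (s : I) (g : G0) : G0 :=
  reweight N (pathWeight w s) (pathWeight_pos hw s) g

/-- The parameter `s μ / ((1 - s) + s μ)` of `g_s` on the segment. -/
def position (N : ℕ) (w : ℕ → ℝ) (g : G0) (s : ℝ) : ℝ :=
  s * mass N w g / ((1 - s) + s * mass N w g)

/-- The derivative of `position`. -/
def speed (N : ℕ) (w : ℕ → ℝ) (g : G0) (s : ℝ) : ℝ :=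
  mass N w g / ((1 - s) + s * mass N w g) ^ 2

theorem weighted_pathWeight (N : ℕ) (w : ℕ → ℝ) (s : I) (g : G0) (t : I) :
    weighted N (pathWeight w s) g t = (1 - s) * g t + s * weighted N w g t := by
  have := weighted_lin N (1 - s) s (fun _ => 1) w g t
  rw [weighted_one] at this
  rw [← this]
  simp only [mul_one]
  rfl

theorem segment_pos {μ s : ℝ} (hμ : 0 < μ) (hs : s ∈ Icc (0 : ℝ) 1) : 0 < (1 - s) + s * μ := by
  rcases hs.1.eq_or_lt with rfl | h
  · simp
  · have := mul_pos h hμ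
    linarith [hs.2]

/-- Numerator and normalizing mass are both affine in s, so the path is a projective
reparametrization of the straight segment. This is why L² distances, and not lengths of curves,
appear in the upper bound. -/
theorem coe_pathMap (hw : ∀ k, 0 < w k) (s : I) (g : G0) (t : I) :
    (pathMap N w hw s g t : ℝ) = g t + position N w g s * (reweight N w hw g t - g t) := by
  have h1 := segment_pos (mass_pos N hw g) s.2
  have h2 := mass_pos N hw g
  rw [pathMap, coe_reweight, coe_reweight, mass, weighted_pathWeight, weighted_pathWeight,
    g.map_one', Icc.coe_one, mul_one]
  change _ / (1 - (s : ℝ) + s * mass N w g) = _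
  unfold position
  field_simp
  ring

theorem pathMap_one (hw : ∀ k, 0 < w k) (g : G0) : pathMap N w hw 1 g = reweight N w hw g := by
  have h2 := mass_pos N hw g
  refine ext_coe fun t => ?_
  rw [coe_pathMap, position]
  simp [h2.ne']

theorem measurable_pathMap_uncurry (hw : ∀ k, 0 < w k) :
    Measurable fun p : G0 × I => pathMap N w hw p.2 p.1 := by
  refine measurable_of_eval fun t => ?_
  suffices h : Measurable fun p : G0 × I => (pathMap N w hw p.2 p.1 t : ℝ) from
    h.subtype_mk (h := fun p => (pathMap N w hw p.2 p.1 t).2)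
  have h1 := measurable_weighted N w t
  have h2 := measurable_mass N w
  have h3 := measurable_eval_real t
  have : Measurable fun p : G0 × I => (p.2 : ℝ) := measurable_subtype_coe.comp measurable_snd
  have h4 : ∀ p : G0 × I, (pathMap N w hw p.2 p.1 t : ℝ) =
      ((1 - p.2) * p.1 t + p.2 * weighted N w p.1 t) / ((1 - p.2) + p.2 * mass N w p.1) := by
    intro p
    rw [pathMap, coe_reweight, mass, weighted_pathWeight, weighted_pathWeight,
      p.1.map_one', Icc.coe_one, mul_one]
    rfl
  simp only [h4]
  have h5 : Measurable fun p : G0 × I => weighted N w p.1 t := h1.comp measurable_fst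
  have h6 : Measurable fun p : G0 × I => mass N w p.1 := h2.comp measurable_fst
  have h7 : Measurable fun p : G0 × I => (p.1 t : ℝ) := h3.comp measurable_fst
  exact (((this.const_sub 1).mul h7).add (this.mul h5)).div ((this.const_sub 1).add (this.mul h6))

theorem measurable_speed : Measurable fun p : G0 × I => speed N w p.1 p.2 := by
  have h2 := measurable_mass N w
  have : Measurable fun p : G0 × I => (p.2 : ℝ) := measurable_subtype_coe.comp measurable_snd
  unfold speed
  fun_prop

theorem speed_nonneg (hw : ∀ k, 0 < w k) (g : G0) (s : ℝ) : 0 ≤ speed N w g s :=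
  div_nonneg (mass_pos N hw g).le (sq_nonneg _)

/-- The mass is at most M, and the denominator, a convex combination of 1 and the mass, is at least
m. -/
theorem speed_le {m M : ℝ} (hm : 0 < m) (hm1 : m ≤ 1) (h1 : ∀ k, m ≤ w k) (h2 : ∀ k, w k ≤ M)
    (g : G0) (s : I) : speed N w g s ≤ M / m ^ 2 := by
  have h3 := mass_le N h2 g
  have h4 := le_mass N h1 g
  have h5 : m ≤ (1 - (s : ℝ)) + s * mass N w g := by nlinarith [s.2.1, s.2.2]
  unfold speed
  gcongr
  linarith

theorem hasDerivAt_position (hw : ∀ k, 0 < w k) (g : G0) {s : ℝ} (hs : s ∈ Icc (0 : ℝ) 1) :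
    HasDerivAt (position N w g) (speed N w g s) s := by
  have h1 := segment_pos (mass_pos N hw g) hs
  have h2 : HasDerivAt (fun s : ℝ => s * mass N w g) (mass N w g) s := by
    simpa using (hasDerivAt_id s).mul_const (mass N w g)
  have h3 : HasDerivAt (fun s : ℝ => (1 - s) + s * mass N w g) (-1 + mass N w g) s :=
    ((hasDerivAt_id s).const_sub 1).add h2
  refine (h2.div h3 h1.ne').congr_deriv ?_
  unfold speed
  congr 1
  ring

theorem continuousOn_speed (hw : ∀ k, 0 < w k) (g : G0) :
    ContinuousOn (speed N w g) (Icc 0 1) := by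
  unfold speed
  refine ContinuousOn.div (by fun_prop) (by fun_prop) fun s hs => ?_
  exact pow_ne_zero _ (segment_pos (mass_pos N hw g) hs).ne'

theorem position_mem (hw : ∀ k, 0 < w k) (g : G0) {s : ℝ} (hs : s ∈ Icc (0 : ℝ) 1) :
    position N w g s ∈ Icc (0 : ℝ) 1 := by
  have h1 := segment_pos (mass_pos N hw g) hs
  have h2 := mass_pos N hw g
  exact ⟨div_nonneg (mul_nonneg hs.1 h2.le) h1.le, div_le_one_of_le₀ (by linarith [hs.2]) h1.le⟩

/-- `∫ f(s) ds` over `s ∈ [0,1]`, `s ≤ r`, as an interval integral. -/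
theorem integral_Iic_unitInterval (f : ℝ → ℝ) (r : I) :
    ∫ s in Iic r, f (s : ℝ) = ∫ s in (0 : ℝ)..r, f s := by
  rw [intervalIntegral.integral_of_le r.2.1, ← integral_Icc_eq_integral_Ioc,
    ← integral_indicator measurableSet_Iic, ← integral_indicator measurableSet_Icc]
  have h := integral_subtype_comap (μ := (volume : Measure ℝ)) (s := Icc (0 : ℝ) 1) measurableSet_Icc
    ((Icc 0 (r : ℝ)).indicator f)
  have h2 : ∫ x in Icc (0 : ℝ) 1, (Icc 0 (r : ℝ)).indicator f x =
      ∫ x, (Icc 0 (r : ℝ)).indicator f x := by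
    rw [setIntegral_indicator measurableSet_Icc, integral_indicator measurableSet_Icc,
      inter_eq_right.2 (Icc_subset_Icc le_rfl r.2.2)]
  rw [h2] at h
  rw [← h]
  refine integral_congr_ae (Eventually.of_forall fun s => ?_)
  by_cases hs : s ≤ r
  · simp [indicator, hs, s.2.1]
  · have : ¬ (s : ℝ) ≤ r := hs
    simp [indicator, hs, this]

theorem integral_Iic_speed (hw : ∀ k, 0 < w k) (g : G0) (r : I) :
    ∫ s in Iic r, speed N w g (s : ℝ) = position N w g r := by
  rw [integral_Iic_unitInterval (speed N w g)]
  have hsub : uIcc (0 : ℝ) r ⊆ Icc 0 1 := by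
    rw [uIcc_of_le r.2.1]; exact Icc_subset_Icc le_rfl r.2.2
  rw [intervalIntegral.integral_eq_sub_of_hasDerivAt
    (fun s hs => hasDerivAt_position hw g (hsub hs))
    ((continuousOn_speed hw g).mono hsub).intervalIntegrable]
  simp [position]

end G0

end

noncomputable section

namespace G0

variable {N : ℕ} {w : ℕ → ℝ}

/-! ### Cylinder functions along the paths -/

theorem measurable_moments {m : ℕ} {α : Fin m → ℝ → ℝ} (hα : ∀ i, Continuous (α i)) :
    Measurable (moments α) := by
  refine measurable_pi_lambda _ fun i => ?_
  have h : StronglyMeasurable (Function.uncurry fun (g : G0) (s : I) => α i (g s)) :=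
    ((hα i).measurable.comp measurable_eval_uncurry).stronglyMeasurable
  exact h.integral_prod_right.measurable

theorem exists_bound_Icc {f : ℝ → ℝ} (hf : Continuous f) (a b : ℝ) :
    ∃ B, 0 ≤ B ∧ ∀ x ∈ Icc a b, |f x| ≤ B := by
  obtain ⟨B, hB⟩ := isCompact_Icc.exists_bound_of_continuousOn (s := Icc a b) hf.continuousOn
  exact ⟨max B 0, le_max_right _ _, fun x hx => (hB x hx).trans (le_max_left _ _)⟩

/-- All g take values in [0,1], so U and its derivative are only seen on a compact box; cylinder
functions and their gradients are bounded without growth conditions on U. -/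
theorem exists_moments_mem_compact {m : ℕ} {α : Fin m → ℝ → ℝ} (hα : ∀ i, Continuous (α i)) :
    ∃ K : Set (Fin m → ℝ), IsCompact K ∧ ∀ g, moments α g ∈ K := by
  choose B hB0 hB using fun i => exists_bound_Icc (hα i) 0 1
  refine ⟨Set.pi univ fun i => Icc (-B i) (B i), isCompact_univ_pi fun i => isCompact_Icc,
    fun g i _ => ?_⟩
  rw [mem_Icc, ← abs_le]
  have := norm_integral_le_of_norm_le_const (μ := (volume : Measure I)) (C := B i)
    (f := fun s => α i (g s)) (Eventually.of_forall fun s => hB i _ (g s).2)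
  simpa [moments] using this

theorem measurable_cylinderFunction {m : ℕ} {U : (Fin m → ℝ) → ℝ} {α : Fin m → ℝ → ℝ}
    (hU : Continuous U) (hα : ∀ i, Continuous (α i)) : Measurable (cylinderFunction U α) :=
  hU.measurable.comp (measurable_moments hα)

theorem measurable_cylinderGradient {m : ℕ} {U : (Fin m → ℝ) → ℝ} {α : Fin m → ℝ → ℝ}
    (hU : ContDiff ℝ 1 U) (hα : ∀ i, ContDiff ℝ 1 (α i)) : Measurable (cylinderGradient U α) := by
  refine Finset.measurable_sum _ fun i _ => ?_
  have h1 : Continuous fun x => fderiv ℝ U x (Pi.single i 1) :=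
    (hU.continuous_fderiv one_ne_zero).clm_apply continuous_const
  exact (h1.measurable.comp ((measurable_moments fun i => (hα i).continuous).comp
    measurable_fst)).mul (((hα i).continuous_deriv le_rfl).measurable.comp measurable_eval_uncurry)

theorem exists_bound_cylinderFunction {m : ℕ} {U : (Fin m → ℝ) → ℝ} {α : Fin m → ℝ → ℝ}
    (hU : Continuous U) (hα : ∀ i, Continuous (α i)) : ∃ B, ∀ g, |cylinderFunction U α g| ≤ B := by
  obtain ⟨K, hK, hm⟩ := exists_moments_mem_compact hα
  obtain ⟨B, hB⟩ := hK.exists_bound_of_continuousOn hU.continuousOn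
  exact ⟨B, fun g => hB _ (hm g)⟩

theorem exists_bound_cylinderGradient {m : ℕ} {U : (Fin m → ℝ) → ℝ} {α : Fin m → ℝ → ℝ}
    (hU : ContDiff ℝ 1 U) (hα : ∀ i, ContDiff ℝ 1 (α i)) :
    ∃ B, ∀ p, |cylinderGradient U α p| ≤ B := by
  obtain ⟨K, hK, hm⟩ := exists_moments_mem_compact fun i => (hα i).continuous
  have h1 : ∀ i, Continuous fun x => fderiv ℝ U x (Pi.single i 1) := fun i =>
    (hU.continuous_fderiv one_ne_zero).clm_apply continuous_const
  choose B hB using fun i => hK.exists_bound_of_continuousOn (h1 i).continuousOn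
  choose D hD0 hD using fun i => exists_bound_Icc ((hα i).continuous_deriv le_rfl) 0 1
  refine ⟨∑ i, B i * D i, fun p => (Finset.abs_sum_le_sum_abs _ _).trans
    (Finset.sum_le_sum fun i _ => ?_)⟩
  rw [abs_mul]
  have h2 := hB i _ (hm p.1)
  exact mul_le_mul h2 (hD i _ (p.1 p.2).2) (abs_nonneg _) ((norm_nonneg _).trans h2)

/-- Derivative of `x ↦ ∫ α(g + x h)`. -/
theorem hasDerivAt_integral_segment {α : ℝ → ℝ} (hα : ContDiff ℝ 1 α) {a h : I → ℝ}
    (ha : Measurable a) (hh : Measurable h) (ha1 : ∀ t, |a t| ≤ 1) (hh1 : ∀ t, |h t| ≤ 1) (x : ℝ) :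
    HasDerivAt (fun x => ∫ t, α (a t + x * h t)) (∫ t, deriv α (a t + x * h t) * h t) x := by
  obtain ⟨B, hB0, hB⟩ := exists_bound_Icc (hα.continuous_deriv le_rfl) (-(|x| + 2)) (|x| + 2)
  obtain ⟨D, hD0, hD⟩ := exists_bound_Icc hα.continuous (-(|x| + 2)) (|x| + 2)
  have hmem : ∀ y ∈ Metric.ball x 1, ∀ t, a t + y * h t ∈ Icc (-(|x| + 2)) (|x| + 2) := by
    intro y hy t
    rw [Metric.mem_ball, Real.dist_eq] at hy
    rw [mem_Icc, ← abs_le]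
    have h1 : |y| ≤ |x| + 1 := by
      have := abs_sub_abs_le_abs_sub y x
      linarith
    calc |a t + y * h t| ≤ |a t| + |y| * |h t| := by rw [← abs_mul]; exact abs_add_le _ _
      _ ≤ 1 + (|x| + 1) * 1 := add_le_add (ha1 t) (mul_le_mul h1 (hh1 t) (abs_nonneg _) (by positivity))
      _ = |x| + 2 := by ring
  have hm : ∀ y : ℝ, Measurable fun t => a t + y * h t := fun y => ha.add (hh.const_mul y)
  refine (hasDerivAt_integral_of_dominated_loc_of_deriv_le (μ := (volume : Measure I))
    (F := fun x t => α (a t + x * h t)) (F' := fun x t => deriv α (a t + x * h t) * h t)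
    (bound := fun _ => B) (Metric.ball_mem_nhds x one_pos) ?_ ?_ ?_ ?_ ?_ ?_).2
  · exact Eventually.of_forall fun y => (hα.continuous.measurable.comp (hm y)).aestronglyMeasurable
  · exact Integrable.of_bound (hα.continuous.measurable.comp (hm x)).aestronglyMeasurable D
      (Eventually.of_forall fun t => hD _ (hmem x (Metric.mem_ball_self one_pos) t))
  · exact (((hα.continuous_deriv le_rfl).measurable.comp (hm x)).mul hh).aestronglyMeasurable
  · refine Eventually.of_forall fun t y hy => ?_
    rw [norm_mul]
    exact (mul_le_mul (hB _ (hmem y hy t)) (hh1 t) (abs_nonneg _) hB0).trans (by rw [mul_one])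
  · exact integrable_const _
  · refine Eventually.of_forall fun t y _ => ?_
    have h1 : HasDerivAt (fun y : ℝ => a t + y * h t) (h t) y := by
      simpa using ((hasDerivAt_id y).mul_const (h t)).const_add (a t)
    exact (((hα.differentiable one_ne_zero) _).hasDerivAt).comp y h1

theorem continuousOn_integral_segment {α : ℝ → ℝ} (hα : Continuous α) {a h : I → ℝ}
    (ha : Measurable a) (hh : Measurable h) (hh1 : ∀ t, |h t| ≤ 1)
    (hs : ∀ x ∈ Icc (0 : ℝ) 1, ∀ t, a t + x * h t ∈ Icc (0 : ℝ) 1) :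
    ContinuousOn (fun x => ∫ t, α (a t + x * h t) * h t) (Icc 0 1) := by
  obtain ⟨B, hB0, hB⟩ := exists_bound_Icc hα 0 1
  refine continuousOn_of_dominated (bound := fun _ => B) ?_ ?_ (integrable_const _) ?_
  · exact fun x _ => ((hα.measurable.comp (ha.add (hh.const_mul x))).mul hh).aestronglyMeasurable
  · refine fun x hx => Eventually.of_forall fun t => ?_
    rw [norm_mul]
    exact (mul_le_mul (hB _ (hs x hx t)) (hh1 t) (abs_nonneg _) hB0).trans (by rw [mul_one])
  · exact Eventually.of_forall fun t => by fun_prop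

/-- The point `(1 - x) g + x h` of the segment from `g` to `h`. -/
def lerp (g h : G0) (x : I) : G0 where
  toFun t := ⟨(1 - x) * g t + x * h t,
    add_nonneg (mul_nonneg (sub_nonneg.2 x.2.2) (g t).2.1) (mul_nonneg x.2.1 (h t).2.1),
    by nlinarith [x.2.1, x.2.2, (g t).2.2, (h t).2.2]⟩
  monotone' s t hst := Subtype.mk_le_mk.2 (add_le_add
    (mul_le_mul_of_nonneg_left (g.monotone' hst) (sub_nonneg.2 x.2.2))
    (mul_le_mul_of_nonneg_left (h.monotone' hst) x.2.1))
  rightContinuous' t := by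
    refine tendsto_subtype_rng.2 ?_
    exact (((continuous_subtype_val.continuousAt.comp_continuousWithinAt
      (g.rightContinuous' t)).tendsto).const_mul _).add
        (((continuous_subtype_val.continuousAt.comp_continuousWithinAt
          (h.rightContinuous' t)).tendsto).const_mul _)
  map_one' := by
    ext
    simp [g.map_one', h.map_one']

theorem coe_lerp (g h : G0) (x t : I) : (lerp g h x t : ℝ) = g t + x * (h t - g t) := by
  change (1 - (x : ℝ)) * g t + x * h t = _
  ring

theorem lerp_zero (g h : G0) : lerp g h 0 = g := ext_coe fun t => by simp [coe_lerp]

theorem lerp_one (g h : G0) : lerp g h 1 = h := ext_coe fun t => by simp [coe_lerp]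

/-- A cylinder function along a segment of `𝒢₀` is the restriction of a differentiable function. -/
theorem exists_hasDerivAt_cylinderFunction_lerp {m : ℕ} {U : (Fin m → ℝ) → ℝ} {α : Fin m → ℝ → ℝ}
    (hU : ContDiff ℝ 1 U) (hα : ∀ i, ContDiff ℝ 1 (α i)) (g k : G0) :
    ∃ f D : ℝ → ℝ, (∀ x, HasDerivAt f (D x) x) ∧ ContinuousOn D (Icc 0 1) ∧
      (∀ x : I, f x = cylinderFunction U α (lerp g k x)) ∧
      ∀ x : I, D x = ∫ t, cylinderGradient U α (lerp g k x, t) * (k t - g t) := by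
  set a : I → ℝ := fun t => g t with ha
  set h : I → ℝ := fun t => k t - g t with hh
  have ham : Measurable a := g.measurable_coe
  have hhm : Measurable h := k.measurable_coe.sub ham
  have ha1 : ∀ t, |a t| ≤ 1 := fun t => by rw [ha, abs_of_nonneg (g t).2.1]; exact (g t).2.2
  have hh1 : ∀ t, |h t| ≤ 1 := fun t => abs_sub_le_one _ _ _
  have hs : ∀ x ∈ Icc (0 : ℝ) 1, ∀ t, a t + x * h t ∈ Icc (0 : ℝ) 1 := by
    intro x hx t
    have := (lerp g k ⟨x, hx⟩ t).2
    rwa [coe_lerp] at this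
  set q : ℝ → Fin m → ℝ := fun x i => ∫ t, α i (a t + x * h t) with hq
  have hqd : ∀ x, HasDerivAt q (fun i => ∫ t, deriv (α i) (a t + x * h t) * h t) x := fun x =>
    hasDerivAt_pi.2 fun i => hasDerivAt_integral_segment (hα i) ham hhm ha1 hh1 x
  set D : ℝ → ℝ := fun x => fderiv ℝ U (q x) fun i => ∫ t, deriv (α i) (a t + x * h t) * h t with hD
  have hmom : ∀ x : I, moments α (lerp g k x) = q x := by
    intro s
    funext i
    simp only [moments, coe_lerp, hq, ha, hh]
  refine ⟨fun x => U (q x), D, fun x =>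
    (((hU.differentiable one_ne_zero) _).hasFDerivAt).comp_hasDerivAt x (hqd x), ?_, fun x => ?_,
    fun x => ?_⟩
  · have h1 : ContinuousOn q (Icc 0 1) := fun x _ => (hqd x).continuousAt.continuousWithinAt
    exact ((hU.continuous_fderiv one_ne_zero).comp_continuousOn h1).clm_apply
      (continuousOn_pi.2 fun i => continuousOn_integral_segment ((hα i).continuous_deriv le_rfl)
        ham hhm hh1 hs)
  · rw [cylinderFunction, hmom]
  · have hi : ∀ i : Fin m, Integrable (fun t => fderiv ℝ U (q x) (Pi.single i 1) *
        deriv (α i) (lerp g k x t) * h t) (volume : Measure I) := by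
      intro i
      obtain ⟨B, hB0, hB⟩ := exists_bound_Icc ((hα i).continuous_deriv le_rfl) 0 1
      refine Integrable.mul_bdd (c := 1) (Integrable.const_mul ?_ _)
        hhm.aestronglyMeasurable (Eventually.of_forall fun t => hh1 t)
      exact Integrable.of_bound (((hα i).continuous_deriv le_rfl).measurable.comp
        (measurable_coe _)).aestronglyMeasurable B
          (Eventually.of_forall fun t => hB _ (lerp g k x t).2)
    simp only [cylinderGradient, hmom, Finset.sum_mul]
    rw [integral_finsetSum _ fun i _ => hi i]
    simp only [hD]
    -- Expanding the direction in the standard basis turns the Fréchet derivative of U into the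
    -- partial derivatives of `cylinderGradient`.
    conv_lhs => rw [pi_eq_sum_univ' (fun i => ∫ t, deriv (α i) (a t + x * h t) * h t)]
    rw [map_sum]
    refine Finset.sum_congr rfl fun i _ => ?_
    rw [map_smul, smul_eq_mul, mul_comm, ← integral_const_mul]
    refine integral_congr_ae (Eventually.of_forall fun t => ?_)
    simp only [coe_lerp, ha, hh]
    ring

/-- The fundamental theorem of calculus along segments for cylinder functions. -/
theorem cylinderFunction_sub {m : ℕ} {U : (Fin m → ℝ) → ℝ} {α : Fin m → ℝ → ℝ}
    (hU : ContDiff ℝ 1 U) (hα : ∀ i, ContDiff ℝ 1 (α i)) (g h : G0) :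
    cylinderFunction U α h - cylinderFunction U α g =
      ∫ s : I, ∫ t, cylinderGradient U α (lerp g h s, t) * (h t - g t) := by
  obtain ⟨f, D, hd, hc, hf, hD⟩ := exists_hasDerivAt_cylinderFunction_lerp hU hα g h
  have hftc := intervalIntegral.integral_eq_sub_of_hasDerivAt (a := 0) (b := 1)
    (fun s _ => hd s) (by rw [← uIcc_of_le zero_le_one] at hc; exact hc.intervalIntegrable)
  have h0 := hf 0
  have h1 := hf 1
  have h2 := integral_Iic_unitInterval D 1
  rw [eq_univ_of_forall (s := Iic (1 : I)) fun t => t.2.2, setIntegral_univ] at h2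
  rw [lerp_zero] at h0
  rw [lerp_one] at h1
  simp only [← hD]
  rw [← h0, ← h1, h2]
  exact hftc.symm

/-- The fundamental theorem of calculus along `s ↦ g_s` for cylinder functions. -/
theorem cylinderFunction_pathMap_sub {m : ℕ} {U : (Fin m → ℝ) → ℝ} {α : Fin m → ℝ → ℝ}
    (hU : ContDiff ℝ 1 U) (hα : ∀ i, ContDiff ℝ 1 (α i)) (hw : ∀ k, 0 < w k) (g : G0) (r : I) :
    cylinderFunction U α (pathMap N w hw r g) - cylinderFunction U α g =
      ∫ s in Iic r, ∫ t, cylinderGradient U α (pathMap N w hw s g, t) *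
        (speed N w g s * (reweight N w hw g t - g t)) := by
  obtain ⟨f, D, hd, hc, hf, hD⟩ :=
    exists_hasDerivAt_cylinderFunction_lerp hU hα g (reweight N w hw g)
  have hsub : uIcc (0 : ℝ) r ⊆ Icc 0 1 := by
    rw [uIcc_of_le r.2.1]; exact Icc_subset_Icc le_rfl r.2.2
  -- The path is the segment run at parameter `position`, so the chain rule reduces the claim to
  -- segments.
  have hlerp : ∀ s : I, pathMap N w hw s g =
      lerp g (reweight N w hw g) ⟨position N w g s, position_mem hw g s.2⟩ := fun s =>
    ext_coe fun t => by rw [coe_pathMap, coe_lerp]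
  have hftc := intervalIntegral.integral_eq_sub_of_hasDerivAt (a := 0) (b := r)
    (f := fun s => f (position N w g s))
    (f' := fun s => D (position N w g s) * speed N w g s)
    (fun s hs' => (hd _).comp s (hasDerivAt_position hw g (hsub hs')))
    (((hc.comp (fun s hs' => (hasDerivAt_position hw g hs').continuousAt.continuousWithinAt)
      fun s hs' => position_mem hw g hs').mul (continuousOn_speed hw g)).mono
        hsub).intervalIntegrable
  have h0 : f (position N w g 0) = cylinderFunction U α g := by
    have := hf 0
    rw [lerp_zero] at this
    simpa [position] using this
  have hr : f (position N w g r) = cylinderFunction U α (pathMap N w hw r g) := by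
    rw [hlerp, ← hf]
  rw [← hr, ← h0, ← hftc,
    ← integral_Iic_unitInterval (fun s => D (position N w g s) * speed N w g s)]
  refine integral_congr_ae (Eventually.of_forall fun s => ?_)
  change D (position N w g s) * speed N w g s = _
  have h3 := hD ⟨position N w g s, position_mem hw g s.2⟩
  rw [← hlerp] at h3
  change D (position N w g s) = _ at h3
  rw [h3, ← integral_mul_const]
  refine integral_congr_ae (Eventually.of_forall fun t => ?_)
  ring

end G0

end

/-! ### Calculus along the flow for the closed gradient -/

noncomputable section

variable {β : ℝ} {Q : Measure G0} {N : ℕ} {w : ℕ → ℝ} {m M : ℝ}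

namespace IsDirichletProcess

/-- Since m ≤ 1 ≤ M, all weights along the path stay in [m, M]; the same constant serves every s and
integrates over s. -/
theorem map_pathMap_uncurry_le (hQ : IsDirichletProcess β Q) (hβ : 0 < β) (hw : ∀ k, 0 < w k)
    (hm : 0 < m) (hm1 : m ≤ 1) (hM1 : 1 ≤ M) (h1 : ∀ k, m ≤ w k) (h2 : ∀ k, w k ≤ M) :
    (Q.prod (volume : Measure I)).map (fun p => G0.pathMap N w hw p.2 p.1) ≤
      ENNReal.ofReal ((m / M) ^ (-β)) • Q := by
  have := hQ.isProbabilityMeasure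
  have hmeas := G0.measurable_pathMap_uncurry (N := N) hw
  refine Measure.le_iff.2 fun A hA => ?_
  have h3 : ∀ s : I, Q ((fun g => G0.pathMap N w hw s g) ⁻¹' A) ≤
      ENNReal.ofReal ((m / M) ^ (-β)) * Q A := fun s => by
    rw [← Measure.map_apply (f := fun g => G0.pathMap N w hw s g) (G0.measurable_reweight N _) hA]
    exact hQ.map_reweight_le hβ N (G0.pathWeight_pos hw s) hm (G0.le_pathWeight hm1 h1 s)
      (G0.pathWeight_le hM1 h2 s) A
  rw [Measure.map_apply hmeas hA, Measure.prod_apply_symm (hmeas hA)]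
  refine (lintegral_mono fun s => h3 s).trans ?_
  simp

theorem map_pathMap_prod_le (hQ : IsDirichletProcess β Q) (hβ : 0 < β) (hw : ∀ k, 0 < w k)
    (hm : 0 < m) (hm1 : m ≤ 1) (hM1 : 1 ≤ M) (h1 : ∀ k, m ≤ w k) (h2 : ∀ k, w k ≤ M) :
    (Q.prod ((volume : Measure I).prod (volume : Measure I))).map
        (fun p => (G0.pathMap N w hw p.2.1 p.1, p.2.2)) ≤
      ENNReal.ofReal ((m / M) ^ (-β)) • Q.prod (volume : Measure I) := by
  have := hQ.isProbabilityMeasure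
  have hmeas := G0.measurable_pathMap_uncurry (N := N) hw
  have h3 : Measurable fun p : (G0 × I) × I => (G0.pathMap N w hw p.1.2 p.1.1, p.2) :=
    (hmeas.comp measurable_fst).prodMk measurable_snd
  rw [← Measure.prodAssoc_prod, Measure.map_map (by
    exact (hmeas.comp (measurable_fst.prodMk (measurable_fst.comp measurable_snd))).prodMk
      (measurable_snd.comp measurable_snd)) MeasurableEquiv.prodAssoc.measurable]
  change ((Q.prod volume).prod volume).map
    (Prod.map (fun p : G0 × I => G0.pathMap N w hw p.2 p.1) id) ≤ _
  have : IsFiniteMeasure (ENNReal.ofReal ((m / M) ^ (-β)) • Q) :=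
    Measure.smul_finite _ ENNReal.ofReal_ne_top
  rw [← Measure.map_prod_map _ _ hmeas measurable_id, Measure.map_id, ← Measure.prod_smul_left]
  exact Measure.prod_mono (hQ.map_pathMap_uncurry_le hβ hw hm hm1 hM1 h1 h2) le_rfl

end IsDirichletProcess

theorem G0.measurable_flowKernel (hw : ∀ k, 0 < w k) : Measurable fun q : G0 × I × I =>
    G0.speed N w q.1 q.2.1 * ((G0.reweight N w hw q.1 q.2.2 : ℝ) - q.1 q.2.2) := by
  have e1 : Measurable fun q : G0 × I × I => (q.1, q.2.1) := by fun_prop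
  have e2 : Measurable fun q : G0 × I × I => (G0.reweight N w hw q.1, q.2.2) :=
    ((G0.measurable_reweight N hw).comp measurable_fst).prodMk
      (measurable_snd.comp measurable_snd)
  have e3 : Measurable fun q : G0 × I × I => (q.1, q.2.2) := by fun_prop
  exact (G0.measurable_speed.comp e1).mul
    ((G0.measurable_eval_uncurry.comp e2).sub (G0.measurable_eval_uncurry.comp e3))

theorem G0.norm_flowKernel_le {hw : ∀ k, 0 < w k} (hm : 0 < m) (hm1 : m ≤ 1) (h1 : ∀ k, m ≤ w k)
    (h2 : ∀ k, w k ≤ M) (q : G0 × I × I) :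
    ‖G0.speed N w q.1 q.2.1 * ((G0.reweight N w hw q.1 q.2.2 : ℝ) - q.1 q.2.2)‖ ≤
      (M / m ^ 2).toNNReal := by
  have hK0 : 0 ≤ M / m ^ 2 :=
    div_nonneg (hm.le.trans ((h1 0).trans (h2 0))) (sq_nonneg _)
  rw [Real.coe_toNNReal _ hK0, norm_mul, Real.norm_of_nonneg (G0.speed_nonneg hw _ _)]
  exact (mul_le_mul (G0.speed_le hm hm1 h1 h2 _ _) (G0.abs_sub_le_one _ _ _) (abs_nonneg _)
    hK0).trans (mul_one _).le

theorem G0.measurable_pathMap_prod (hw : ∀ k, 0 < w k) :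
    Measurable fun p : G0 × I × I => (G0.pathMap N w hw p.2.1 p.1, p.2.2) :=
  ((G0.measurable_pathMap_uncurry hw).comp
    (measurable_fst.prodMk (measurable_fst.comp measurable_snd))).prodMk
      (measurable_snd.comp measurable_snd)

theorem IsDirichletProcess.ae_integrable_flow (hQ : IsDirichletProcess β Q) (hβ : 0 < β)
    (hw : ∀ k, 0 < w k) (hm : 0 < m) (hm1 : m ≤ 1) (hM1 : 1 ≤ M) (h1 : ∀ k, m ≤ w k)
    (h2 : ∀ k, w k ≤ M) {V : G0 × I → ℝ} (hV : Integrable V (Q.prod (volume : Measure I))) :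
    ∀ᵐ g ∂Q, Integrable (fun q : I × I => V (G0.pathMap N w hw q.1 g, q.2) *
      (G0.speed N w g q.1 * (G0.reweight N w hw g q.2 - g q.2)))
      ((volume : Measure I).prod volume) := by
  have := hQ.isProbabilityMeasure
  exact ((integrable_comp_of_map_le (G0.measurable_pathMap_prod hw) ENNReal.ofReal_ne_top
    (hQ.map_pathMap_prod_le hβ hw hm hm1 hM1 h1 h2) hV).mul_bdd
      (G0.measurable_flowKernel hw).aestronglyMeasurable
        (Eventually.of_forall fun q => G0.norm_flowKernel_le (hw := hw) hm hm1 h1 h2 q)).prod_right_ae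

/-- The closure of the graph of `𝔻`. -/
def gradientGraph (β : ℝ) : Submodule ℝ (Lp ℝ 2 (dirichletProcess β) ×
    Lp ℝ 2 ((dirichletProcess β).prod (volume : Measure I))) :=
  (Submodule.span ℝ (cylinderGraph β)).topologicalClosure

/-- The fundamental theorem of calculus along `s ↦ g_s` for functions in the closure. -/
theorem gradientGraph_flow (hβ : 0 < β) {p : Lp ℝ 2 (dirichletProcess β) ×
    Lp ℝ 2 ((dirichletProcess β).prod (volume : Measure I))} (hp : p ∈ gradientGraph β)
    (hw : ∀ k, 0 < w k) (hm : 0 < m) (hm1 : m ≤ 1) (hM1 : 1 ≤ M) (h1 : ∀ k, m ≤ w k)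
    (h2 : ∀ k, w k ≤ M) (r : I) :
    ∀ᵐ g ∂(dirichletProcess β), p.1 (G0.pathMap N w hw r g) - p.1 g =
      ∫ q in Iic r ×ˢ univ, p.2 (G0.pathMap N w hw q.1 g, q.2) *
        (G0.speed N w g q.1 * (G0.reweight N w hw g q.2 - g q.2)) := by
  have hQ := isDirichletProcess_dirichletProcess hβ
  have hprob := hQ.isProbabilityMeasure
  have hmr : Measurable fun g => G0.pathMap N w hw r g := G0.measurable_reweight N _
  have hkey : ∀ (f : G0 → ℝ) (x : Unit → G0), (∫ y : Unit, f (x y) * 1 ∂(Measure.dirac ())) =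
      f (x ()) := fun f x => by rw [integral_dirac, mul_one]
  -- The three terms of the formula become bounded operators into L¹: u itself, u at the endpoint,
  -- and the path integral of the gradient. A one-point second factor puts the first two in the
  -- general form.
  obtain ⟨T0, hT0⟩ := exists_transfer (μ := (dirichletProcess β)) (ν := Measure.dirac ()) (ζ := (dirichletProcess β))
    (Θ := Prod.fst) measurable_fst ENNReal.one_ne_top
    (by rw [Measure.map_fst_prod, one_smul]; simp) (κ := fun _ => 1) measurable_const
    (K := 1) (by simp)
  obtain ⟨T1, hT1⟩ := exists_transfer (μ := (dirichletProcess β)) (ν := Measure.dirac ()) (ζ := (dirichletProcess β))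
    (Θ := fun p => G0.pathMap N w hw r p.1) (hmr.comp measurable_fst)
    (C := ENNReal.ofReal ((m / M) ^ (-β))) ENNReal.ofReal_ne_top (by
      have e := Measure.map_map (μ := (dirichletProcess β).prod (Measure.dirac ())) hmr
        measurable_fst
      refine (le_of_eq e.symm).trans ?_
      rw [Measure.map_fst_prod, measure_univ, one_smul]
      exact hQ.map_reweight_le hβ N (G0.pathWeight_pos hw r) hm (G0.le_pathWeight hm1 h1 r)
        (G0.pathWeight_le hM1 h2 r)) (κ := fun _ => 1) measurable_const (K := 1) (by simp)
  have hκ := G0.measurable_flowKernel (N := N) hw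
  have hκb := G0.norm_flowKernel_le (N := N) (hw := hw) hm hm1 h1 h2
  have hr : ((volume : Measure (I × I)).restrict (Iic r ×ˢ univ)) ≤
      (volume : Measure I).prod volume := Measure.restrict_le_self
  have hΘ := G0.measurable_pathMap_prod (N := N) hw
  obtain ⟨T2, hT2⟩ := exists_transfer (μ := (dirichletProcess β))
    (ν := (volume : Measure (I × I)).restrict (Iic r ×ˢ univ)) (ζ := (dirichletProcess β).prod (volume : Measure I))
    hΘ (C := ENNReal.ofReal ((m / M) ^ (-β))) ENNReal.ofReal_ne_top
    ((Measure.map_mono (Measure.prod_mono le_rfl hr) hΘ).trans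
      (hQ.map_pathMap_prod_le hβ hw hm hm1 hM1 h1 h2)) hκ hκb
  set L : (Lp ℝ 2 (dirichletProcess β) × Lp ℝ 2 ((dirichletProcess β).prod (volume : Measure I))) →L[ℝ] Lp ℝ 1 (dirichletProcess β) :=
    T1.comp (ContinuousLinearMap.fst ℝ _ _) - T0.comp (ContinuousLinearMap.fst ℝ _ _) -
      T2.comp (ContinuousLinearMap.snd ℝ _ _) with hL
  have hLapp : ∀ (p : Lp ℝ 2 (dirichletProcess β) × Lp ℝ 2 ((dirichletProcess β).prod (volume : Measure I))) (u : G0 → ℝ)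
      (W : G0 × I → ℝ), p.1 =ᵐ[(dirichletProcess β)] u → p.2 =ᵐ[(dirichletProcess β).prod (volume : Measure I)] W →
      L p =ᵐ[(dirichletProcess β)] fun g => u (G0.pathMap N w hw r g) - u g -
        ∫ q in Iic r ×ˢ univ, W (G0.pathMap N w hw q.1 g, q.2) *
          (G0.speed N w g q.1 * (G0.reweight N w hw g q.2 - g q.2)) := by
    intro p u W hu hW
    have e : L p = T1 p.1 - T0 p.1 - T2 p.2 := rfl
    rw [e]
    filter_upwards [Lp.coeFn_sub (T1 p.1 - T0 p.1) (T2 p.2), Lp.coeFn_sub (T1 p.1) (T0 p.1),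
      hT0 _ _ hu, hT1 _ _ hu, hT2 _ _ hW] with g a1 a2 a3 a4 a5
    rw [a1, Pi.sub_apply, a2, Pi.sub_apply, a3, a4, a5, hkey u (fun _ => g),
      hkey u (fun _ => G0.pathMap N w hw r g)]
  have hLp : L p = 0 := by
    -- The kernel of L is a closed subspace, so it suffices to check cylinder functions.
    have hle : gradientGraph β ≤ LinearMap.ker L.toLinearMap := by
      refine Submodule.topologicalClosure_minimal _ (Submodule.span_le.2 ?_) L.isClosed_ker
      rintro p ⟨n, U, α, hU, hα, hu, hW⟩
      refine LinearMap.mem_ker.2 ((Lp.eq_zero_iff_ae_eq_zero).2 ((hLapp p _ _ hu hW).trans ?_))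
      refine Eventually.of_forall fun g => ?_
      simp only [Pi.zero_apply]
      rw [G0.cylinderFunction_pathMap_sub hU hα hw g r, sub_eq_zero]
      obtain ⟨B, hB⟩ := G0.exists_bound_cylinderGradient hU hα
      have hi : Integrable (fun q : I × I =>
          cylinderGradient U α (G0.pathMap N w hw q.1 g, q.2) *
            (G0.speed N w g q.1 * (G0.reweight N w hw g q.2 - g q.2)))
          (((volume : Measure I).restrict (Iic r)).prod volume) := by
        have e : Measurable fun q : I × I => (g, q) := measurable_prodMk_left
        refine Integrable.mul_bdd (c := (M / m ^ 2).toNNReal) ?_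
          (hκ.comp e).aestronglyMeasurable (Eventually.of_forall fun q => hκb (g, q))
        exact Integrable.of_bound (((G0.measurable_cylinderGradient hU hα).comp
          (hΘ.comp e)).aestronglyMeasurable) B (Eventually.of_forall fun q => hB _)
      have e2 : (volume : Measure (I × I)).restrict (Iic r ×ˢ univ) =
          ((volume : Measure I).restrict (Iic r)).prod volume := by
        rw [Measure.volume_eq_prod, ← Measure.prod_restrict, Measure.restrict_univ]
      rw [e2, integral_prod _ hi]
    exact hle hp
  have := hLapp p _ _ (ae_eq_refl _) (ae_eq_refl _)
  rw [hLp] at this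
  filter_upwards [this, Lp.coeFn_zero ℝ 1 (dirichletProcess β)] with g e1 e2
  rw [e2] at e1
  exact sub_eq_zero.1 e1.symm

end

noncomputable section

/-! ### Closability -/

/-- The exceptional null set may depend on r, so one integrates over rectangles A × [0, r], which
form a generating π-system. -/
theorem ae_eq_zero_of_forall_setIntegral_Iic {X : Type*} [MeasurableSpace X] {μ : Measure X}
    [IsFiniteMeasure μ] {F : X × I → ℝ} (hF : Integrable F (μ.prod volume))
    (h : ∀ r : I, ∀ᵐ x ∂μ, ∫ s in Iic r, F (x, s) = 0) : F =ᵐ[μ.prod volume] 0 := by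
  have hset : ∀ (A : Set X) (r : I), MeasurableSet A →
      ∫ p in A ×ˢ Iic r, F p ∂(μ.prod volume) = 0 := by
    intro A r hA
    rw [setIntegral_prod _ hF.integrableOn]
    rw [integral_congr_ae (ae_restrict_of_ae (h r)), integral_zero]
  refine ae_eq_zero_of_forall_setIntegral_piSystem
    (C := image2 (· ×ˢ ·) {A : Set X | MeasurableSet A} (range (Iic : I → Set I))) ?_ ?_ hF ?_ ?_
  · rw [← generateFrom_prod_eq, ← borel_eq_generateFrom_Iic, ← BorelSpace.measurable_eq,
      MeasurableSpace.generateFrom_measurableSet]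
    · exact ⟨fun _ => univ, fun _ => MeasurableSet.univ, iUnion_const _⟩
    · exact ⟨fun _ => Iic 1, fun _ => mem_range_self _, by
        rw [iUnion_const]; exact eq_univ_of_forall fun t => t.2.2⟩
  · exact MeasurableSpace.isPiSystem_measurableSet.prod isPiSystem_Iic
  · have := hset univ 1 MeasurableSet.univ
    rwa [eq_univ_of_forall (s := Iic (1 : I)) fun t => t.2.2, univ_prod_univ, setIntegral_univ]
      at this
  · rintro _ ⟨A, hA, _, ⟨r, rfl⟩, rfl⟩
    exact hset A r hA

/-! ### Two-valued weights and the tangent vectors they generate -/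

namespace G0

/-- The weights `2` on `[0, K/(N+1))` and `1` on `[K/(N+1), 1]`. -/
def splitWeight (K k : ℕ) : ℝ := if k < K then 2 else 1

theorem one_le_splitWeight (K k : ℕ) : 1 ≤ splitWeight K k := by
  unfold splitWeight; split_ifs <;> norm_num

theorem splitWeight_le (K k : ℕ) : splitWeight K k ≤ 2 := by
  unfold splitWeight; split_ifs <;> norm_num

theorem splitWeight_pos (K k : ℕ) : 0 < splitWeight K k := one_pos.trans_le (one_le_splitWeight K k)

theorem weighted_splitWeight {N K : ℕ} (hK : K ≤ N) (g : G0) (t : I) :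
    weighted N (splitWeight (K + 1)) g t = g t + g (min t (gridPt (N + 1) (K + 1))) := by
  rw [← weighted_one N g t, ← weighted_one N g (min t _), weighted_min_gridPt N _ g t hK,
    weighted, weighted, ← Finset.inter_eq_right.2 (Finset.range_subset_range.2
      (Nat.succ_le_succ hK)), ← Finset.sum_ite_mem, ← Finset.sum_add_distrib]
  refine Finset.sum_congr rfl fun k _ => ?_
  simp only [splitWeight, Finset.mem_range]
  split_ifs <;> ring

/-- The tangent vector `t ↦ g(t ∧ b) - g(b) g(t)`. -/
def tent (b : I) (g : G0) (t : I) : ℝ := g (min t b) - g b * g t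

theorem measurable_tent (b : I) : Measurable fun p : G0 × I => tent b p.1 p.2 := by
  have h1 : Measurable fun p : G0 × I => (p.1, min p.2 b) := by fun_prop
  exact (measurable_eval_uncurry.comp h1).sub
    (((measurable_eval_real b).comp measurable_fst).mul measurable_eval_uncurry)

theorem abs_tent_le (b : I) (g : G0) (t : I) : |tent b g t| ≤ 1 := by
  have h1 := (g (min t b)).2
  have h2 := (g b * g t).2
  have h3 : ((g b * g t : I) : ℝ) = g b * g t := rfl
  rw [h3] at h2
  unfold tent
  rw [abs_le]
  constructor <;> linarith [h1.1, h1.2, h2.1, h2.2]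

/-- With values 2 and 1 the path is, up to the time change 1 / (1 + s), an integral curve of the
vector field `tent`: its velocity depends only on the current point. The total mass is 1 + g(b). -/
theorem speed_mul_splitWeight {N K : ℕ} (hK : K ≤ N) (g : G0) (s t : I) :
    speed N (splitWeight (K + 1)) g s *
        (reweight N (splitWeight (K + 1)) (splitWeight_pos _) g t - g t) =
      tent (gridPt (N + 1) (K + 1)) (pathMap N (splitWeight (K + 1)) (splitWeight_pos _) s g) t /
        (1 + s) := by
  set b := gridPt (N + 1) (K + 1)
  have hc := (g b).2.1
  have hs := s.2.1
  have h1 : (1 : ℝ) + g b ≠ 0 := by positivity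
  have h2 : (1 : ℝ) + s * g b ≠ 0 := by positivity
  have h3 : (1 : ℝ) + s ≠ 0 := by positivity
  have hmass : mass N (splitWeight (K + 1)) g = 1 + g b := by
    rw [mass, weighted_splitWeight hK, g.map_one', min_eq_right unitInterval.le_one']
    rfl
  have hp : ∀ t, (pathMap N (splitWeight (K + 1)) (splitWeight_pos _) s g t : ℝ) =
      (g t + s * g (min t b)) / (1 + s * g b) := by
    intro t
    rw [coe_pathMap, position, coe_reweight, hmass, weighted_splitWeight hK]
    have h4 : (1 : ℝ) - s + s * (1 + g b) ≠ 0 := by convert h2 using 1; ring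
    change (g t : ℝ) + s * (1 + g b) / (1 - s + s * (1 + g b)) *
      ((g t + g (min t b)) / (1 + g b) - g t) = _
    rw [show (1 : ℝ) - s + s * (1 + g b) = 1 + s * g b by ring]
    field_simp
    ring
  rw [tent, hp, hp, hp, min_assoc, min_self, speed, hmass, coe_reweight, hmass,
    weighted_splitWeight hK]
  change (1 + (g b : ℝ)) / (1 - s + s * (1 + g b)) ^ 2 *
      ((g t + g (min t b)) / (1 + g b) - g t) = _
  rw [show (1 : ℝ) - s + s * (1 + g b) = 1 + s * g b by ring]
  field_simp
  ring

/-- Orthogonality reads ∫ v g(t ∧ b) dt = g(b) c with c = ∫ v g. Difference quotients in b, relative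
to g(b), give ∫ v over (x, 1] equal to c for every x < 1. Letting x tend to 1 shows c = 0, so v
integrates to zero over all half-lines. Strict monotonicity permits the division. -/
theorem ae_eq_zero_of_integral_tent {g : G0} (hg : StrictMono g) {v : I → ℝ}
    (hv : Integrable v) (h : ∀ N K, K ≤ N → ∫ t, v t * tent (gridPt (N + 1) (K + 1)) g t = 0) :
    v =ᵐ[volume] 0 := by
  have hgm : ∀ b : I, Measurable fun t : I => (g (min t b) : ℝ) := fun b =>
    g.measurable_coe.comp (by fun_prop)
  have hi : ∀ b : I, Integrable fun t => v t * g (min t b) := fun b =>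
    hv.mul_bdd (c := 1) (hgm b).aestronglyMeasurable (Eventually.of_forall fun t => by
      rw [Real.norm_of_nonneg (g _).2.1]; exact (g _).2.2)
  have hi' : Integrable fun t => v t * g t :=
    hv.mul_bdd (c := 1) g.measurable_coe.aestronglyMeasurable (Eventually.of_forall fun t => by
      rw [Real.norm_of_nonneg (g _).2.1]; exact (g _).2.2)
  set c := ∫ t, v t * g t with hc
  have h1 : ∀ N K, K ≤ N → ∫ t, v t * g (min t (gridPt (N + 1) (K + 1))) =
      g (gridPt (N + 1) (K + 1)) * c := by
    intro N K hK
    rw [hc, ← integral_const_mul, ← sub_eq_zero, ← integral_sub (hi _) (hi'.const_mul _),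
      ← h N K hK]
    refine integral_congr_ae (Eventually.of_forall fun t => ?_)
    simp only [tent]
    ring
  have h2 : ∀ x : I, x < 1 → ∫ t in Ioi x, v t = c := by
    intro x hx
    -- Two consecutive grid points strictly to the right of x, both tending to x.
    set b : ℕ → I := fun n => gridPt (n + 1) (⌊((n + 1 : ℕ) : ℝ) * x⌋₊ + 1) with hb
    set b' : ℕ → I := fun n => gridPt (n + 1) (⌊((n + 1 : ℕ) : ℝ) * x⌋₊ + 2) with hb'
    have hlt : ∀ n, x < b n := fun n => lt_gridPt_floor (n + 1) n.succ_pos x hx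
    have hle : ∀ n, b n ≤ b' n := fun n => gridPt_mono _ (by omega)
    have htend : Tendsto b' atTop (𝓝 x) :=
      tendsto_gridPt_floor x (N := fun n => n + 1) (tendsto_add_atTop_nat 1) 2
    have hev : ∀ᶠ n in atTop, ⌊((n + 1 : ℕ) : ℝ) * x⌋₊ + 2 ≤ n := by
      filter_upwards [htend.eventually (gt_mem_nhds hx)] with n hn
      by_contra hcon
      rcases Nat.lt_or_ge n (⌊((n + 1 : ℕ) : ℝ) * x⌋₊ + 1) with h' | h'
      · exact absurd (gridPt_of_le n.succ_pos (by omega)) hn.ne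
      · have : n + 1 ≤ ⌊((n + 1 : ℕ) : ℝ) * x⌋₊ + 2 := by omega
        exact absurd (gridPt_of_le n.succ_pos this) hn.ne
    have hlt' : ∀ᶠ n in atTop, b n < b' n := by
      filter_upwards [hev] with n hn
      refine lt_of_le_of_ne (hle n) fun he => ?_
      have := congrArg (Subtype.val) he
      simp only [hb, hb'] at this
      rw [coe_gridPt (by omega), coe_gridPt (by omega)] at this
      field_simp at this
      push_cast at this
      linarith
    -- The quotient lies in [0,1]; it is 0 for t ≤ x, and 1 as soon as b' n < t.
    have hlim : Tendsto (fun n => ∫ t, v t * (((g (min t (b' n)) : ℝ) - g (min t (b n))) /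
        (g (b' n) - g (b n)))) atTop (𝓝 (∫ t, (Ioi x).indicator v t)) := by
      refine tendsto_integral_filter_of_dominated_convergence (fun t => ‖v t‖) ?_ ?_ hv.norm ?_
      · exact Eventually.of_forall fun n => hv.aestronglyMeasurable.mul
          (((hgm _).sub (hgm _)).div_const _).aestronglyMeasurable
      · filter_upwards [hlt'] with n hn
        refine Eventually.of_forall fun t => ?_
        rw [norm_mul]
        refine mul_le_of_le_one_right (norm_nonneg _) ?_
        have e1 : (0 : ℝ) < g (b' n) - g (b n) := sub_pos.2 (hg hn)
        have e2 : (g (min t (b n)) : ℝ) ≤ g (min t (b' n)) :=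
          g.monotone' (min_le_min le_rfl hn.le)
        rw [Real.norm_of_nonneg (div_nonneg (sub_nonneg.2 e2) e1.le), div_le_one e1]
        rcases le_total t (b n) with ht | ht
        · rw [min_eq_left ht, min_eq_left (ht.trans hn.le)]
          linarith
        · rw [min_eq_right ht]
          have : (g (min t (b' n)) : ℝ) ≤ g (b' n) := g.monotone' (min_le_right _ _)
          linarith
      · refine Eventually.of_forall fun t => tendsto_const_nhds.congr' ?_
        by_cases ht : x < t
        · filter_upwards [hlt', htend.eventually (gt_mem_nhds ht)] with n hn hnt
          have e1 : (0 : ℝ) < g (b' n) - g (b n) := sub_pos.2 (hg hn)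
          rw [min_eq_right (hn.trans hnt).le, min_eq_right hnt.le, div_self e1.ne',
            indicator_of_mem (mem_Ioi.2 ht), mul_one]
        · refine Eventually.of_forall fun n => ?_
          beta_reduce
          have ht' := (not_lt.1 ht).trans (hlt n).le
          rw [min_eq_left ht', min_eq_left (ht'.trans (hle n)),
            indicator_of_notMem (by simpa using ht)]
          simp
    rw [integral_indicator measurableSet_Ioi] at hlim
    refine tendsto_nhds_unique hlim (tendsto_const_nhds.congr' ?_)
    filter_upwards [hev, hlt'] with n hn hn'
    have e1 : (0 : ℝ) < g (b' n) - g (b n) := sub_pos.2 (hg hn')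
    have e2 : ∫ t, v t * (((g (min t (b' n)) : ℝ) - g (min t (b n))) / (g (b' n) - g (b n))) =
        ((∫ t, v t * g (min t (b' n))) - ∫ t, v t * g (min t (b n))) / (g (b' n) - g (b n)) := by
      rw [← integral_sub (hi _) (hi _), ← integral_div]
      refine integral_congr_ae (Eventually.of_forall fun t => ?_)
      ring
    have e3 : ∫ t, v t * g (min t (b n)) = g (b n) * c := h1 n _ (by omega)
    have e4 : ∫ t, v t * g (min t (b' n)) = g (b' n) * c := h1 n _ (by omega)
    rw [e2, e3, e4, ← sub_mul, mul_div_cancel_left₀ _ e1.ne']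
  -- The integral over (x, 1] equals c for all x < 1 and vanishes in the limit x → 1.
  have hc0 : c = 0 := by
    set x : ℕ → I := fun n => gridPt (n + 1) n with hx
    have hxv : ∀ n, (x n : ℝ) = (n : ℝ) / (n + 1 : ℕ) := fun n => coe_gridPt n.le_succ
    have hx1 : ∀ n, x n < 1 := fun n => by
      have : (x n : ℝ) < 1 := by
        rw [hxv, div_lt_one (by positivity)]; push_cast; linarith
      exact this
    have hxt : Tendsto x atTop (𝓝 1) := by
      rw [tendsto_subtype_rng]
      simp only [hxv]
      push_cast
      exact tendsto_natCast_div_add_atTop (1 : ℝ)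
    have hlim : Tendsto (fun n => ∫ t, (Ioi (x n)).indicator v t) atTop (𝓝 (∫ _ : I, (0 : ℝ))) := by
      refine tendsto_integral_filter_of_dominated_convergence (fun t => ‖v t‖) ?_ ?_ hv.norm ?_
      · exact Eventually.of_forall fun n => hv.aestronglyMeasurable.indicator measurableSet_Ioi
      · exact Eventually.of_forall fun n => Eventually.of_forall fun t => norm_indicator_le_norm_self _ _
      · have : ∀ᵐ t : I, t ≠ 1 := by
          rw [ae_iff]; simp
        filter_upwards [this] with t ht
        have ht1 : t < 1 := lt_of_le_of_ne t.2.2 ht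
        refine tendsto_const_nhds.congr' ?_
        filter_upwards [hxt.eventually (lt_mem_nhds ht1)] with n hn
        rw [indicator_of_notMem (by simpa using hn.le)]
    rw [integral_zero] at hlim
    refine tendsto_nhds_unique (tendsto_const_nhds.congr fun n => ?_) hlim
    rw [integral_indicator measurableSet_Ioi, h2 _ (hx1 n)]
  refine ae_eq_zero_of_forall_setIntegral_piSystem (C := range (Ioi : I → Set I))
    ((BorelSpace.measurable_eq).trans (borel_eq_generateFrom_Ioi I)) isPiSystem_Ioi hv ?_ ?_
  · have := h2 0 one_pos
    rw [hc0] at this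
    rw [← this, ← integral_indicator measurableSet_Ioi]
    refine integral_congr_ae ?_
    have h0 : ∀ᵐ t : I, t ≠ 0 := by
      rw [ae_iff]; simp
    filter_upwards [h0] with t ht
    rw [indicator_of_mem]
    exact lt_of_le_of_ne t.2.1 fun h => ht (Subtype.ext h.symm)
  · rintro _ ⟨x, rfl⟩
    rcases eq_or_lt_of_le (show x ≤ 1 from x.2.2) with rfl | hx
    · have : Ioi (1 : I) = ∅ := eq_empty_of_forall_notMem fun t (ht : 1 < t) =>
        absurd ht (not_lt.2 t.2.2)
      rw [this, setIntegral_empty]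
    · rw [h2 x hx, hc0]

end G0

end

/-! ### Almost sure strict monotonicity, and the graph of the closed gradient -/

noncomputable section

namespace G0

/-- Any s < t with (N + 1)(t - s) > 2 have two consecutive grid points between them. Countably many
conditions therefore suffice, and each holds almost surely. -/
theorem strictMono_of_grid {g : G0} (h : ∀ N k : ℕ, 0 < k → k ≤ N →
    (g (gridPt (N + 1) k) : ℝ) < g (gridPt (N + 1) (k + 1))) : StrictMono g := by
  intro s t hst
  have hst' : (s : ℝ) < t := hst
  have ht1 := t.2.2
  obtain ⟨N, hN⟩ := exists_nat_gt (2 / ((t : ℝ) - s))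
  have hN1 : 2 < ((N + 1 : ℕ) : ℝ) * (t - s) := by
    rw [div_lt_iff₀ (by linarith)] at hN
    push_cast
    nlinarith
  set k := ⌊((N + 1 : ℕ) : ℝ) * s⌋₊ with hk
  have hfl : (k : ℝ) ≤ ((N + 1 : ℕ) : ℝ) * s := Nat.floor_le (mul_nonneg (Nat.cast_nonneg _) s.2.1)
  have hkN : (k : ℝ) + 2 < ((N + 1 : ℕ) : ℝ) * t := by linarith
  have hkN' : k + 2 < N + 1 + 1 := by
    have : ((k + 2 : ℕ) : ℝ) < ((N + 1 : ℕ) : ℝ) + 1 := by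
      push_cast at hkN ⊢
      nlinarith
    exact_mod_cast this
  have h1 : s ≤ gridPt (N + 1) (k + 1) :=
    (lt_gridPt_floor (N + 1) N.succ_pos s (hst.trans_le t.2.2)).le
  have h2 : gridPt (N + 1) (k + 1 + 1) ≤ t := by
    refine Subtype.coe_le_coe.1 ?_
    rw [coe_gridPt (by omega), div_le_iff₀ (by positivity)]
    push_cast at hkN ⊢
    linarith
  exact (g.monotone' h1).trans_lt
    ((Subtype.coe_lt_coe.1 (h N (k + 1) k.succ_pos (by omega))).trans_le (g.monotone' h2))

end G0

theorem IsDirichletProcess.ae_increments_nodes_pos {β : ℝ} {Q : Measure G0}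
    (hQ : IsDirichletProcess β Q) (N : ℕ) :
    ∀ᵐ g ∂Q, ∀ i, 0 < increments (G0.nodes N g) i := by
  refine ae_of_ae_map (G0.measurable_nodes N).aemeasurable
    (p := fun x => ∀ i, 0 < increments x i) ?_
  rw [hQ.map_nodes N]
  exact ae_increments_pos _

theorem IsDirichletProcess.ae_strictMono {β : ℝ} {Q : Measure G0} (hQ : IsDirichletProcess β Q) :
    ∀ᵐ g ∂Q, StrictMono (G0.toFun g) := by
  filter_upwards [ae_all_iff.2 fun N => hQ.ae_increments_nodes_pos N] with g hg
  refine G0.strictMono_of_grid fun N k hk hkN => ?_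
  have := hg N ⟨k, by omega⟩
  rw [increments, G0.withEndpoints_nodes, G0.withEndpoints_nodes, if_neg (Fin.succ_ne_zero _),
    if_neg (by simp [Fin.ext_iff]; omega)] at this
  simpa using this

theorem integrable_fiber {X : Type*} [MeasurableSpace X] {μ : Measure X} [IsFiniteMeasure μ]
    (V : Lp ℝ 2 (μ.prod (volume : Measure I))) : Integrable V (μ.prod (volume : Measure I)) :=
  (Lp.memLp V).integrable (by norm_num)

/-- `𝔻` is closable. -/
theorem gradientGraph_snd_eq_zero {β : ℝ} (hβ : 0 < β) {p : Lp ℝ 2 (dirichletProcess β) ×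
    Lp ℝ 2 ((dirichletProcess β).prod (volume : Measure I))} (hp : p ∈ gradientGraph β)
    (hp0 : p.1 = 0) : p.2 = 0 := by
  have hQ := isDirichletProcess_dirichletProcess hβ
  have hprob := hQ.isProbabilityMeasure
  have hVm : Measurable p.2 := (Lp.stronglyMeasurable p.2).measurable
  have hVi := integrable_fiber p.2
  have hHm : ∀ b, StronglyMeasurable fun g : G0 => ∫ t, p.2 (g, t) * G0.tent b g t := fun b =>
    StronglyMeasurable.integral_prod_right
      (f := fun (g : G0) (t : I) => p.2 (g, t) * G0.tent b g t)
      ((hVm.mul (G0.measurable_tent b)).stronglyMeasurable)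
  -- As u = 0, the flow formula says that the integral of H(g_s) / (1 + s) over [0, r] vanishes for
  -- every r, where H(g) pairs the gradient with the tangent vector. So H vanishes along almost
  -- every path at almost every time.
  have hH : ∀ N K, K ≤ N → ∀ᵐ g ∂(dirichletProcess β),
      ∫ t, p.2 (g, t) * G0.tent (G0.gridPt (N + 1) (K + 1)) g t = 0 := by
    intro N K hK
    set b := G0.gridPt (N + 1) (K + 1)
    set w := G0.splitWeight (K + 1)
    have hw : ∀ k, 0 < w k := G0.splitWeight_pos _
    have h1 : ∀ k, 1 ≤ w k := G0.one_le_splitWeight _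
    have h2 : ∀ k, w k ≤ 2 := G0.splitWeight_le _
    have hmeas := G0.measurable_pathMap_uncurry (N := N) hw
    set H : G0 → ℝ := fun g => ∫ t, p.2 (g, t) * G0.tent b g t with hHdef
    have hHi : Integrable H (dirichletProcess β) := by
      refine Integrable.integral_prod_left (f := fun q : G0 × I => p.2 q * G0.tent b q.1 q.2) ?_
      exact hVi.mul_bdd (c := 1) (G0.measurable_tent b).aestronglyMeasurable
        (Eventually.of_forall fun q => G0.abs_tent_le _ _ _)
    have hFi : Integrable (fun q : G0 × I => H (G0.pathMap N w hw q.2 q.1) / (1 + q.2))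
        ((dirichletProcess β).prod volume) := by
      have e1 := integrable_comp_of_map_le hmeas ENNReal.ofReal_ne_top
        (hQ.map_pathMap_uncurry_le hβ hw one_pos le_rfl one_le_two h1 h2) hHi
      have e2 : Measurable fun q : G0 × I => (1 + (q.2 : ℝ))⁻¹ :=
        ((measurable_subtype_coe.comp measurable_snd).const_add 1).inv
      simp only [div_eq_mul_inv]
      refine e1.mul_bdd (c := 1) e2.aestronglyMeasurable (Eventually.of_forall fun q => ?_)
      have := q.2.2.1
      rw [Real.norm_of_nonneg (by positivity)]
      exact inv_le_one_of_one_le₀ (by linarith)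
    have hu : p.1 =ᵐ[dirichletProcess β] 0 := (Lp.eq_zero_iff_ae_eq_zero).1 hp0
    have hVint := hQ.ae_integrable_flow (N := N) hβ hw one_pos le_rfl one_le_two h1 h2 hVi
    have hF0 : ∀ r : I, ∀ᵐ g ∂(dirichletProcess β),
        ∫ s in Iic r, H (G0.pathMap N w hw s g) / (1 + s) = 0 := by
      intro r
      have e1 : ∀ᵐ g ∂(dirichletProcess β), p.1 (G0.pathMap N w hw r g) = 0 := by
        refine ae_of_ae_map (f := fun g => G0.pathMap N w hw r g)
          (G0.measurable_reweight N _).aemeasurable (p := fun g => p.1 g = 0) ?_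
        exact ((Measure.absolutelyContinuous_of_le (hQ.map_reweight_le hβ N
          (G0.pathWeight_pos hw r) one_pos (G0.le_pathWeight le_rfl h1 r)
          (G0.pathWeight_le one_le_two h2 r))).trans Measure.smul_absolutelyContinuous).ae_le hu
      filter_upwards [hu, e1, hVint,
        gradientGraph_flow (N := N) hβ hp hw one_pos le_rfl one_le_two h1 h2 r] with g a1 a2 a3 a4
      rw [a1, a2, Pi.zero_apply, sub_zero, Measure.volume_eq_prod, ← Measure.prod_restrict,
        Measure.restrict_univ, integral_prod _ (a3.mono_measure
          (Measure.prod_mono Measure.restrict_le_self le_rfl))] at a4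
      rw [a4]
      refine integral_congr_ae (Eventually.of_forall fun s => ?_)
      simp only [hHdef, w]
      rw [← integral_div]
      refine integral_congr_ae (Eventually.of_forall fun t => ?_)
      simp only [G0.speed_mul_splitWeight hK]
      rw [mul_div_assoc]
    have hF := ae_eq_zero_of_forall_setIntegral_Iic hFi hF0
    have hA : MeasurableSet {g | H g = 0} :=
      (hHm b).measurable (measurableSet_singleton (0 : ℝ))
    -- By Fubini one fixed time s serves almost every g; composing with the inverse reweighting,
    -- again absolutely continuous, moves the statement from g_s to g.
    obtain ⟨s, hs⟩ : ∃ s : I, ∀ᵐ g ∂(dirichletProcess β), H (G0.pathMap N w hw s g) = 0 := by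
      have e1 : ∀ᵐ q ∂((volume : Measure I).prod (dirichletProcess β)),
          H (G0.pathMap N w hw q.1 q.2) = 0 := by
        have e2 : ∀ᵐ q ∂((dirichletProcess β).prod (volume : Measure I)),
            H (G0.pathMap N w hw q.2 q.1) = 0 := by
          filter_upwards [hF] with q hq
          have := q.2.2.1
          have h3 : (1 : ℝ) + q.2 ≠ 0 := by positivity
          exact (div_eq_zero_iff.1 hq).resolve_right h3
        exact Measure.measurePreserving_swap.quasiMeasurePreserving.ae e2
      exact (Measure.ae_ae_of_ae_prod e1).exists
    have hinv := fun k => inv_pos.2 (G0.pathWeight_pos hw s k)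
    -- The path weights lie in [1, 2], hence their inverses in [1/2, 1].
    have hqi := hQ.map_reweight_le hβ N hinv (m := 1 / 2) (M := 1) (by norm_num)
      (fun k => by
        rw [← one_div]
        exact one_div_le_one_div_of_le (G0.pathWeight_pos hw s k)
          (G0.pathWeight_le one_le_two h2 s k))
      (fun k => inv_le_one_of_one_le₀ (G0.le_pathWeight le_rfl h1 s k))
    have e3 := ae_of_ae_map (G0.measurable_reweight N hinv).aemeasurable
      (((Measure.absolutelyContinuous_of_le hqi).trans
        Measure.smul_absolutelyContinuous).ae_le hs)
    filter_upwards [e3] with g hg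
    rwa [G0.pathMap, G0.reweight_inv_reweight] at hg
  refine (Lp.eq_zero_iff_ae_eq_zero).2 ?_
  refine (Measure.ae_prod_iff_ae_ae (p := fun q => p.2 q = 0)
    (hVm (measurableSet_singleton 0))).2 ?_
  have hH' : ∀ᵐ g ∂(dirichletProcess β), ∀ N K, K ≤ N →
      ∫ t, p.2 (g, t) * G0.tent (G0.gridPt (N + 1) (K + 1)) g t = 0 := by
    refine ae_all_iff.2 fun N => ae_all_iff.2 fun K => ?_
    by_cases hK : K ≤ N
    · filter_upwards [hH N K hK] with g hg _ using hg
    · exact Eventually.of_forall fun g h => absurd h hK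
  filter_upwards [hQ.ae_strictMono, hVi.prod_right_ae, hH'] with g h1 h2 h3
  exact G0.ae_eq_zero_of_integral_tent h1 h2 h3

/-- `Submodule.toLinearPMap` represents its submodule only if that is a graph, and
`LinearPMap.closure` is the closure only for closable operators. Closability supplies both, and from
here on the gradient is handled through its graph. -/
theorem graph_closedGradient {β : ℝ} (hβ : 0 < β) : (closedGradient β).graph = gradientGraph β := by
  have h1 : (wassersteinGradient β).graph = Submodule.span ℝ (cylinderGraph β) :=
    Submodule.toLinearPMap_graph_eq _ fun p hp hp0 => gradientGraph_snd_eq_zero hβ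
      (Submodule.le_topologicalClosure _ hp) hp0
  have h2 : (wassersteinGradient β).IsClosable := by
    refine ⟨(gradientGraph β).toLinearPMap, ?_⟩
    rw [h1, Submodule.toLinearPMap_graph_eq _ fun p hp hp0 => gradientGraph_snd_eq_zero hβ hp hp0]
    rfl
  rw [closedGradient, ← h2.graph_closure_eq_closure_graph, h1]
  rfl

end

noncomputable section

/-! ### The upper bound -/

/-- Cauchy-Schwarz through Young's inequality with parameter d + ε, the ε allowing d = 0. -/
theorem integral_mul_le_of_sq_le {X : Type*} [MeasurableSpace X] {μ : Measure X} {f h : X → ℝ}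
    {d : ℝ} (hd : 0 ≤ d) (hf : Integrable (fun x => f x ^ 2) μ) (hh : Integrable (fun x => h x ^ 2) μ)
    (hfh : Integrable (fun x => f x * h x) μ) (h1 : ∫ x, f x ^ 2 ∂μ ≤ 1)
    (h2 : ∫ x, h x ^ 2 ∂μ ≤ d ^ 2) : ∫ x, f x * h x ∂μ ≤ d := by
  refine le_of_forall_pos_le_add fun ε hε => ?_
  have hc : 0 < d + ε := by positivity
  have h3 : ∫ x, f x * h x ∂μ ≤
      ∫ x, ((d + ε) / 2 * f x ^ 2 + (d + ε)⁻¹ / 2 * h x ^ 2) ∂μ := by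
    refine integral_mono hfh ((hf.const_mul _).add (hh.const_mul _)) fun x => ?_
    have e : (d + ε) / 2 * f x ^ 2 + (d + ε)⁻¹ / 2 * h x ^ 2 - f x * h x =
        (d + ε)⁻¹ / 2 * ((d + ε) * f x - h x) ^ 2 := by
      field_simp
      ring
    have : 0 ≤ (d + ε)⁻¹ / 2 * ((d + ε) * f x - h x) ^ 2 := by positivity
    exact sub_nonneg.1 (e ▸ this)
  rw [integral_add (hf.const_mul _) (hh.const_mul _), integral_const_mul, integral_const_mul] at h3
  have h4 : (d + ε)⁻¹ / 2 * ∫ x, h x ^ 2 ∂μ ≤ (d + ε) / 2 := by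
    have : ∫ x, h x ^ 2 ∂μ ≤ (d + ε) ^ 2 := h2.trans (by gcongr; linarith)
    calc (d + ε)⁻¹ / 2 * ∫ x, h x ^ 2 ∂μ ≤ (d + ε)⁻¹ / 2 * (d + ε) ^ 2 := by gcongr
      _ = (d + ε) / 2 := by field_simp
  have h5 : (d + ε) / 2 * ∫ x, f x ^ 2 ∂μ ≤ (d + ε) / 2 := mul_le_of_le_one_right (by positivity) h1
  linarith

/-- If `Γ(u,u) ≤ 1` then `u` increases at most by the distance along the flow. -/
theorem gradientGraph_sub_le {β : ℝ} (hβ : 0 < β) {p : Lp ℝ 2 (dirichletProcess β) ×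
    Lp ℝ 2 ((dirichletProcess β).prod (volume : Measure I))} (hp : p ∈ gradientGraph β)
    (hΓ : ∀ᵐ g ∂(dirichletProcess β), ∫ t, p.2 (g, t) ^ 2 ≤ 1) {N : ℕ} {w : ℕ → ℝ} {m M : ℝ}
    (hw : ∀ k, 0 < w k) (hm : 0 < m) (hm1 : m ≤ 1) (hM1 : 1 ≤ M) (h1 : ∀ k, m ≤ w k)
    (h2 : ∀ k, w k ≤ M) :
    ∀ᵐ g ∂(dirichletProcess β), p.1 (G0.reweight N w hw g) - p.1 g ≤
      dist (G0.reweight N w hw g) g := by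
  have hQ := isDirichletProcess_dirichletProcess hβ
  have hprob := hQ.isProbabilityMeasure
  have hVi := integrable_fiber p.2
  have hV2 := (Lp.memLp p.2).integrable_sq
  have hmeas := G0.measurable_pathMap_uncurry (N := N) hw
  have hae : ∀ᵐ q ∂((dirichletProcess β).prod (volume : Measure I)),
      Integrable (fun t => p.2 (G0.pathMap N w hw q.2 q.1, t)) ∧
      Integrable (fun t => p.2 (G0.pathMap N w hw q.2 q.1, t) ^ 2) ∧
      ∫ t, p.2 (G0.pathMap N w hw q.2 q.1, t) ^ 2 ≤ 1 := by
    refine ae_of_ae_map hmeas.aemeasurable (p := fun g => Integrable (fun t => p.2 (g, t)) ∧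
      Integrable (fun t => p.2 (g, t) ^ 2) ∧ ∫ t, p.2 (g, t) ^ 2 ≤ 1) ?_
    refine ((Measure.absolutelyContinuous_of_le
      (hQ.map_pathMap_uncurry_le hβ hw hm hm1 hM1 h1 h2)).trans
        Measure.smul_absolutelyContinuous).ae_le ?_
    exact hVi.prod_right_ae.and (hV2.prod_right_ae.and hΓ)
  filter_upwards [Measure.ae_ae_of_ae_prod hae, hQ.ae_integrable_flow (N := N) hβ hw hm hm1 hM1 h1
    h2 hVi, gradientGraph_flow (N := N) hβ hp hw hm hm1 hM1 h1 h2 1] with g a1 a2 a3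
  have hI1 : Iic (1 : I) = univ := eq_univ_of_forall fun t => t.2.2
  rw [G0.pathMap_one, hI1, univ_prod_univ, setIntegral_univ, Measure.volume_eq_prod,
    integral_prod _ a2] at a3
  rw [a3]
  have hspeed := G0.integral_Iic_speed (N := N) hw g 1
  have hpos1 : G0.position N w g (1 : I) = 1 := by
    simp [G0.position, (G0.mass_pos N hw g).ne']
  rw [hI1, setIntegral_univ, hpos1] at hspeed
  set d := dist (G0.reweight N w hw g) g with hd
  have hd2 : ∫ t : I, ((G0.reweight N w hw g t : ℝ) - g t) ^ 2 = d ^ 2 := by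
    rw [hd, G0.dist_eq_norm_toL2, G0.norm_toL2_sub_sq]
  have hhm : Measurable fun t : I => (G0.reweight N w hw g t : ℝ) - g t :=
    (G0.measurable_coe _).sub g.measurable_coe
  have hsi : Integrable (fun s : I => G0.speed N w g s) := by
    refine Integrable.of_bound (C := M / m ^ 2) (G0.measurable_speed.comp
      measurable_prodMk_left).aestronglyMeasurable (Eventually.of_forall fun s => ?_)
    rw [Real.norm_of_nonneg (G0.speed_nonneg hw _ _)]
    exact G0.speed_le hm hm1 h1 h2 g s
  -- At each time Cauchy-Schwarz bounds the pairing of the gradient, of norm at most 1, with the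
  -- direction of the segment, of norm d; the speed then integrates to 1.
  calc _ ≤ ∫ s : I, G0.speed N w g s * d := by
        refine integral_mono_ae a2.integral_prod_left (hsi.mul_const d) ?_
        filter_upwards [a1] with s hs
        obtain ⟨b1, b2, b3⟩ := hs
        have e : ∀ t, p.2 (G0.pathMap N w hw s g, t) *
            (G0.speed N w g s * ((G0.reweight N w hw g t : ℝ) - g t)) =
            G0.speed N w g s * (p.2 (G0.pathMap N w hw s g, t) *
              ((G0.reweight N w hw g t : ℝ) - g t)) := fun t => by ring
        simp only [e]
        rw [integral_const_mul]
        refine mul_le_mul_of_nonneg_left (integral_mul_le_of_sq_le dist_nonneg b2 ?_ ?_ b3 hd2.le)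
          (G0.speed_nonneg hw _ _)
        · refine Integrable.of_bound (C := 1) (hhm.pow_const 2).aestronglyMeasurable
            (Eventually.of_forall fun t => ?_)
          rw [norm_pow]
          exact pow_le_one₀ (norm_nonneg _) (G0.abs_sub_le_one _ _ _)
        · exact b1.mul_bdd (c := 1) hhm.aestronglyMeasurable
            (Eventually.of_forall fun t => G0.abs_sub_le_one _ _ _)
    _ = d := by rw [integral_mul_const, hspeed, one_mul]

/-! ### Transport between prescribed grid values -/

theorem increments_le_one {N : ℕ} {z : Fin N → ℝ} (hz : ∀ i, 0 ≤ increments z i) (i : Fin (N + 1)) :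
    increments z i ≤ 1 := by
  rw [← sum_increments z]
  exact Finset.single_le_sum (fun j _ => hz j) (Finset.mem_univ i)

/-- The weights which transport the nodes `z` to the nodes `z'`. -/
def transportWeight {N : ℕ} (z z' : Fin N → ℝ) (k : ℕ) : ℝ :=
  if h : k < N + 1 then increments z' ⟨k, h⟩ / increments z ⟨k, h⟩ else 1

theorem le_transportWeight {N : ℕ} {z z' : Fin N → ℝ} {η : ℝ} (h : ∀ i, 0 < increments z i)
    (h' : ∀ i, η ≤ increments z' i) (hη : 0 < η) (k : ℕ) : η ≤ transportWeight z z' k := by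
  have h0' := fun i => hη.trans_le (h' i)
  have h1' : η ≤ 1 := (h' 0).trans (increments_le_one (fun i => (h0' i).le) 0)
  unfold transportWeight
  split_ifs with hk
  · rw [le_div_iff₀ (h _)]
    exact (mul_le_of_le_one_right hη.le (increments_le_one (fun i => (h i).le) _)).trans (h' _)
  · exact h1'

theorem transportWeight_le {N : ℕ} {z z' : Fin N → ℝ} {η : ℝ} (h : ∀ i, η ≤ increments z i)
    (h' : ∀ i, 0 < increments z' i) (hη : 0 < η) (k : ℕ) : transportWeight z z' k ≤ η⁻¹ := by
  have h1 : η ≤ 1 := (h 0).trans (increments_le_one (fun i => (hη.trans_le (h i)).le) 0)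
  unfold transportWeight
  split_ifs with hk
  · rw [← one_div]
    exact div_le_div₀ zero_le_one (increments_le_one (fun i => (h' i).le) _) hη (h _)
  · exact (one_le_inv₀ hη).2 h1

/-- The induced map T on grid values is continuous at z with T z = z'. The Dirichlet density is
positive on the open simplex, so the g with nodes in a small neighbourhood of z have positive
measure and meet the almost sure event P. -/
theorem IsDirichletProcess.exists_nodes_near {β : ℝ} {Q : Measure G0}
    (hQ : IsDirichletProcess β Q) (hβ : 0 < β) {N : ℕ} {z z' : Fin N → ℝ}
    (hz : ∀ i, 0 < increments z i) (hw : ∀ k, 0 < transportWeight z z' k) {P : G0 → Prop}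
    (hP : ∀ᵐ g ∂Q, P g) {ε : ℝ} (hε : 0 < ε) :
    ∃ g, P g ∧ (∀ j, |G0.nodes N g j - z j| < ε) ∧
      ∀ j, |G0.nodes N (G0.reweight N (transportWeight z z') hw g) j - z' j| < ε := by
  set T : (Fin N → ℝ) → Fin N → ℝ := fun y =>
    normalizedSums fun i : Fin (N + 1) => transportWeight z z' i * increments y i with hT
  have hinc : (fun i : Fin (N + 1) => transportWeight z z' i * increments z i) = increments z' := by
    funext i
    rw [transportWeight, dif_pos i.2, div_mul_cancel₀ _ (hz i).ne']
  have hTz : T z = z' := by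
    rw [hT]
    beta_reduce
    rw [hinc, normalizedSums_increments]
  have hTc : ContinuousAt T z := by
    refine continuousAt_pi.2 fun i => ?_
    have hc : ∀ i : Fin (N + 1), Continuous fun y : Fin N → ℝ =>
        transportWeight z z' i * increments y i := fun i => (continuous_increments i).const_mul _
    refine ContinuousAt.div (continuous_finsetSum _ fun i _ => hc i).continuousAt
      (continuous_finsetSum _ fun i _ => hc i).continuousAt ?_
    rw [hinc, sum_increments]
    exact one_ne_zero
  have hnhds : ∀ᶠ y in 𝓝 z, (∀ i, 0 < increments y i) ∧ (∀ j, |y j - z j| < ε) ∧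
      ∀ j, |T y j - z' j| < ε := by
    have e1 : ∀ᶠ y in 𝓝 z, ∀ i, 0 < increments y i := eventually_all.2 fun i =>
      (continuous_increments i).continuousAt.eventually (lt_mem_nhds (hz i))
    have e2 : ∀ᶠ y in 𝓝 z, dist y z < ε := Metric.ball_mem_nhds z hε
    have e3 : ∀ᶠ y in 𝓝 z, dist (T y) z' < ε := by
      have : ∀ᶠ x in 𝓝 (T z), dist x z' < ε := by
        rw [hTz]
        exact Metric.ball_mem_nhds z' hε
      exact hTc.eventually this
    filter_upwards [e1, e2, e3] with y a1 a2 a3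
    exact ⟨a1, fun j => (dist_le_pi_dist y z j).trans_lt a2,
      fun j => (dist_le_pi_dist (T y) z' j).trans_lt a3⟩
  obtain ⟨O, hO, hOo, hzO⟩ := eventually_nhds_iff.1 hnhds
  have hpos : Q (G0.nodes N ⁻¹' O) ≠ 0 := by
    rw [← Measure.map_apply (G0.measurable_nodes N) hOo.measurableSet, hQ.map_nodes N]
    intro h0
    rw [withDensity_apply_eq_zero (measurable_dirichletPDF _)] at h0
    -- O was chosen inside the open simplex, where the density does not vanish.
    have hsub : O ⊆ {x | dirichletPDF (fun _ => β / (N + 1 : ℕ)) x ≠ 0} ∩ O := by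
      refine fun y hy => ⟨?_, hy⟩
      have hy' := (hO y hy).1
      have hb : 0 < β / (N + 1 : ℕ) := by positivity
      rw [mem_ofPred_eq, dirichletPDF, if_pos hy']
      refine (ENNReal.ofReal_pos.2 (mul_pos (div_pos (Real.Gamma_pos_of_pos ?_) ?_) ?_)).ne'
      · exact Finset.sum_pos (fun _ _ => hb) ⟨0, Finset.mem_univ _⟩
      · exact Finset.prod_pos fun _ _ => Real.Gamma_pos_of_pos hb
      · exact Finset.prod_pos fun i _ => Real.rpow_pos_of_pos (hy' i) _
    exact (hOo.measure_pos volume ⟨z, hzO⟩).ne' (measure_mono_null hsub h0)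
  have hf : ∃ᵐ g ∂Q, g ∈ G0.nodes N ⁻¹' O := frequently_ae_mem_iff.2 hpos
  obtain ⟨g, hg, hPg⟩ := (hf.and_eventually hP).exists
  have h3 := hO _ hg
  refine ⟨g, hPg, h3.2.1, fun j => ?_⟩
  rw [G0.nodes_reweight]
  exact h3.2.2 j

namespace G0

/-- The nodes of `g`, moved slightly towards the uniform ones. -/
def perturbedNodes (N : ℕ) (g : G0) (j : Fin N) : ℝ :=
  (1 - 1 / ((N : ℝ) + 1)) * nodes N g j + 1 / ((N : ℝ) + 1) * gridPt (N + 1) (j + 1)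

/-- Nodes of g may coincide, which would make transport weights zero or infinite. The uniform nodes,
with share 1/(N+1) and spacing 1/(N+1), guarantee the stated gap. -/
theorem le_increments_perturbedNodes (N : ℕ) (g : G0) (i : Fin (N + 1)) :
    (1 / ((N : ℝ) + 1)) ^ 2 ≤ increments (perturbedNodes N g) i := by
  have hN : (0 : ℝ) < (N : ℝ) + 1 := by positivity
  have h1 : 1 / ((N : ℝ) + 1) ≤ 1 := by
    rw [div_le_one hN]; linarith [(Nat.cast_nonneg N : (0 : ℝ) ≤ N)]
  have hw : ∀ k : Fin (N + 2), withEndpoints (perturbedNodes N g) k =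
      (1 - 1 / ((N : ℝ) + 1)) * withEndpoints (nodes N g) k +
        1 / ((N : ℝ) + 1) * withEndpoints (fun i : Fin N => (gridPt (N + 1) (i + 1) : ℝ)) k := by
    intro k
    refine Fin.cases ?_ (fun j => ?_) k
    · simp [withEndpoints]
    · refine Fin.lastCases ?_ (fun i => ?_) j
      · simp [withEndpoints]
      · simp [withEndpoints, perturbedNodes]
  have h2 : increments (perturbedNodes N g) i =
      (1 - 1 / ((N : ℝ) + 1)) * increments (nodes N g) i +
        1 / ((N : ℝ) + 1) * increments (fun i : Fin N => (gridPt (N + 1) (i + 1) : ℝ)) i := by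
    simp only [increments, hw]
    ring
  rw [h2, IsDirichletProcess.increments_gridPt]
  have h3 : 0 ≤ increments (nodes N g) i :=
    sub_nonneg.2 (monotone_withEndpoints_nodes N g (Fin.castSucc_lt_succ).le)
  have h4 := mul_nonneg (sub_nonneg.2 h1) h3
  push_cast
  linarith [sq (1 / ((N : ℝ) + 1))]

theorem abs_perturbedNodes_sub_le (N : ℕ) (g : G0) (j : Fin N) :
    |perturbedNodes N g j - nodes N g j| ≤ 1 / ((N : ℝ) + 1) := by
  have h1 : perturbedNodes N g j - nodes N g j =
      1 / ((N : ℝ) + 1) * (gridPt (N + 1) (j + 1) - nodes N g j) := by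
    rw [perturbedNodes]; ring
  have h2 : |(gridPt (N + 1) (j + 1) : ℝ) - nodes N g j| ≤ 1 := by
    have a := (gridPt (N + 1) (j + 1)).2
    have b := (g (gridPt (N + 1) (j + 1))).2
    rw [abs_le, nodes]
    constructor <;> linarith [a.1, a.2, b.1, b.2]
  rw [h1, abs_mul, abs_of_nonneg (by positivity)]
  exact mul_le_of_le_one_right (by positivity) h2

theorem tendsto_of_abs_nodes_sub_lt {g : ℕ → G0} {h : G0} (hg : ∀ N (j : Fin N),
    |nodes N (g N) j - perturbedNodes N h j| < 1 / ((N : ℝ) + 1)) : Tendsto g atTop (𝓝 h) := by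
  have hε : Tendsto (fun n : ℕ => 2 * (1 / ((n : ℝ) + 1))) atTop (𝓝 0) := by
    simpa using tendsto_one_div_add_atTop_nhds_zero_nat.const_mul (2 : ℝ)
  refine tendsto_of_nodes (N := fun n => n + 1) (tendsto_add_atTop_nat 1) hε fun n k hk hkn => ?_
  have h1 := hg n ⟨k - 1, by omega⟩
  have h2 := abs_perturbedNodes_sub_le n h ⟨k - 1, by omega⟩
  have h3 : ∀ g : G0, nodes n g ⟨k - 1, by omega⟩ = g (gridPt (n + 1) k) := fun g => by
    rw [nodes]
    simp only [Nat.sub_add_cancel hk]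
  rw [h3] at h1 h2
  have := abs_add_le ((g n (gridPt (n + 1) k) : ℝ) - perturbedNodes n h ⟨k - 1, by omega⟩)
    (perturbedNodes n h ⟨k - 1, by omega⟩ - h (gridPt (n + 1) k))
  rw [sub_add_sub_cancel] at this
  linarith

end G0

theorem formDomain_mem_gradientGraph {β : ℝ} (hβ : 0 < β) (w : formDomain β) :
    ((w : Lp ℝ 2 (dirichletProcess β)), closedGradient β w) ∈ gradientGraph β := by
  rw [← graph_closedGradient hβ]
  exact LinearPMap.mem_graph _ w

/-- The almost sure inequality says nothing at g₀ and g₁ themselves. For each N it is applied at a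
good point near g₀ whose reweighting is near g₁; as N grows both converge in 𝒢₀, and continuity of u
passes to the limit. -/
theorem sub_le_dist_of_mem_intrinsicFunctions {β : ℝ} (hβ : 0 < β) {u : G0 → ℝ}
    (hu : u ∈ intrinsicFunctions β) (g₀ g₁ : G0) : u g₁ - u g₀ ≤ dist g₁ g₀ := by
  obtain ⟨huc, v, hvu, hΓ⟩ := hu
  have hQ := isDirichletProcess_dirichletProcess hβ
  have hex : ∀ N : ℕ, ∃ g g' : G0, u g' - u g ≤ dist g' g ∧
      (∀ j, |G0.nodes N g j - G0.perturbedNodes N g₀ j| < 1 / ((N : ℝ) + 1)) ∧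
      ∀ j, |G0.nodes N g' j - G0.perturbedNodes N g₁ j| < 1 / ((N : ℝ) + 1) := by
    intro N
    have hη : (0 : ℝ) < (1 / ((N : ℝ) + 1)) ^ 2 := by positivity
    have hz := G0.le_increments_perturbedNodes N
    have hz0 := fun g i => hη.trans_le (hz g i)
    have h1 := le_transportWeight (hz0 g₀) (hz g₁) hη
    have h2 := transportWeight_le (hz g₀) (hz0 g₁) hη
    have hw := fun k => hη.trans_le (h1 k)
    have hη1 : (1 / ((N : ℝ) + 1)) ^ 2 ≤ 1 :=
      (hz g₀ 0).trans (increments_le_one (fun i => (hz0 g₀ i).le) 0)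
    have hM := (one_le_inv₀ hη).2 hη1
    have hP := gradientGraph_sub_le hβ (formDomain_mem_gradientGraph hβ v)
      (by simpa only [squareField, ← sq] using hΓ) (N := N) hw hη hη1 hM h1 h2
    -- The continuous function and its L² representative also agree at the reweighted point, because
    -- null sets pull back to null sets.
    have hP' : ∀ᵐ g ∂(dirichletProcess β),
        (v : Lp ℝ 2 (dirichletProcess β)) (G0.reweight N _ hw g) = u (G0.reweight N _ hw g) := by
      refine ae_of_ae_map (G0.measurable_reweight N hw).aemeasurable
        (p := fun g => (v : Lp ℝ 2 (dirichletProcess β)) g = u g) ?_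
      exact ((Measure.absolutelyContinuous_of_le (hQ.map_reweight_le hβ N hw hη h1 h2)).trans
        Measure.smul_absolutelyContinuous).ae_le hvu
    obtain ⟨g, ⟨a1, a2, a3⟩, b, c⟩ := hQ.exists_nodes_near hβ (hz0 g₀) hw
      (hP.and (hP'.and hvu)) (ε := 1 / ((N : ℝ) + 1)) (by positivity)
    refine ⟨g, G0.reweight N _ hw g, ?_, b, c⟩
    rw [← a2, ← a3]
    exact a1
  choose g g' h1 h2 h3 using hex
  have t0 := G0.tendsto_of_abs_nodes_sub_lt h2
  have t1 := G0.tendsto_of_abs_nodes_sub_lt h3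
  exact le_of_tendsto_of_tendsto' (((huc.tendsto _).comp t1).sub ((huc.tendsto _).comp t0))
    (t1.dist t0) h1

end

noncomputable section

/-! ### A smooth step function -/

theorem hasDerivAt_sq_max_zero (x : ℝ) : HasDerivAt (fun x : ℝ => max 0 x ^ 2) (2 * max 0 x) x := by
  rcases lt_trichotomy x 0 with hx | rfl | hx
  · have h : (fun x : ℝ => max 0 x ^ 2) =ᶠ[𝓝 x] fun _ => 0 := by
      filter_upwards [gt_mem_nhds hx] with y hy
      simp [max_eq_left (le_of_lt hy)]
    rw [max_eq_left hx.le, mul_zero]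
    exact (hasDerivAt_const x 0).congr_of_eventuallyEq h
  · rw [hasDerivAt_iff_isLittleO]
    have h : (fun x : ℝ => max 0 x ^ 2) =O[𝓝 0] fun x : ℝ => x ^ 2 := by
      refine Asymptotics.IsBigO.of_bound 1 (Eventually.of_forall fun y => ?_)
      rw [one_mul, norm_pow, norm_pow]
      gcongr
      rw [Real.norm_of_nonneg (le_max_left _ _), Real.norm_eq_abs]
      exact max_le (abs_nonneg _) (le_abs_self _)
    simpa using h.trans_isLittleO (Asymptotics.isLittleO_pow_id one_lt_two)
  · have h : (fun x : ℝ => max 0 x ^ 2) =ᶠ[𝓝 x] fun x => x ^ 2 := by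
      filter_upwards [lt_mem_nhds hx] with y hy
      rw [max_eq_right (le_of_lt hy)]
    rw [max_eq_right hx.le]
    simpa using (hasDerivAt_pow 2 x).congr_of_eventuallyEq h

/-- The hat function. -/
def hat (x : ℝ) : ℝ := max 0 (x + 1) - 2 * max 0 x + max 0 (x - 1)

/-- The primitive of `hat`, a `C¹` function which is `0` on `]-∞, -1]` and `1` on `[1, ∞[`. -/
def smoothStep (x : ℝ) : ℝ :=
  (max 0 (x + 1) ^ 2 - 2 * max 0 x ^ 2 + max 0 (x - 1) ^ 2) / 2

theorem continuous_hat : Continuous hat := by unfold hat; fun_prop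

theorem hasDerivAt_smoothStep (x : ℝ) : HasDerivAt smoothStep (hat x) x := by
  have h1 : HasDerivAt (fun x : ℝ => max 0 (x + 1) ^ 2) (2 * max 0 (x + 1)) x := by
    simpa using (hasDerivAt_sq_max_zero (x + 1)).comp_add_const x 1
  have h2 : HasDerivAt (fun x : ℝ => max 0 (x - 1) ^ 2) (2 * max 0 (x - 1)) x := by
    simpa using (hasDerivAt_sq_max_zero (x - 1)).comp_sub_const x 1
  refine (((h1.sub ((hasDerivAt_sq_max_zero x).const_mul 2)).add h2).div_const 2).congr_deriv ?_
  unfold hat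
  ring

theorem contDiff_smoothStep : ContDiff ℝ 1 smoothStep := by
  refine contDiff_one_iff_deriv.2 ⟨fun x => (hasDerivAt_smoothStep x).differentiableAt, ?_⟩
  rw [show deriv smoothStep = hat from funext fun x => (hasDerivAt_smoothStep x).deriv]
  exact continuous_hat

theorem hat_nonneg (x : ℝ) : 0 ≤ hat x := by
  unfold hat
  rcases max_cases 0 (x + 1) with h | h <;> rcases max_cases 0 x with h' | h' <;>
    rcases max_cases 0 (x - 1) with h'' | h'' <;> linarith [h.1, h.2, h'.1, h'.2, h''.1, h''.2]

theorem hat_eq_zero {x : ℝ} (hx : 1 ≤ |x|) : hat x = 0 := by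
  unfold hat
  rcases le_abs.1 hx with h | h
  · rw [max_eq_right (by linarith), max_eq_right (by linarith), max_eq_right (by linarith)]
    ring
  · rw [max_eq_left (by linarith), max_eq_left (by linarith), max_eq_left (by linarith)]
    ring

theorem smoothStep_mem_Icc (x : ℝ) : smoothStep x ∈ Icc (0 : ℝ) 1 := by
  unfold smoothStep
  rcases max_cases 0 (x + 1) with h | h <;> rcases max_cases 0 x with h' | h' <;>
    rcases max_cases 0 (x - 1) with h'' | h'' <;> rw [h.1, h'.1, h''.1] <;>
    constructor <;> nlinarith [h.2, h'.2, h''.2]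

theorem smoothStep_eq_zero {x : ℝ} (hx : x ≤ -1) : smoothStep x = 0 := by
  unfold smoothStep
  rw [max_eq_left (by linarith), max_eq_left (by linarith), max_eq_left (by linarith)]
  ring

theorem smoothStep_eq_one {x : ℝ} (hx : 1 ≤ x) : smoothStep x = 1 := by
  unfold smoothStep
  rw [max_eq_right (by linarith), max_eq_right (by linarith), max_eq_right (by linarith)]
  ring

/-- Integer translates of `hat` form a partition of unity: `hat` is a second difference of the
positive part, so the sum telescopes. -/
theorem sum_hat {n : ℕ} {z : ℝ} (hz : z ∈ Icc (0 : ℝ) n) :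
    ∑ k ∈ Finset.range (n + 2), hat (k - z) = 1 := by
  have h : ∀ k : ℕ, hat (k - z) =
      (max 0 (((k + 1 : ℕ) : ℝ) - z) - max 0 (((k + 1 : ℕ) : ℝ) - z - 1)) -
        (max 0 ((k : ℝ) - z) - max 0 ((k : ℝ) - z - 1)) := by
    intro k
    unfold hat
    push_cast
    rw [show (k : ℝ) + 1 - z - 1 = k - z by ring, show (k : ℝ) + 1 - z = k - z + 1 by ring]
    ring
  simp only [h]
  rw [Finset.sum_range_sub (fun k : ℕ => max 0 ((k : ℝ) - z) - max 0 ((k : ℝ) - z - 1))]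
  have h1 := hz.1
  have h2 := hz.2
  push_cast
  rw [max_eq_right (by linarith), max_eq_right (by linarith), max_eq_left (by linarith),
    max_eq_left (by linarith)]
  ring

/-! ### Smoothed distribution functions and approximating cylinder functions -/

namespace G0

/-- A smooth approximation of `Leb {s : n g(s) ≤ k}`. -/
def smoothCDF (n k : ℕ) (g : G0) : ℝ := ∫ s : I, smoothStep (k - n * g s)

theorem integrable_smoothStep (n k : ℕ) (g : G0) :
    Integrable fun s : I => smoothStep (k - n * g s) :=
  Integrable.of_bound (C := 1) ((contDiff_smoothStep.continuous.measurable.comp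
    ((g.measurable_coe.const_mul _).const_sub _)).aestronglyMeasurable)
    (Eventually.of_forall fun s => by
      rw [Real.norm_of_nonneg (smoothStep_mem_Icc _).1]; exact (smoothStep_mem_Icc _).2)

theorem volume_real_Iic_unitInterval (x : I) : (volume : Measure I).real (Iic x) = x := by
  simp [measureReal_def, ENNReal.toReal_ofReal x.2.1]

theorem smoothCDF_mem_Icc (n k : ℕ) (g : G0) : smoothCDF n k g ∈ Icc (0 : ℝ) 1 := by
  constructor
  · exact integral_nonneg fun s => (smoothStep_mem_Icc _).1
  · have := integral_mono (integrable_smoothStep n k g) (integrable_const (1 : ℝ))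
      fun s => (smoothStep_mem_Icc _).2
    simpa [smoothCDF] using this

theorem le_smoothCDF {n k : ℕ} {g : G0} {x : I} (h : (n : ℝ) * g x + 1 ≤ k) :
    (x : ℝ) ≤ smoothCDF n k g := by
  rw [← volume_real_Iic_unitInterval x, ← integral_indicator_one measurableSet_Iic]
  refine integral_mono ((integrable_const (1 : ℝ)).indicator measurableSet_Iic)
    (integrable_smoothStep n k g) fun s => ?_
  by_cases hs : s ≤ x
  · have h1 : (g s : ℝ) ≤ g x := g.monotone' hs
    have h2 : (n : ℝ) * g s ≤ n * g x := by gcongr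
    rw [smoothStep_eq_one (by linarith)]
    exact indicator_le_self' (fun _ _ => zero_le_one) s
  · rw [indicator_of_notMem (by simpa using hs)]
    exact (smoothStep_mem_Icc _).1

theorem smoothCDF_le {n k : ℕ} {g : G0} {x : I} (h : (k : ℝ) + 1 ≤ n * g x) :
    smoothCDF n k g ≤ x := by
  rw [← volume_real_Iic_unitInterval x, ← integral_indicator_one measurableSet_Iic]
  refine integral_mono (integrable_smoothStep n k g)
    ((integrable_const (1 : ℝ)).indicator measurableSet_Iic) fun s => ?_
  by_cases hs : s ≤ x
  · rw [indicator_of_mem (mem_Iic.2 hs)]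
    exact (smoothStep_mem_Icc _).2
  · have h1 : (g x : ℝ) ≤ g s := g.monotone' (not_le.1 hs).le
    have h2 : (n : ℝ) * g x ≤ n * g s := by gcongr
    rw [smoothStep_eq_zero (by linarith)]
    exact indicator_nonneg (fun _ _ => zero_le_one) s

/-- If k / n is within 1 / n of g t, the smoothed distribution function at k / n is close to g⁻¹(g
t) = t; strict monotonicity excludes flat pieces of g, on which the inverse would jump. -/
theorem eventually_abs_smoothCDF_sub_lt {g : G0} (hg : StrictMono g) (t : I) {δ : ℝ} (hδ : 0 < δ) :
    ∀ᶠ n : ℕ in atTop, ∀ k : ℕ, |(k : ℝ) - n * g t| < 1 → |smoothCDF n k g - t| < δ := by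
  -- Of the margin 2, one unit pays for the distance of k from n g t, the other for the width of the
  -- smoothing.
  have key : ∀ {a b : I}, a < b → ∀ᶠ n : ℕ in atTop, (n : ℝ) * g a + 2 ≤ n * g b := by
    intro a b hab
    have h1 : (0 : ℝ) < g b - g a := sub_pos.2 (hg hab)
    obtain ⟨n₀, hn₀⟩ := exists_nat_gt (2 / ((g b : ℝ) - g a))
    filter_upwards [eventually_ge_atTop n₀] with n hn
    have h2 : 2 / ((g b : ℝ) - g a) < n := hn₀.trans_le (by exact_mod_cast hn)
    rw [div_lt_iff₀ h1] at h2
    linarith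
  have hlow : ∀ᶠ n : ℕ in atTop, ∀ k : ℕ, |(k : ℝ) - n * g t| < 1 → (t : ℝ) - δ < smoothCDF n k g := by
    by_cases ht : (t : ℝ) - δ / 2 < 0
    · exact Eventually.of_forall fun n k _ => by linarith [(smoothCDF_mem_Icc n k g).1]
    · have hmem : (t : ℝ) - δ / 2 ∈ Icc (0 : ℝ) 1 := ⟨not_lt.1 ht, by linarith [t.2.2]⟩
      filter_upwards [key (a := ⟨_, hmem⟩) (b := t)
        (Subtype.mk_lt_mk.2 (by linarith))] with n hn k hk
      have := le_smoothCDF (n := n) (k := k) (g := g) (x := ⟨_, hmem⟩) (by linarith [(abs_lt.1 hk).1])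
      change (t : ℝ) - δ / 2 ≤ _ at this
      linarith
  have hup : ∀ᶠ n : ℕ in atTop, ∀ k : ℕ, |(k : ℝ) - n * g t| < 1 → smoothCDF n k g < t + δ := by
    by_cases ht : 1 < (t : ℝ) + δ / 2
    · exact Eventually.of_forall fun n k _ => by linarith [(smoothCDF_mem_Icc n k g).2]
    · have hmem : (t : ℝ) + δ / 2 ∈ Icc (0 : ℝ) 1 := ⟨by linarith [t.2.1], not_lt.1 ht⟩
      filter_upwards [key (a := t) (b := ⟨_, hmem⟩)
        (Subtype.mk_lt_mk.2 (by linarith))] with n hn k hk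
      have := smoothCDF_le (n := n) (k := k) (g := g) (x := ⟨_, hmem⟩) (by linarith [(abs_lt.1 hk).2])
      change _ ≤ (t : ℝ) + δ / 2 at this
      linarith
  filter_upwards [hlow, hup] with n h1 h2 k hk
  rw [abs_lt]
  constructor <;> linarith [h1 k hk, h2 k hk]

/-- A weighted average of the values of `φ` at the points `smoothCDF n k g`. -/
def smoothAverage (φ : ℝ → ℝ) (n : ℕ) (p : G0 × I) : ℝ :=
  ∑ k ∈ Finset.range (n + 2), φ (smoothCDF n k p.1) * hat (k - n * p.1 p.2)

theorem mul_coe_mem_Icc (n : ℕ) (g : G0) (t : I) : (n : ℝ) * g t ∈ Icc (0 : ℝ) n :=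
  ⟨mul_nonneg n.cast_nonneg (g t).2.1, mul_le_of_le_one_right n.cast_nonneg (g t).2.2⟩

theorem abs_smoothAverage_le {φ : ℝ → ℝ} {B : ℝ} (hB : ∀ x ∈ Icc (0 : ℝ) 1, |φ x| ≤ B) (n : ℕ)
    (p : G0 × I) : |smoothAverage φ n p| ≤ B := by
  calc |smoothAverage φ n p| ≤ ∑ k ∈ Finset.range (n + 2), B * hat (k - n * p.1 p.2) := by
        refine (Finset.abs_sum_le_sum_abs _ _).trans (Finset.sum_le_sum fun k _ => ?_)
        rw [abs_mul, abs_of_nonneg (hat_nonneg _)]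
        exact mul_le_mul_of_nonneg_right (hB _ (smoothCDF_mem_Icc _ _ _)) (hat_nonneg _)
    _ = B := by rw [← Finset.mul_sum, sum_hat (mul_coe_mem_Icc n p.1 p.2), mul_one]

/-- Only the k with |k - n g t| < 1 contribute to the average, and for these the argument of φ is
close to t. -/
theorem tendsto_smoothAverage {φ : ℝ → ℝ} (hφ : Continuous φ) {g : G0} (hg : StrictMono g) (t : I) :
    Tendsto (fun n => smoothAverage φ n (g, t)) atTop (𝓝 (φ t)) := by
  rw [Metric.tendsto_nhds]
  intro ε hε
  obtain ⟨δ, hδ, hδε⟩ := Metric.continuous_iff.1 hφ t (ε / 2) (by positivity)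
  filter_upwards [eventually_abs_smoothCDF_sub_lt hg t hδ] with n hn
  have h1 : smoothAverage φ n (g, t) - φ t = ∑ k ∈ Finset.range (n + 2),
      (φ (smoothCDF n k g) - φ t) * hat (k - n * g t) := by
    simp only [sub_mul, Finset.sum_sub_distrib]
    rw [← Finset.mul_sum, sum_hat (mul_coe_mem_Icc n g t), mul_one]
    rfl
  rw [Real.dist_eq, h1]
  calc _ ≤ ∑ k ∈ Finset.range (n + 2), ε / 2 * hat (k - n * g t) := by
        refine (Finset.abs_sum_le_sum_abs _ _).trans (Finset.sum_le_sum fun k _ => ?_)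
        rw [abs_mul, abs_of_nonneg (hat_nonneg _)]
        rcases le_or_gt 1 |(k : ℝ) - n * g t| with h | h
        · rw [hat_eq_zero h, mul_zero, mul_zero]
        · exact mul_le_mul_of_nonneg_right (hδε _ (hn k h)).le (hat_nonneg _)
    _ = ε / 2 := by rw [← Finset.mul_sum, sum_hat (mul_coe_mem_Icc n g t), mul_one]
    _ < ε := by linarith

/-- The outer functions of the approximating cylinder functions. -/
def outerFunction (Ψ : ℝ → ℝ) (c : ℝ) (n : ℕ) (x : Fin (n + 2) → ℝ) : ℝ := c - (∑ k, Ψ (x k)) / n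

/-- The inner functions of the approximating cylinder functions. -/
def innerFunction (n : ℕ) (k : Fin (n + 2)) (x : ℝ) : ℝ := smoothStep ((k : ℕ) - n * x)

theorem contDiff_innerFunction (n : ℕ) (k : Fin (n + 2)) : ContDiff ℝ 1 (innerFunction n k) :=
  contDiff_smoothStep.comp (by fun_prop)

theorem contDiff_outerFunction {Ψ : ℝ → ℝ} (hΨ : ContDiff ℝ 1 Ψ) (c : ℝ) (n : ℕ) :
    ContDiff ℝ 1 (outerFunction Ψ c n) :=
  contDiff_const.sub ((ContDiff.sum fun k _ => hΨ.comp (contDiff_apply ℝ ℝ k)).div_const _)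

theorem fderiv_outerFunction {Ψ φ : ℝ → ℝ} (hΨ : ∀ x, HasDerivAt Ψ (φ x) x) (c : ℝ) (n : ℕ)
    (x : Fin (n + 2) → ℝ) (i : Fin (n + 2)) :
    fderiv ℝ (outerFunction Ψ c n) x (Pi.single i 1) = -(φ (x i) / n) := by
  have h1 : ∀ k : Fin (n + 2), HasDerivAt (fun s : ℝ => Ψ ((x + s • (Pi.single i 1 : Fin (n + 2) → ℝ)) k))
      (if k = i then φ (x i) else 0) 0 := by
    intro k
    by_cases hk : k = i
    · subst hk
      have h2 : HasDerivAt (fun s : ℝ => x k + s) 1 0 := (hasDerivAt_id _).const_add _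
      have h3 := HasDerivAt.comp (0 : ℝ) (h₂ := Ψ) (h := fun s => x k + s) (hΨ _) h2
      simpa [Function.comp_def] using h3
    · simpa [hk] using hasDerivAt_const (0 : ℝ) (Ψ (x k))
  have h4 : HasDerivAt (fun s : ℝ => outerFunction Ψ c n
      (x + s • (Pi.single i 1 : Fin (n + 2) → ℝ)))
      (-(φ (x i) / n)) 0 := by
    refine (((HasDerivAt.fun_sum fun k (_ : k ∈ Finset.univ) => h1 k).div_const (n : ℝ)).const_sub
      c).congr_deriv ?_
    simp
  have h5 : Differentiable ℝ Ψ := fun x => (hΨ x).differentiableAt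
  have h6 : Differentiable ℝ (outerFunction Ψ c n) := by
    unfold outerFunction
    fun_prop
  exact ((h6 x).hasFDerivAt.hasLineDerivAt (Pi.single i 1)).unique h4

/-- The factor -1/n from the outer function cancels the factor -n from the inner ones. -/
theorem cylinderGradient_outerFunction {Ψ φ : ℝ → ℝ} (hΨ : ∀ x, HasDerivAt Ψ (φ x) x) (c : ℝ)
    {n : ℕ} (hn : n ≠ 0) (p : G0 × I) :
    cylinderGradient (outerFunction Ψ c n) (innerFunction n) p = smoothAverage φ n p := by
  rw [smoothAverage, Finset.sum_range, cylinderGradient]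
  refine Finset.sum_congr rfl fun i _ => ?_
  have h1 : HasDerivAt (innerFunction n i) (hat ((i : ℕ) - n * (p.1 p.2 : ℝ)) * -n) (p.1 p.2) := by
    have h2 : HasDerivAt (fun x : ℝ => ((i : ℕ) : ℝ) - n * x) (-n) (p.1 p.2) := by
      simpa using ((hasDerivAt_id (p.1 p.2 : ℝ)).const_mul (n : ℝ)).const_sub ((i : ℕ) : ℝ)
    exact (hasDerivAt_smoothStep _).comp _ h2
  have hn' : (n : ℝ) ≠ 0 := by exact_mod_cast hn
  rw [fderiv_outerFunction hΨ, h1.deriv]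
  change -(φ (smoothCDF n i p.1) / n) * _ = _
  field_simp

/-- The identity map as an element of `𝒢₀`. -/
def identity : G0 := ⟨id, monotone_id, fun _ => continuousWithinAt_id, rfl⟩

theorem strictMono_lerp_identity (g : G0) {s : I} (hs : s < 1) : StrictMono (lerp identity g s) := by
  intro a b hab
  refine Subtype.coe_lt_coe.1 ?_
  rw [coe_lerp, coe_lerp]
  have h1 : (g a : ℝ) ≤ g b := g.monotone' hab.le
  have h2 : ((identity a : I) : ℝ) < identity b := hab
  have h3 : (s : ℝ) < 1 := hs
  nlinarith [s.2.1]

theorem measurable_lerp (g h : G0) : Measurable fun p : I × I => (lerp g h p.1 p.2 : ℝ) := by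
  simp only [coe_lerp]
  have h1 := g.measurable_coe.comp (measurable_snd : Measurable fun p : I × I => p.2)
  have h2 := h.measurable_coe.comp (measurable_snd : Measurable fun p : I × I => p.2)
  have h3 : Measurable fun p : I × I => (p.1 : ℝ) := measurable_subtype_coe.comp measurable_fst
  exact h1.add (h3.mul (h2.sub h1))

theorem measurable_lerp_left (g h : G0) : Measurable (lerp g h) :=
  measurable_of_eval fun t => by
    have : Measurable fun s : I => (lerp g h s t : ℝ) :=
      (measurable_lerp g h).comp measurable_prodMk_right
    exact this.subtype_mk (h := fun s => (lerp g h s t).2)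

theorem measurable_smoothAverage {φ : ℝ → ℝ} (hφ : Continuous φ) (n : ℕ) :
    Measurable (smoothAverage φ n) := by
  refine Finset.measurable_sum _ fun k _ => ?_
  have h1 : StronglyMeasurable (Function.uncurry fun (g : G0) (s : I) =>
      smoothStep ((k : ℕ) - n * (g s : ℝ))) :=
    (contDiff_smoothStep.continuous.measurable.comp
      ((measurable_eval_uncurry.const_mul _).const_sub _)).stronglyMeasurable
  have h2 : Measurable fun g : G0 => smoothCDF n k g := h1.integral_prod_right.measurable
  exact (hφ.measurable.comp (h2.comp measurable_fst)).mul
    (continuous_hat.measurable.comp ((measurable_eval_uncurry.const_mul _).const_sub _))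

/-- The segment from the identity to g consists of strictly increasing maps for s < 1, so the
gradients converge along it even when g itself has flat pieces. -/
theorem tendsto_integral_smoothAverage {φ : ℝ → ℝ} (hφ : Continuous φ) (g : G0) :
    Tendsto (fun n => ∫ s : I, ∫ t, smoothAverage φ n (lerp identity g s, t) * (g t - identity t))
      atTop (𝓝 (∫ t : I, φ t * (g t - identity t))) := by
  obtain ⟨B, hB0, hB⟩ := exists_bound_Icc hφ 0 1
  have hm : ∀ n, Measurable fun p : I × I =>
      smoothAverage φ n (lerp identity g p.1, p.2) * ((g p.2 : ℝ) - identity p.2) := fun n =>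
    ((measurable_smoothAverage hφ n).comp (((measurable_lerp_left identity g).comp
      measurable_fst).prodMk measurable_snd)).mul
        ((g.measurable_coe.sub identity.measurable_coe).comp measurable_snd)
  have hb : ∀ n (s t : I), ‖smoothAverage φ n (lerp identity g s, t) *
      ((g t : ℝ) - identity t)‖ ≤ B := fun n s t => by
    rw [norm_mul]
    exact (mul_le_mul (abs_smoothAverage_le hB _ _) (abs_sub_le_one _ _ _) (abs_nonneg _)
      hB0).trans (mul_one _).le
  have h1 : ∫ t : I, φ t * ((g t : ℝ) - identity t) =
      ∫ _ : I, ∫ t : I, φ t * ((g t : ℝ) - identity t) := by simp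
  rw [h1]
  refine tendsto_integral_filter_of_dominated_convergence (fun _ => B) ?_ ?_ (integrable_const _) ?_
  · refine Eventually.of_forall fun n => ?_
    exact (hm n).stronglyMeasurable.integral_prod_right'.aestronglyMeasurable
  · refine Eventually.of_forall fun n => Eventually.of_forall fun s => ?_
    have := norm_integral_le_of_norm_le_const (μ := (volume : Measure I))
      (Eventually.of_forall fun t => hb n s t)
    simpa using this
  · have h0 : ∀ᵐ s : I, s ≠ 1 := by rw [ae_iff]; simp
    filter_upwards [h0] with s hs
    have hs1 : s < 1 := lt_of_le_of_ne s.2.2 hs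
    refine tendsto_integral_filter_of_dominated_convergence (fun _ => B) ?_ ?_
      (integrable_const _) ?_
    · exact Eventually.of_forall fun n =>
        ((hm n).comp measurable_prodMk_left).aestronglyMeasurable
    · exact Eventually.of_forall fun n => Eventually.of_forall fun t => hb n s t
    · exact Eventually.of_forall fun t =>
        (tendsto_smoothAverage hφ (strictMono_lerp_identity g hs1) t).mul_const _

end G0

end

noncomputable section

/-! ### The lower bound -/

theorem tendsto_Lp_two_of_bounded {X : Type*} [MeasurableSpace X] {μ : Measure X}
    [IsFiniteMeasure μ] {f : ℕ → X → ℝ} {g : X → ℝ} {F : ℕ → Lp ℝ 2 μ} {G : Lp ℝ 2 μ} {B : ℝ}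
    (hF : ∀ n, F n =ᵐ[μ] f n) (hG : G =ᵐ[μ] g) (hb : ∀ n x, |f n x| ≤ B)
    (hfg : ∀ᵐ x ∂μ, Tendsto (fun n => f n x) atTop (𝓝 (g x))) : Tendsto F atTop (𝓝 G) := by
  rw [tendsto_iff_norm_sub_tendsto_zero]
  have h1 : ∀ n, ‖F n - G‖ ^ 2 = ∫ x, (f n x - g x) ^ 2 ∂μ := by
    intro n
    rw [← real_inner_self_eq_norm_sq, L2.inner_def]
    refine integral_congr_ae ?_
    filter_upwards [Lp.coeFn_sub (F n) G, hF n, hG] with x e1 e2 e3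
    rw [e1, Pi.sub_apply, e2, e3, real_inner_self_eq_norm_sq, Real.norm_eq_abs, sq_abs]
  have hgb : ∀ᵐ x ∂μ, |g x| ≤ B := by
    filter_upwards [hfg] with x hx
    exact le_of_tendsto hx.abs (Eventually.of_forall fun n => hb n x)
  have h2 : Tendsto (fun n => ∫ x, (f n x - g x) ^ 2 ∂μ) atTop (𝓝 (∫ _, (0 : ℝ) ∂μ)) := by
    refine tendsto_integral_filter_of_dominated_convergence (fun _ => (2 * B) ^ 2) ?_ ?_
      (integrable_const _) ?_
    · refine Eventually.of_forall fun n => ?_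
      exact (((Lp.aestronglyMeasurable (F n)).congr (hF n)).sub
        ((Lp.aestronglyMeasurable G).congr hG)).pow 2
    · refine Eventually.of_forall fun n => ?_
      filter_upwards [hgb] with x hx
      rw [norm_pow]
      refine pow_le_pow_left₀ (norm_nonneg _) ?_ 2
      exact (norm_sub_le _ _).trans ((add_le_add (hb n x) hx).trans (two_mul B).ge)
    · filter_upwards [hfg] with x hx
      have := (hx.sub_const (g x)).pow 2
      simpa using this
  rw [integral_zero] at h2
  have h3 := (h2.congr fun n => (h1 n).symm).sqrt
  simpa [Real.sqrt_sq] using h3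

theorem norm_Lp_two_le_of_ae_bound {X : Type*} [MeasurableSpace X] {μ : Measure X}
    [IsProbabilityMeasure μ] {F : Lp ℝ 2 μ} {C : ℝ} (hC : 0 ≤ C) (h : ∀ᵐ x ∂μ, ‖F x‖ ≤ C) :
    ‖F‖ ≤ C := by
  have h1 : measureUnivNNReal μ = 1 := by simp [measureUnivNNReal]
  have h2 := Lp.norm_le_of_ae_bound hC h
  rwa [h1, NNReal.coe_one, Real.one_rpow, one_mul] at h2

namespace G0

theorem norm_toL2_le_one (g : G0) : ‖g.toL2‖ ≤ 1 := by
  refine norm_Lp_two_le_of_ae_bound zero_le_one ?_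
  filter_upwards [g.coeFn_toL2] with t ht
  rw [ht, Real.norm_of_nonneg (g t).2.1]
  exact (g t).2.2

theorem abs_inner_toL2_le (φ : Lp ℝ 2 (volume : Measure I)) (g : G0) :
    |inner ℝ φ g.toL2| ≤ ‖φ‖ :=
  (abs_real_inner_le_norm _ _).trans (mul_le_of_le_one_right (norm_nonneg _) g.norm_toL2_le_one)

theorem continuous_inner_toL2 (φ : Lp ℝ 2 (volume : Measure I)) :
    Continuous fun g : G0 => inner ℝ φ g.toL2 :=
  continuous_const.inner continuous_toL2

theorem memLp_inner_toL2 (Q : Measure G0) [IsFiniteMeasure Q] (φ : Lp ℝ 2 (volume : Measure I)) :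
    MemLp (fun g : G0 => inner ℝ φ g.toL2) 2 Q :=
  MemLp.of_bound (continuous_inner_toL2 φ).measurable.aestronglyMeasurable ‖φ‖
    (Eventually.of_forall fun g => abs_inner_toL2_le φ g)

end G0

theorem cylinder_mem_gradientGraph {β : ℝ} (hβ : 0 < β) {m : ℕ} {U : (Fin m → ℝ) → ℝ}
    {α : Fin m → ℝ → ℝ} (hU : ContDiff ℝ 1 U) (hα : ∀ i, ContDiff ℝ 1 (α i)) :
    ∃ p ∈ gradientGraph β, p.1 =ᵐ[dirichletProcess β] cylinderFunction U α ∧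
      p.2 =ᵐ[(dirichletProcess β).prod (volume : Measure I)] cylinderGradient U α := by
  have hprob := (isDirichletProcess_dirichletProcess hβ).isProbabilityMeasure
  obtain ⟨B, hB⟩ := G0.exists_bound_cylinderFunction hU.continuous fun i => (hα i).continuous
  obtain ⟨D, hD⟩ := G0.exists_bound_cylinderGradient hU hα
  have h1 : MemLp (cylinderFunction U α) 2 (dirichletProcess β) :=
    MemLp.of_bound (G0.measurable_cylinderFunction hU.continuous
      fun i => (hα i).continuous).aestronglyMeasurable B (Eventually.of_forall hB)
  have h2 : MemLp (cylinderGradient U α) 2 ((dirichletProcess β).prod (volume : Measure I)) :=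
    MemLp.of_bound (G0.measurable_cylinderGradient hU hα).aestronglyMeasurable D
      (Eventually.of_forall hD)
  exact ⟨(h1.toLp _, h2.toLp _), Submodule.le_topologicalClosure _ (Submodule.subset_span
    ⟨m, U, α, hU, hα, h1.coeFn_toLp, h2.coeFn_toLp⟩), h1.coeFn_toLp, h2.coeFn_toLp⟩

/-- The gradients of the approximating cylinder functions converge boundedly to φ(t). The values
need no separate analysis: they follow by integrating the gradients along the segment from the
identity map. -/
theorem continuous_linear_mem_gradientGraph {β : ℝ} (hβ : 0 < β) {φ : ℝ → ℝ} (hφ : Continuous φ)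
    {p : Lp ℝ 2 (dirichletProcess β) × Lp ℝ 2 ((dirichletProcess β).prod (volume : Measure I))}
    (hp1 : p.1 =ᵐ[dirichletProcess β] fun g => ∫ t : I, φ t * g t)
    (hp2 : p.2 =ᵐ[(dirichletProcess β).prod (volume : Measure I)] fun q => φ q.2) :
    p ∈ gradientGraph β := by
  have hQ := isDirichletProcess_dirichletProcess hβ
  have hprob := hQ.isProbabilityMeasure
  obtain ⟨B, hB0, hB⟩ := G0.exists_bound_Icc hφ 0 1
  set Ψ : ℝ → ℝ := fun x => ∫ y in (0 : ℝ)..x, φ y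
  have hΨ : ∀ x, HasDerivAt Ψ (φ x) x := fun x => (hφ.integral_hasStrictDerivAt 0 x).hasDerivAt
  have hΨ1 : ContDiff ℝ 1 Ψ := by
    refine contDiff_one_iff_deriv.2 ⟨fun x => (hΨ x).differentiableAt, ?_⟩
    rwa [show deriv Ψ = φ from funext fun x => (hΨ x).deriv]
  set κ := ∫ t : I, φ t * G0.identity t with hκ
  -- The constant c n is chosen so that each approximant has the exact value κ at the identity map.
  set c : ℕ → ℝ := fun n => κ - cylinderFunction (G0.outerFunction Ψ 0 n) (G0.innerFunction n)
    G0.identity with hc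
  have hU := fun n => G0.contDiff_outerFunction hΨ1 (c n) n
  have hα := G0.contDiff_innerFunction
  set u : ℕ → G0 → ℝ := fun n =>
    cylinderFunction (G0.outerFunction Ψ (c n) n) (G0.innerFunction n) with hu
  have hid : ∀ n, u n G0.identity = κ := by
    intro n
    simp only [hu, hc, cylinderFunction, G0.outerFunction]
    ring
  have hsub : ∀ n, n ≠ 0 → ∀ g, u n g = κ + ∫ s : I, ∫ t,
      G0.smoothAverage φ n (G0.lerp G0.identity g s, t) * (g t - G0.identity t) := by
    intro n hn g
    have h1 := G0.cylinderFunction_sub (hU n) (hα n) G0.identity g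
    simp only [G0.cylinderGradient_outerFunction hΨ _ hn] at h1
    rw [← h1, ← hid n]
    simp only [hu]
    ring
  have hlim : ∀ g, Tendsto (fun n => u (n + 1) g) atTop (𝓝 (∫ t : I, φ t * g t)) := by
    intro g
    have h1 := ((G0.tendsto_integral_smoothAverage hφ g).comp (tendsto_add_atTop_nat 1)).const_add κ
    have hint : ∀ h : G0, Integrable fun t : I => φ t * h t := fun h =>
      Integrable.of_bound (C := B) ((hφ.measurable.comp measurable_subtype_coe).mul
        h.measurable_coe).aestronglyMeasurable (Eventually.of_forall fun t => by
          rw [norm_mul, Real.norm_of_nonneg (h t).2.1]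
          exact (mul_le_mul (hB t t.2) (h t).2.2 (h t).2.1 hB0).trans (mul_one _).le)
    have h2 : κ + ∫ t : I, φ t * ((g t : ℝ) - G0.identity t) = ∫ t : I, φ t * g t := by
      simp only [mul_sub]
      rw [integral_sub (hint g) (hint _)]
      ring
    rw [h2] at h1
    exact h1.congr fun n => (hsub (n + 1) n.succ_ne_zero g).symm
  have hub : ∀ n g, |u (n + 1) g| ≤ |κ| + B := by
    intro n g
    rw [hsub (n + 1) n.succ_ne_zero g]
    refine (abs_add_le _ _).trans (add_le_add le_rfl ?_)
    have hb : ∀ s t : I, ‖G0.smoothAverage φ (n + 1) (G0.lerp G0.identity g s, t) *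
        ((g t : ℝ) - G0.identity t)‖ ≤ B := fun s t => by
      rw [norm_mul]
      exact (mul_le_mul (G0.abs_smoothAverage_le hB _ _) (G0.abs_sub_le_one _ _ _) (abs_nonneg _)
        hB0).trans (mul_one _).le
    have h1 : ∀ s : I, ‖∫ t, G0.smoothAverage φ (n + 1) (G0.lerp G0.identity g s, t) *
        ((g t : ℝ) - G0.identity t)‖ ≤ B := fun s => by
      simpa using norm_integral_le_of_norm_le_const (μ := (volume : Measure I))
        (Eventually.of_forall (hb s))
    simpa using norm_integral_le_of_norm_le_const (μ := (volume : Measure I))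
        (Eventually.of_forall h1)
  choose P hP hP1 hP2 using fun n => cylinder_mem_gradientGraph hβ (hU (n + 1)) (hα (n + 1))
  have ht1 : Tendsto (fun n => (P n).1) atTop (𝓝 p.1) :=
    tendsto_Lp_two_of_bounded hP1 hp1 hub (Eventually.of_forall hlim)
  have ht2 : Tendsto (fun n => (P n).2) atTop (𝓝 p.2) := by
    refine tendsto_Lp_two_of_bounded (f := fun n => G0.smoothAverage φ (n + 1)) (fun n => ?_) hp2
      (fun n => G0.abs_smoothAverage_le hB _) ?_
    · refine (hP2 n).trans (Eventually.of_forall fun q => ?_)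
      exact G0.cylinderGradient_outerFunction hΨ _ n.succ_ne_zero q
    · have h1 : ∀ᵐ q ∂((dirichletProcess β).prod (volume : Measure I)),
          StrictMono (G0.toFun q.1) :=
        Measure.quasiMeasurePreserving_fst.ae hQ.ae_strictMono
      filter_upwards [h1] with q hq
      exact (G0.tendsto_smoothAverage hφ hq q.2).comp (tendsto_add_atTop_nat 1)
  exact (Submodule.isClosed_topologicalClosure _).mem_of_tendsto (ht1.prodMk_nhds ht2)
    (Eventually.of_forall hP)

/-- The functions `g ↦ ⟨φ, g⟩` belong to the domain and have gradient `φ`. -/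
theorem linear_mem_gradientGraph {β : ℝ} (hβ : 0 < β) (φ : Lp ℝ 2 (volume : Measure I))
    {p : Lp ℝ 2 (dirichletProcess β) × Lp ℝ 2 ((dirichletProcess β).prod (volume : Measure I))}
    (hp1 : p.1 =ᵐ[dirichletProcess β] fun g => inner ℝ φ g.toL2)
    (hp2 : p.2 =ᵐ[(dirichletProcess β).prod (volume : Measure I)] fun q => φ q.2) :
    p ∈ gradientGraph β := by
  have hprob := (isDirichletProcess_dirichletProcess hβ).isProbabilityMeasure
  have hsnd : MeasurePreserving Prod.snd ((dirichletProcess β).prod (volume : Measure I)) volume :=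
    measurePreserving_snd
  set J : Lp ℝ 2 (volume : Measure I) → Lp ℝ 2 (dirichletProcess β) ×
      Lp ℝ 2 ((dirichletProcess β).prod (volume : Measure I)) := fun φ =>
    ((G0.memLp_inner_toL2 (dirichletProcess β) φ).toLp _, Lp.compMeasurePreserving Prod.snd hsnd φ)
  have hJ1 : ∀ φ, (J φ).1 =ᵐ[dirichletProcess β] fun g => inner ℝ φ g.toL2 := fun φ =>
    (G0.memLp_inner_toL2 (dirichletProcess β) φ).coeFn_toLp
  have hJ2 : ∀ φ, (J φ).2 =ᵐ[(dirichletProcess β).prod (volume : Measure I)] fun q => φ q.2 :=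
    fun φ => Lp.coeFn_compMeasurePreserving φ hsnd
  have hJ : Continuous J := by
    refine Continuous.prodMk ?_ (Lp.isometry_compMeasurePreserving hsnd).continuous
    refine LipschitzWith.continuous (K := 1) (LipschitzWith.of_dist_le_mul fun φ ψ => ?_)
    rw [NNReal.coe_one, one_mul, dist_eq_norm, dist_eq_norm]
    refine norm_Lp_two_le_of_ae_bound (norm_nonneg (φ - ψ)) ?_
    filter_upwards [Lp.coeFn_sub (J φ).1 (J ψ).1, hJ1 φ, hJ1 ψ] with g e1 e2 e3
    change ‖((J φ).1 - (J ψ).1 : Lp ℝ 2 (dirichletProcess β)) g‖ ≤ _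
    rw [e1, Pi.sub_apply, e2, e3, ← inner_sub_left]
    exact G0.abs_inner_toL2_le _ _
  have hpJ : p = J φ := Prod.ext (Lp.ext (hp1.trans (hJ1 φ).symm)) (Lp.ext (hp2.trans (hJ2 φ).symm))
  rw [hpJ]
  -- J is continuous and the graph closed, so continuous φ suffice.
  refine (ContinuousMap.toLp_denseRange ℝ (volume : Measure I) ℝ
    (p := 2) ENNReal.ofNat_ne_top).induction_on (p := fun φ => J φ ∈ gradientGraph β) φ
    ((Submodule.isClosed_topologicalClosure _).preimage hJ) fun ψ => ?_
  have hψ := ContinuousMap.coeFn_toLp (p := 2) (𝕜 := ℝ) (volume : Measure I) ψ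
  refine continuous_linear_mem_gradientGraph hβ (φ := fun x => ψ (projIcc 0 1 zero_le_one x))
    (ψ.continuous.comp continuous_projIcc) ((hJ1 _).trans ?_) ((hJ2 _).trans ?_)
  · refine Eventually.of_forall fun g => ?_
    simp only [L2.inner_def]
    refine integral_congr_ae ?_
    filter_upwards [hψ, g.coeFn_toL2] with t e1 e2
    rw [e1, e2, projIcc_val]
    exact mul_comm _ _
  · have := hsnd.quasiMeasurePreserving.ae hψ
    filter_upwards [this] with q hq
    rw [hq, projIcc_val]

theorem inner_toL2_mem_intrinsicFunctions {β : ℝ} (hβ : 0 < β) {φ : Lp ℝ 2 (volume : Measure I)}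
    (hφ : ‖φ‖ ≤ 1) : (fun g : G0 => inner ℝ φ g.toL2) ∈ intrinsicFunctions β := by
  have hprob := (isDirichletProcess_dirichletProcess hβ).isProbabilityMeasure
  have hsnd : MeasurePreserving Prod.snd ((dirichletProcess β).prod (volume : Measure I)) volume :=
    measurePreserving_snd
  have h1 := (G0.memLp_inner_toL2 (dirichletProcess β) φ).coeFn_toLp
  have h2 := Lp.coeFn_compMeasurePreserving φ hsnd
  have hmem := linear_mem_gradientGraph hβ φ
    (p := ((G0.memLp_inner_toL2 (dirichletProcess β) φ).toLp _,
      Lp.compMeasurePreserving Prod.snd hsnd φ)) h1 h2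
  rw [← graph_closedGradient hβ, LinearPMap.mem_graph_iff] at hmem
  obtain ⟨v, hv1, hv2⟩ := hmem
  refine ⟨G0.continuous_inner_toL2 φ, v, ?_, ?_⟩
  · rw [hv1]
    exact h1
  · have h3 := Measure.ae_ae_of_ae_prod h2
    filter_upwards [h3] with g hg
    change ∫ t : I, closedGradient β v (g, t) * closedGradient β v (g, t) ≤ 1
    rw [hv2]
    have h4 : ∫ t : I, φ t * φ t = ‖φ‖ ^ 2 := by
      rw [← real_inner_self_eq_norm_sq, L2.inner_def]
      rfl
    refine le_of_eq_of_le (integral_congr_ae (g := fun t => φ t * φ t) ?_) ?_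
    · filter_upwards [hg] with t ht
      simp only [ht, Function.comp_apply]
    · rw [h4]
      exact pow_le_one₀ (norm_nonneg _) hφ

theorem isLUB_intrinsic {β : ℝ} (hβ : 0 < β) (g₀ g₁ : G0) :
    IsLUB {r : ℝ | ∃ u ∈ intrinsicFunctions β, r = u g₁ - u g₀} ‖g₁.toL2 - g₀.toL2‖ := by
  refine ⟨?_, fun b hb => ?_⟩
  · rintro _ ⟨u, hu, rfl⟩
    rw [← G0.dist_eq_norm_toL2]
    exact sub_le_dist_of_mem_intrinsicFunctions hβ hu g₀ g₁
  · set d := g₁.toL2 - g₀.toL2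
    -- The supremum is attained at the unit vector in direction d; for d = 0 the convention 0⁻¹ = 0
    -- gives φ = 0, which is still admissible.
    refine hb ⟨_, inner_toL2_mem_intrinsicFunctions hβ (φ := ‖d‖⁻¹ • d) ?_, ?_⟩
    · rw [norm_smul, norm_inv, norm_norm]
      exact inv_mul_le_one
    · rw [← inner_sub_right, real_inner_smul_left, real_inner_self_eq_norm_sq]
      rcases eq_or_ne ‖d‖ 0 with h | h
      · simp [h]
      · field_simp

end

noncomputable section

/-! ### The Wasserstein distance -/

theorem inverseCDF_le_of_lt {μ : ProbabilityMeasure I} {t s : I}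
    (h : (t : ℝ) < (μ : Measure I).real (Iic s)) : inverseCDF μ t ≤ s := sInf_le h

/-- The infimum need not be attained, so the bound first holds at every s' > s and then at s by
right continuity of the distribution function. -/
theorem le_of_inverseCDF_le {μ : ProbabilityMeasure I} {t s : I} (h : inverseCDF μ t ≤ s) :
    (t : ℝ) ≤ (μ : Measure I).real (Iic s) := by
  rcases eq_or_lt_of_le (show s ≤ 1 from s.2.2) with rfl | hs
  · rw [eq_univ_of_forall (s := Iic (1 : I)) fun t => t.2.2, probReal_univ]
    exact t.2.2
  have h1 : ∀ s', s < s' → (t : ℝ) ≤ (μ : Measure I).real (Iic s') := by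
    intro s' hs'
    obtain ⟨s'', h2, h3⟩ := sInf_lt_iff.1 (h.trans_lt hs' : inverseCDF μ t < s')
    exact (le_of_lt h2).trans (measureReal_mono (Iic_subset_Iic.2 h3.le))
  have h2 : Tendsto (fun s' => (μ : Measure I) (Iic s')) (𝓝[>] s) (𝓝 ((μ : Measure I) (Iic s))) := by
    have h3 := tendsto_measure_biInter_gt (μ := (μ : Measure I)) (s := fun s' : I => Iic s') (a := s)
      (fun _ _ => measurableSet_Iic.nullMeasurableSet) (fun i j _ hij => Iic_subset_Iic.2 hij)
      ⟨1, hs, measure_ne_top _ _⟩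
    have h4 : ⋂ r, ⋂ (_ : r > s), Iic r = Iic s := by
      ext x
      simp only [mem_iInter, mem_Iic]
      exact ⟨fun hx => le_of_forall_gt_imp_ge_of_dense hx, fun hx r hr => hx.trans (le_of_lt hr)⟩
    rwa [h4] at h3
  have : (𝓝[>] s).NeBot := nhdsGT_neBot_of_exists_gt ⟨1, hs⟩
  exact ge_of_tendsto ((ENNReal.tendsto_toReal (measure_ne_top _ _)).comp h2)
    (eventually_nhdsWithin_of_forall h1)

theorem G0.measurable_toFun (g : G0) : Measurable g.toFun := g.monotone'.measurable

/-- The law of the inverse distribution function of `μ` under Lebesgue measure is `μ`. -/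
theorem map_inverseCDF (μ : ProbabilityMeasure I) :
    (volume : Measure I).map (inverseCDF μ).toFun = μ := by
  have : IsProbabilityMeasure ((volume : Measure I).map (inverseCDF μ).toFun) :=
    Measure.isProbabilityMeasure_map (G0.measurable_toFun _).aemeasurable
  refine Measure.ext_of_Iic _ _ fun s => ?_
  rw [Measure.map_apply (G0.measurable_toFun _) measurableSet_Iic]
  set x : I := ⟨(μ : Measure I).real (Iic s), measureReal_nonneg, measureReal_le_one⟩ with hx
  have h0 : (μ : Measure I) (Iic s) = ENNReal.ofReal x :=
    (ENNReal.ofReal_toReal (measure_ne_top _ _)).symm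
  rw [h0]
  -- The preimage of [0, s] lies between [0, x) and [0, x], which have the same length.
  refine le_antisymm ?_ ?_
  · refine (measure_mono (t := Iic x) fun t ht => ?_).trans (by simp)
    exact (le_of_inverseCDF_le ht : (t : ℝ) ≤ _)
  · refine le_trans (by simp) (measure_mono (s := Iio x) fun t ht => ?_)
    exact inverseCDF_le_of_lt ht

/-- Layer cake formula: the product is the area of the rectangle [0, p.1) × [0, p.2), and Tonelli
exchanges the integrals. -/
theorem lintegral_mul_eq_lintegral_Ioi (γ : Measure (I × I)) [SFinite γ] :
    ∫⁻ p, ENNReal.ofReal ((p.1 : ℝ) * p.2) ∂γ = ∫⁻ q : I × I, γ (Ioi q.1 ×ˢ Ioi q.2) := by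
  set S : Set ((I × I) × (I × I)) := {r | r.2.1 < r.1.1 ∧ r.2.2 < r.1.2} with hS
  have hSm : MeasurableSet S := by
    refine (measurableSet_lt ?_ ?_).inter (measurableSet_lt ?_ ?_) <;> fun_prop
  have h1 := Measure.prod_apply (μ := γ) (ν := (volume : Measure (I × I))) hSm
  have h2 := Measure.prod_apply_symm (μ := γ) (ν := (volume : Measure (I × I))) hSm
  have h3 : ∀ p : I × I, ENNReal.ofReal ((p.1 : ℝ) * p.2) =
      (volume : Measure (I × I)) (Prod.mk p ⁻¹' S) := by
    intro p
    have e : Prod.mk p ⁻¹' S = Iio p.1 ×ˢ Iio p.2 := rfl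
    rw [e, Measure.volume_eq_prod, Measure.prod_prod, ENNReal.ofReal_mul p.1.2.1]
    simp
  simp only [h3]
  rw [← h1, h2]
  rfl

/-- Among all couplings of two measures, the monotone one maximizes the correlation. -/
theorem lintegral_mul_le_map_inverseCDF {μ ν : ProbabilityMeasure I} {γ : Measure (I × I)}
    [SFinite γ] (h1 : γ.map Prod.fst = μ) (h2 : γ.map Prod.snd = ν) :
    ∫⁻ p, ENNReal.ofReal ((p.1 : ℝ) * p.2) ∂γ ≤
      ∫⁻ t : I, ENNReal.ofReal ((inverseCDF μ t : ℝ) * inverseCDF ν t) := by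
  have hm : Measurable fun t : I => (inverseCDF μ t, inverseCDF ν t) :=
    (G0.measurable_toFun _).prodMk (G0.measurable_toFun _)
  have h3 := lintegral_mul_eq_lintegral_Ioi
    ((volume : Measure I).map fun t : I => (inverseCDF μ t, inverseCDF ν t))
  rw [lintegral_map (by fun_prop) hm] at h3
  rw [h3, lintegral_mul_eq_lintegral_Ioi]
  refine lintegral_mono fun q => ?_
  rw [Measure.map_apply hm (measurableSet_Ioi.prod measurableSet_Ioi)]
  have e1 : γ (Ioi q.1 ×ˢ Ioi q.2) ≤ volume ((inverseCDF μ).toFun ⁻¹' Ioi q.1) := by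
    rw [← Measure.map_apply (G0.measurable_toFun _) measurableSet_Ioi, map_inverseCDF, ← h1,
      Measure.map_apply measurable_fst measurableSet_Ioi]
    exact measure_mono fun p hp => hp.1
  have e2 : γ (Ioi q.1 ×ˢ Ioi q.2) ≤ volume ((inverseCDF ν).toFun ⁻¹' Ioi q.2) := by
    rw [← Measure.map_apply (G0.measurable_toFun _) measurableSet_Ioi, map_inverseCDF, ← h2,
      Measure.map_apply measurable_snd measurableSet_Ioi]
    exact measure_mono fun p hp => hp.2
  have u1 : IsUpperSet ((inverseCDF μ).toFun ⁻¹' Ioi q.1) := fun a b hab ha =>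
    lt_of_lt_of_le (mem_Ioi.1 ha) ((inverseCDF μ).monotone' hab)
  have u2 : IsUpperSet ((inverseCDF ν).toFun ⁻¹' Ioi q.2) := fun a b hab ha =>
    lt_of_lt_of_le (mem_Ioi.1 ha) ((inverseCDF ν).monotone' hab)
  rcases u1.total u2 with h | h
  -- Any coupling gives a quadrant at most the smaller of its marginal masses. For the monotone
  -- coupling the two preimages are up-sets of a chain, hence nested, so that bound is attained.
  · exact e1.trans (measure_mono fun t ht => ⟨ht, h ht⟩)
  · exact e2.trans (measure_mono fun t ht => ⟨h ht, ht⟩)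

theorem isProbabilityMeasure_of_map_fst {μ : ProbabilityMeasure I} {γ : Measure (I × I)}
    (h1 : γ.map Prod.fst = μ) : IsProbabilityMeasure γ := by
  have : IsProbabilityMeasure (γ.map Prod.fst) := h1 ▸ inferInstance
  exact Measure.isProbabilityMeasure_of_map Prod.fst

/-- Expanding the square, only the correlation depends on the coupling, so minimal cost means
maximal correlation. -/
theorem integral_sub_sq_coupling {μ ν : ProbabilityMeasure I} {γ : Measure (I × I)}
    (h1 : γ.map Prod.fst = μ) (h2 : γ.map Prod.snd = ν) :
    ∫ p, ((p.1 : ℝ) - p.2) ^ 2 ∂γ = ∫ x : I, (x : ℝ) ^ 2 ∂(μ : Measure I) +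
      ∫ y : I, (y : ℝ) ^ 2 ∂(ν : Measure I) -
        2 * (∫⁻ p, ENNReal.ofReal ((p.1 : ℝ) * p.2) ∂γ).toReal := by
  have hprob := isProbabilityMeasure_of_map_fst h1
  have hi : ∀ f : I × I → ℝ, Measurable f → (∀ p, f p ∈ Icc (0 : ℝ) 1) → Integrable f γ :=
    fun f hf hb => Integrable.of_bound hf.aestronglyMeasurable 1 (Eventually.of_forall fun p => by
      rw [Real.norm_of_nonneg (hb p).1]; exact (hb p).2)
  have i1 : Integrable (fun p : I × I => (p.1 : ℝ) ^ 2) γ := hi _ (by fun_prop) fun p =>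
    ⟨sq_nonneg _, pow_le_one₀ p.1.2.1 p.1.2.2⟩
  have i2 : Integrable (fun p : I × I => (p.2 : ℝ) ^ 2) γ := hi _ (by fun_prop) fun p =>
    ⟨sq_nonneg _, pow_le_one₀ p.2.2.1 p.2.2.2⟩
  have i3 : Integrable (fun p : I × I => (p.1 : ℝ) * p.2) γ := hi _ (by fun_prop) fun p =>
    ⟨mul_nonneg p.1.2.1 p.2.2.1, mul_le_one₀ p.1.2.2 p.2.2.1 p.2.2.2⟩
  rw [← integral_eq_lintegral_of_nonneg_ae
    (Eventually.of_forall fun p => mul_nonneg p.1.2.1 p.2.2.1) i3.aestronglyMeasurable,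
    ← h1, ← h2, integral_map measurable_fst.aemeasurable (by fun_prop),
    integral_map measurable_snd.aemeasurable (by fun_prop), ← integral_const_mul,
    ← integral_add i1 i2, ← integral_sub (by exact i1.add i2) (i3.const_mul 2)]
  refine integral_congr_ae (Eventually.of_forall fun p => ?_)
  ring

/-- The law γ₀ of the pair of inverse distribution functions is a coupling whose cost is the squared
L² distance, and it maximizes the correlation; the infimum is thus attained. -/
theorem wassersteinDist_eq (μ ν : ProbabilityMeasure I) :
    wassersteinDist μ ν = ‖(inverseCDF ν).toL2 - (inverseCDF μ).toL2‖ := by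
  have hm : Measurable fun t : I => (inverseCDF μ t, inverseCDF ν t) :=
    (G0.measurable_toFun _).prodMk (G0.measurable_toFun _)
  set γ₀ := (volume : Measure I).map fun t : I => (inverseCDF μ t, inverseCDF ν t) with hγ₀
  have hf : γ₀.map Prod.fst = μ := by
    rw [hγ₀, Measure.map_map measurable_fst hm]
    exact map_inverseCDF μ
  have hs : γ₀.map Prod.snd = ν := by
    rw [hγ₀, Measure.map_map measurable_snd hm]
    exact map_inverseCDF ν
  have hval : ∫ p, ((p.1 : ℝ) - p.2) ^ 2 ∂γ₀ = ‖(inverseCDF ν).toL2 - (inverseCDF μ).toL2‖ ^ 2 := by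
    rw [norm_sub_rev, G0.norm_toL2_sub_sq, hγ₀, integral_map hm.aemeasurable (by fun_prop)]
  have hnorm : ‖(inverseCDF ν).toL2 - (inverseCDF μ).toL2‖ =
      √(∫ p, ((p.1 : ℝ) - p.2) ^ 2 ∂γ₀) := by
    rw [hval, Real.sqrt_sq (norm_nonneg _)]
  refine IsLeast.csInf_eq ⟨⟨γ₀, hf, hs, hnorm⟩, ?_⟩
  rintro r ⟨γ, h1, h2, rfl⟩
  rw [hnorm]
  refine Real.sqrt_le_sqrt ?_
  have hprob := isProbabilityMeasure_of_map_fst h1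
  rw [integral_sub_sq_coupling hf hs, integral_sub_sq_coupling h1 h2]
  have h3 := lintegral_mul_le_map_inverseCDF h1 h2
  have h4 : ∫⁻ p, ENNReal.ofReal ((p.1 : ℝ) * p.2) ∂γ₀ =
      ∫⁻ t : I, ENNReal.ofReal ((inverseCDF μ t : ℝ) * inverseCDF ν t) := by
    rw [hγ₀, lintegral_map (by fun_prop) hm]
  have h5 : ∫⁻ t : I, ENNReal.ofReal ((inverseCDF μ t : ℝ) * inverseCDF ν t) ≠ ∞ := by
    refine ne_top_of_le_ne_top (b := ∫⁻ _ : I, 1) (by simp) (lintegral_mono fun t => ?_)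
    rw [← ENNReal.ofReal_one]
    exact ENNReal.ofReal_le_ofReal (mul_le_one₀ (inverseCDF μ t).2.2 (inverseCDF ν t).2.1
      (inverseCDF ν t).2.2)
  rw [h4]
  have := ENNReal.toReal_mono h5 h3
  linarith

end

theorem mainTheorem4 (β : ℝ) (hβ : 0 < β) :
    (∀ g₀ g₁ : G0,
      IsLUB {r : ℝ | ∃ u ∈ intrinsicFunctions β, r = u g₁ - u g₀} ‖g₁.toL2 - g₀.toL2‖) ∧
    (∀ μ ν : ProbabilityMeasure I,
      IsLUB {r : ℝ | ∃ u ∈ intrinsicFunctions β, r = u (inverseCDF ν) - u (inverseCDF μ)}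
        (wassersteinDist μ ν)) := by
  refine ⟨isLUB_intrinsic hβ, fun μ ν => ?_⟩
  rw [wassersteinDist_eq]
  exact isLUB_intrinsic hβ _ _
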